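/- **Setting.** Let $G=(A\cup B,E)$ be a bipartite graph with $|A|=|B|=n$ and $|E|=m$, in which every agent $a\in A$ has a strict partial order $\succ_a$ over her neighbours; objects $b\in B$ have no preferences. A matching may leave nodes unmatched; an *assignment* is a perfect matching in $G$. For a positive integer $\kappa$ and matchings $N,M$ in $G$, let $\mathsf{vote}^\kappa_a(N,M)$ be $1$ (resp. $-1$) if $a$ is matched in both and $N(a)\succ_a M(a)$ (resp. $M(a)\succ_a N(a)$), $\kappa$ if $a$ is matched in $N$ but not in $M$, $-\kappa$ if $a$ is matched in $M$ but not in $N$, and $0$ otherwise. A matching $M$ is *popular with penalty $\kappa$* if $\sum_{a\in A}\mathsf{vote}^\kappa_a(N,M)\le 0$ for every matching $N$ in $G$. **Algorithm.** For $\ell:B\to\mathbb N$ let $\ell^*(a)$ be the maximum of $\ell$ over the neighbours of $a$, and let $G_\ell$ consist of the edges $(a,b)\in E$ such that either (i) $\ell(b)=\ell^*(a)$ and $a$ prefers no neighbour at level $\ell^*(a)$ to $b$; or (ii) $\ell(b)=\ell^*(a)-1$, $a$ prefers $b$ to all her neighbours at level $\ell^*(a)$, and $a$ prefers no neighbour at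 level $\ell^*(a)-1$ to $b$. The *popular assignment algorithm* starts with $\ell=0$. As long as $\ell(b)<n$ for all $b\in B$, it computes a maximum matching $M$ in $G_\ell$; if $M$ is perfect it returns $M$, and otherwise it increases $\ell(b)$ by $1$ for every object $b$ that is unmatched in $M$, and repeats. When the loop ends without returning a matching, it rejects. The *$(\kappa+1)$-level truncation* also ends the loop, and rejects, as soon as some object has level $\kappa+1$. **Theorem.** Let $\kappa$ be a positive integer. 1. For every choice of the maximum matchings, the $(\kappa+1)$-level truncation terminates. Every matching that it returns is an assignment that is popular with penalty $\kappa$ (against all matchings in $G$), and it returns one whenever $G$ admits such an assignment. 2. It runs in time $O(\kappa\cdot m\cdot n^{3/2})$. Precisely: there are one program for a unit-cost word RAM with words of $O(\log(n+\kappa))$ bits, and one constant $C$, such that for all $\kappa\ge1$ and all instances $G$ with $1\le n\le m$ (in particular, all those with $n\ge 1$ that admit an assignment), given with random access to the adjacency matrix and to the preference comparisons, the program carries out a complete execution of the $(\kappa+1)$-level truncation on $G$, printing the levels and the matching of every iteration and the final result, and halts after at most $C\cdot\kappa\cdot m\cdot n^{3/2}$ steps. -/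

import Mathlib

namespace PopAssign

/-! ### Instances, matchings, popularity with penalty -/

/-- A bipartite graph between agents `A` and objects `B`, in which every agent `a` has a strict
partial order over her neighbours: `pref a b b'` means that `a` prefers `b` to `b'`. -/
structure Instance (A B : Type*) where
  Adj : A → B → Prop
  pref : A → B → B → Prop
  pref_adj : ∀ a b b', pref a b b' → Adj a b ∧ Adj a b'
  pref_irrefl : ∀ a b, ¬ pref a b b
  pref_trans : ∀ a b b' b'', pref a b b' → pref a b' b'' → pref a b b''

/-- Matchings are partial bijections `M : A ≃. B`; `M a` is the partner of the agent `a`, and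
`M.symm b` the partner of the object `b`. `M` is a matching in the bipartite graph with edge
relation `R` if it uses only edges of `R`. -/
def IsMatching {A B : Type*} (R : A → B → Prop) (M : A ≃. B) : Prop :=
  ∀ a b, M a = some b → R a b

/-- The number of edges of a matching. -/
def msize {A B : Type*} [Fintype A] (M : A ≃. B) : ℕ :=
  (Finset.univ.filter (fun a => (M a).isSome)).card

/-- A maximum (cardinality) matching in the bipartite graph with edge relation `R`. -/
def IsMaximumMatching {A B : Type*} [Fintype A] (R : A → B → Prop) (M : A ≃. B) : Prop :=
  IsMatching R M ∧ ∀ N : A ≃. B, IsMatching R N → msize N ≤ msize M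

/-- Every node is matched. -/
def IsPerfect {A B : Type*} (M : A ≃. B) : Prop :=
  (∀ a, (M a).isSome) ∧ ∀ b, (M.symm b).isSome

namespace Instance

variable {A B : Type*} (G : Instance A B)

/-- An assignment is a perfect matching in `G`. -/
def IsAssignment (M : A ≃. B) : Prop :=
  IsMatching G.Adj M ∧ IsPerfect M

open Classical in
/-- The number of edges. -/
noncomputable def numEdges [Fintype A] [Fintype B] : ℕ :=
  (Finset.univ.filter (fun e : A × B => G.Adj e.1 e.2)).card

open Classical in
/-- The vote of agent `a` between `N` and `M`, with weight `κ` if exactly one of the two matchings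
leaves `a` unmatched. -/
noncomputable def vote (κ : ℕ) (N M : A ≃. B) (a : A) : ℤ :=
  match N a, M a with
  | some b, some b' => if G.pref a b b' then 1 else if G.pref a b' b then -1 else 0
  | some _, none => (κ : ℤ)
  | none, some _ => -(κ : ℤ)
  | none, none => 0

/-- `M` is a matching that does not lose against any matching `N` in `G`. -/
def PopularWithPenalty [Fintype A] (κ : ℕ) (M : A ≃. B) : Prop :=
  IsMatching G.Adj M ∧ ∀ N : A ≃. B, IsMatching G.Adj N → ∑ a, G.vote κ N M a ≤ 0

/-! ### The truncated algorithm -/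

open Classical in
/-- The highest level at which `a` has a neighbour. -/
noncomputable def topLevel [Fintype B] (ℓ : B → ℕ) (a : A) : ℕ :=
  (Finset.univ.filter (fun b => G.Adj a b)).sup ℓ

/-- The edges of the subgraph `G_ℓ` induced by the level function `ℓ`. -/
def LevelEdge [Fintype B] (ℓ : B → ℕ) (a : A) (b : B) : Prop :=
  G.Adj a b ∧
    ((ℓ b = G.topLevel ℓ a ∧
        ∀ b', G.Adj a b' → ℓ b' = G.topLevel ℓ a → ¬ G.pref a b' b) ∨
     (ℓ b + 1 = G.topLevel ℓ a ∧
        (∀ b', G.Adj a b' → ℓ b' = G.topLevel ℓ a → G.pref a b b') ∧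
        (∀ b', G.Adj a b' → ℓ b' + 1 = G.topLevel ℓ a → ¬ G.pref a b' b)))

end Instance

/-- The level of every object that is unmatched in `M` is increased by one. -/
def raiseLevels {A B : Type*} (ℓ : B → ℕ) (M : A ≃. B) (b : B) : ℕ :=
  if (M.symm b).isSome then ℓ b else ℓ b + 1

/-- Configurations of the algorithm: about to test the condition of the while-loop; just after the
computation of the matching `M` in `G_ℓ`; halted, with an assignment or with a rejection. -/
inductive Conf (A B : Type*) where
  | test (ℓ : B → ℕ) : Conf A B
  | matched (ℓ : B → ℕ) (M : A ≃. B) : Conf A B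
  | halt (o : Option (A ≃. B)) : Conf A B

/-- The steps of the `t`-level truncation of the popular assignment algorithm: the while-loop runs
as long as all levels are less than `n = |B|`, and also less than `t`. In each iteration an
arbitrary maximum matching of `G_ℓ` may be computed. -/
inductive Step {A B : Type*} [Fintype A] [Fintype B] (G : Instance A B) (t : ℕ) :
    Conf A B → Conf A B → Prop where
  | enter (ℓ : B → ℕ) (M : A ≃. B) :
      (∀ b, ℓ b < Fintype.card B ∧ ℓ b < t) → IsMaximumMatching (G.LevelEdge ℓ) M →
      Step G t (Conf.test ℓ) (Conf.matched ℓ M)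
  | exit (ℓ : B → ℕ) :
      ¬ (∀ b, ℓ b < Fintype.card B ∧ ℓ b < t) →
      Step G t (Conf.test ℓ) (Conf.halt none)
  | accept (ℓ : B → ℕ) (M : A ≃. B) :
      IsPerfect M → Step G t (Conf.matched ℓ M) (Conf.halt (some M))
  | raise (ℓ : B → ℕ) (M : A ≃. B) :
      ¬ IsPerfect M → Step G t (Conf.matched ℓ M) (Conf.test (raiseLevels ℓ M))

/-- Initially all levels are zero. -/
def Conf.start {A B : Type*} : Conf A B := Conf.test (fun _ => 0)

/-- Every execution of the `t`-level truncation that begins in a given configuration (whatever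
maximum matchings are chosen) terminates, and it halts with an outcome that satisfies `P`. -/
inductive AlwaysHaltsWith {A B : Type*} [Fintype A] [Fintype B] (G : Instance A B) (t : ℕ)
    (P : Option (A ≃. B) → Prop) : Conf A B → Prop where
  | halt (o : Option (A ≃. B)) : P o → AlwaysHaltsWith G t P (Conf.halt o)
  | step (c : Conf A B) : (∃ c', Step G t c c') →
      (∀ c', Step G t c c' → AlwaysHaltsWith G t P c') → AlwaysHaltsWith G t P c

/-- `cs` is a complete execution of the `t`-level truncation, from the start to a halt. -/
def IsCompleteRun {A B : Type*} [Fintype A] [Fintype B] (G : Instance A B) (t : ℕ)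
    (cs : List (Conf A B)) : Prop :=
  cs.IsChain (Step G t) ∧ cs.head? = some Conf.start ∧
    ∃ o : Option (A ≃. B), cs.getLast? = some (Conf.halt o)

/-! ### A word RAM with a step count

A program uses finitely many registers and finitely many arrays of words. -/

/-- Arithmetic expressions; `var x` is register `x`, and `get r e` is the word at position `e` of
the array `r`. -/
inductive Expr where
  | lit (k : ℕ) : Expr
  | var (x : ℕ) : Expr
  | get (r : ℕ) (e : Expr) : Expr
  | add (e e' : Expr) : Expr
  | sub (e e' : Expr) : Expr
  | mul (e e' : Expr) : Expr

/-- Programs. `ite e e' c d` runs `c` if `e < e'`, and `d` otherwise; `loop e e' c` runs `c` as long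
as `e < e'`; `emit e` appends the value of `e` to the output. -/
inductive Prog where
  | skip : Prog
  | assign (x : ℕ) (e : Expr) : Prog
  | put (r : ℕ) (e e' : Expr) : Prog
  | emit (e : Expr) : Prog
  | seq (c d : Prog) : Prog
  | ite (e e' : Expr) (c d : Prog) : Prog
  | loop (e e' : Expr) (c : Prog) : Prog

/-- Memory and output of the machine. -/
structure State where
  reg : ℕ → ℕ
  arr : ℕ → ℕ → ℕ
  out : List ℕ

namespace Expr

/-- The value of an expression (subtraction is truncated at zero). -/
def eval (σ : State) : Expr → ℕ
  | lit k => k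
  | var x => σ.reg x
  | get r e => σ.arr r (e.eval σ)
  | add e e' => e.eval σ + e'.eval σ
  | sub e e' => e.eval σ - e'.eval σ
  | mul e e' => e.eval σ * e'.eval σ

/-- The number of unit-cost operations needed to evaluate an expression. -/
def cost : Expr → ℕ
  | lit _ => 1
  | var _ => 1
  | get _ e => e.cost + 1
  | add e e' => e.cost + e'.cost + 1
  | sub e e' => e.cost + e'.cost + 1
  | mul e e' => e.cost + e'.cost + 1

/-- No value that occurs in the evaluation exceeds the largest machine word `W`. -/
def Fits (W : ℕ) (σ : State) : Expr → Prop
  | lit k => k ≤ W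
  | var x => σ.reg x ≤ W
  | get r e => e.Fits W σ ∧ σ.arr r (e.eval σ) ≤ W
  | add e e' => e.Fits W σ ∧ e'.Fits W σ ∧ e.eval σ + e'.eval σ ≤ W
  | sub e e' => e.Fits W σ ∧ e'.Fits W σ
  | mul e e' => e.Fits W σ ∧ e'.Fits W σ ∧ e.eval σ * e'.eval σ ≤ W

end Expr

/-- `Exec W c σ t σ'`: with words in `{0, …, W}`, the program `c` started in `σ` halts in `σ'` after
`t` steps. There is no rule for an expression that overflows: such a program is stuck. -/
inductive Exec (W : ℕ) : Prog → State → ℕ → State → Prop where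
  | skip (σ : State) : Exec W Prog.skip σ 1 σ
  | assign (x : ℕ) (e : Expr) (σ : State) : e.Fits W σ →
      Exec W (Prog.assign x e) σ (e.cost + 1)
        ⟨Function.update σ.reg x (e.eval σ), σ.arr, σ.out⟩
  | put (r : ℕ) (e e' : Expr) (σ : State) : e.Fits W σ → e'.Fits W σ →
      Exec W (Prog.put r e e') σ (e.cost + e'.cost + 1)
        ⟨σ.reg, Function.update σ.arr r (Function.update (σ.arr r) (e.eval σ) (e'.eval σ)), σ.out⟩
  | emit (e : Expr) (σ : State) : e.Fits W σ →
      Exec W (Prog.emit e) σ (e.cost + 1) ⟨σ.reg, σ.arr, σ.out ++ [e.eval σ]⟩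
  | seq (c d : Prog) (σ σ₁ σ₂ : State) (t₁ t₂ : ℕ) :
      Exec W c σ t₁ σ₁ → Exec W d σ₁ t₂ σ₂ → Exec W (Prog.seq c d) σ (t₁ + t₂) σ₂
  | ite_true (e e' : Expr) (c d : Prog) (σ σ₁ : State) (t : ℕ) :
      e.Fits W σ → e'.Fits W σ → e.eval σ < e'.eval σ → Exec W c σ t σ₁ →
      Exec W (Prog.ite e e' c d) σ (e.cost + e'.cost + 1 + t) σ₁
  | ite_false (e e' : Expr) (c d : Prog) (σ σ₁ : State) (t : ℕ) :
      e.Fits W σ → e'.Fits W σ → ¬ e.eval σ < e'.eval σ → Exec W d σ t σ₁ →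
      Exec W (Prog.ite e e' c d) σ (e.cost + e'.cost + 1 + t) σ₁
  | loop_true (e e' : Expr) (c : Prog) (σ σ₁ σ₂ : State) (t₁ t₂ : ℕ) :
      e.Fits W σ → e'.Fits W σ → e.eval σ < e'.eval σ →
      Exec W c σ t₁ σ₁ → Exec W (Prog.loop e e' c) σ₁ t₂ σ₂ →
      Exec W (Prog.loop e e' c) σ (e.cost + e'.cost + 1 + t₁ + t₂) σ₂
  | loop_false (e e' : Expr) (c : Prog) (σ : State) :
      e.Fits W σ → e'.Fits W σ → ¬ e.eval σ < e'.eval σ →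
      Exec W (Prog.loop e e' c) σ (e.cost + e'.cost + 1) σ

/-! ### Input and output of the implementation -/

open Classical in
/-- The initial memory: register `0` holds the number `n` of agents, register `1` the penalty `κ`,
array `0` the adjacency matrix, and array `1` the table of preferences; all other cells are zero. -/
noncomputable def inputState {n : ℕ} (G : Instance (Fin n) (Fin n)) (κ : ℕ) : State where
  reg x := if x = 0 then n else if x = 1 then κ else 0
  arr r i :=
    if r = 0 then
      if ∃ a b : Fin n, i = a * n + b ∧ G.Adj a b then 1 else 0
    else if r = 1 then
      if ∃ a b b' : Fin n, i = (a * n + b) * n + b' ∧ G.pref a b b' then 1 else 0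
    else 0
  out := []

/-- The partners of agents `0, …, n - 1`, as numbers: `0` for unmatched, `j + 1` for object `j`. -/
def encodeMatching {n : ℕ} (M : Fin n ≃. Fin n) : List ℕ :=
  List.ofFn (fun a : Fin n => match M a with
    | none => 0
    | some b => (b : ℕ) + 1)

/-- What an implementation prints in each configuration: in every iteration the current levels and
the computed matching, and finally the result. -/
def encodeConf {n : ℕ} : Conf (Fin n) (Fin n) → List ℕ
  | Conf.test _ => []
  | Conf.matched ℓ M => 2 :: (List.ofFn ℓ ++ encodeMatching M)
  | Conf.halt none => [0]
  | Conf.halt (some M) => 1 :: encodeMatching M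

/-- With words in `{0, …, W}`, the program `p` on input `(G, κ)` carries out, and prints, a complete
execution of the `t`-level truncation, and it halts within `T` steps. -/
def ExecutesWithin (p : Prog) (W : ℕ) {n : ℕ} (G : Instance (Fin n) (Fin n)) (κ t : ℕ)
    (T : ℝ) : Prop :=
  ∃ (σ : State) (s : ℕ), Exec W p (inputState G κ) s σ ∧ (s : ℝ) ≤ T ∧
    ∃ cs : List (Conf (Fin n) (Fin n)), IsCompleteRun G t cs ∧ σ.out = cs.flatMap encodeConf

end PopAssign

/-! Correctness is linear programming duality. Let gain(a, b, b') in {-1, 0, 1} be the vote of a for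
b' against b. Rules (i) and (ii) say precisely that (a, b) is an edge of G_ℓ iff gain(a, b, b') +
ℓ(b') ≤ ℓ(b) for all neighbours b' of a (`Instance.levelEdge_iff`). Hence levels in {0, …, κ} with a
perfect matching M in G_ℓ certify that M is popular: summing these inequalities along any N bounds
the votes for N by Σ ℓ + Σ (κ - ℓ) - nκ = 0 (`Instance.popular_of_levels`).

Conversely, let M be a popular assignment, and let the objects be the nodes of a digraph with an arc
from b to every neighbour b' of the partner of b, weighted by her vote for b' against b. A positive
cycle, or a path of weight more than κ, would yield a matching that beats M. The maximal weights of
simple paths are therefore levels of at most κ (`exists_potential`,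
`Instance.exists_levels_of_popular`), and closing their gaps makes them less than n
(`Instance.exists_small_levels`). The algorithm never rises above such a certificate: an unmatched
object that had already reached its certified level could be covered by exchanging M with the
certified matching on the agents concerned (`Instance.level_lt_of_unmatched`). So it rejects only
when no certificate exists.

For the running time, every iteration that does not halt raises an object, so there are O(κn)
iterations. Each one computes a maximum matching in time O(m√n). A labelling phase with about √n
labels leaves a deficiency of at most about √n (`PushInv.bound`), and each missing edge is found by
one breadth-first search. The edges of G_ℓ are recognised in constant time from maxima of levels
that are maintained under increases. Raising b costs O(n) for each neighbour of b, which adds up to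
O(κmn).

The program is verified for unbounded words by invariants and potentials that pay for the steps. A
syntactic criterion then shows that polynomially bounded words suffice (`Run.exec`): stored values
exceed earlier ones by at most the time spent. -/

namespace PopAssign

open Finset

/-! ### Votes, levels and duality. -/

section Correctness

variable {A B : Type*}

namespace Instance

variable (G : Instance A B)

open Classical in
/-- The vote of `a` for `b'` against `b`. -/
noncomputable def gain (a : A) (b b' : B) : ℤ :=
  if G.pref a b' b then 1 else if G.pref a b b' then -1 else 0

lemma gain_le_one (a : A) (b b' : B) : G.gain a b b' ≤ 1 := by
  unfold gain; split_ifs <;> norm_num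

lemma neg_one_le_gain (a : A) (b b' : B) : -1 ≤ G.gain a b b' := by
  unfold gain; split_ifs <;> norm_num

lemma pref_asymm {a : A} {b b' : B} (h : G.pref a b b') : ¬ G.pref a b' b :=
  fun h' => G.pref_irrefl _ _ (G.pref_trans _ _ _ _ h h')

lemma gain_self (a : A) (b : B) : G.gain a b b = 0 := by
  simp [gain, G.pref_irrefl]

lemma gain_swap (a : A) (b b' : B) : G.gain a b' b = -G.gain a b b' := by
  unfold gain
  by_cases h : G.pref a b b'
  · simp [h, G.pref_asymm h]
  · by_cases h' : G.pref a b' b <;> simp [h, h']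

lemma gain_le_zero {a : A} {b b' : B} : G.gain a b b' ≤ 0 ↔ ¬ G.pref a b' b := by
  unfold gain; split_ifs <;> simp_all

lemma gain_le_neg_one {a : A} {b b' : B} : G.gain a b b' ≤ -1 ↔ G.pref a b b' := by
  unfold gain
  by_cases h : G.pref a b' b
  · simp [h, G.pref_asymm h]
  · simp only [h, if_false]; split_ifs <;> simp_all

lemma vote_some (κ : ℕ) {N M : A ≃. B} {a : A} {b b' : B} (hN : N a = some b')
    (hM : M a = some b) : G.vote κ N M a = G.gain a b b' := by
  simp [vote, hN, hM, gain]

lemma vote_none (κ : ℕ) {N M : A ≃. B} {a : A} {b : B} (hN : N a = none)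
    (hM : M a = some b) : G.vote κ N M a = -κ := by
  simp [vote, hN, hM]

variable [Fintype B]

lemma le_topLevel (ℓ : B → ℕ) {a : A} {b : B} (h : G.Adj a b) : ℓ b ≤ G.topLevel ℓ a := by
  classical
  exact Finset.le_sup (f := ℓ) (by simp [h])

lemma exists_topLevel (ℓ : B → ℕ) {a : A} {b : B} (h : G.Adj a b) :
    ∃ b', G.Adj a b' ∧ ℓ b' = G.topLevel ℓ a := by
  classical
  obtain ⟨b', hb', e⟩ := Finset.exists_mem_eq_sup (univ.filter (fun b => G.Adj a b))
    ⟨b, by simp [h]⟩ ℓ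
  exact ⟨b', by simpa using hb', e.symm⟩

/-- Since gains lie between -1 and 1, the inequalities put b at most one level below the top. The
two possible heights of b then give the two rules, and levels further down impose nothing. This is
the dual feasibility condition on which everything else rests. -/
lemma levelEdge_iff (ℓ : B → ℕ) (a : A) (b : B) :
    G.LevelEdge ℓ a b ↔ G.Adj a b ∧ ∀ b', G.Adj a b' → G.gain a b b' + ℓ b' ≤ ℓ b := by
  constructor
  · rintro ⟨h, hc⟩
    refine ⟨h, fun b' hb' => ?_⟩
    have h1 := G.le_topLevel ℓ hb'
    have h2 := G.gain_le_one a b b'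
    rcases hc with ⟨e, hc⟩ | ⟨e, hp, hc⟩
    · rcases h1.eq_or_lt with h3 | h3
      · have := G.gain_le_zero.2 (hc b' hb' h3)
        omega
      · omega
    · rcases h1.eq_or_lt with h3 | h3
      · have := G.gain_le_neg_one.2 (hp b' hb' h3)
        omega
      · by_cases h4 : ℓ b' + 1 = G.topLevel ℓ a
        · have := G.gain_le_zero.2 (hc b' hb' h4)
          omega
        · omega
  · rintro ⟨h, hc⟩
    obtain ⟨b0, hb0, e0⟩ := G.exists_topLevel ℓ h
    have h1 := G.le_topLevel ℓ h
    have h2 := hc b0 hb0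
    have h3 := G.neg_one_le_gain a b b0
    refine ⟨h, ?_⟩
    by_cases h4 : ℓ b = G.topLevel ℓ a
    · refine Or.inl ⟨h4, fun b' hb' e => G.gain_le_zero.1 ?_⟩
      have := hc b' hb'
      omega
    · refine Or.inr ⟨by omega, fun b' hb' e => G.gain_le_neg_one.1 ?_,
        fun b' hb' e => G.gain_le_zero.1 ?_⟩
      · have := hc b' hb'
        omega
      · have := hc b' hb'
        omega

end Instance

/-! ### Summation over matchings -/

lemma pequiv_elim_eq_sum [Fintype B] (N : A ≃. B) (f : B → ℕ) (a : A) :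
    (N a).elim 0 f = ∑ b, (open Classical in if N a = some b then f b else 0) := by
  classical
  rcases h : N a with _ | b
  · simp
  · simp

lemma pequiv_sum_eq [Fintype A] (N : A ≃. B) (f : B → ℕ) (b : B) :
    ∑ a, (open Classical in if N a = some b then f b else 0) =
      if (N.symm b).isSome then f b else 0 := by
  classical
  rcases h : N.symm b with _ | a
  · have : ∀ a, N a ≠ some b := fun a ha => by
      rw [← N.eq_some_iff, h] at ha; simp at ha
    simp [this]
  · have : ∀ a', N a' = some b ↔ a' = a := fun a' => by
      rw [← N.eq_some_iff, h]; simp [eq_comm]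
    simp [this]

/-- Double counting: an object is the partner of at most one agent. -/
lemma pequiv_sum_elim [Fintype A] [Fintype B] (N : A ≃. B) (f : B → ℕ) :
    ∑ a, (N a).elim 0 f = ∑ b, if (N.symm b).isSome then f b else 0 := by
  simp_rw [pequiv_elim_eq_sum]
  rw [Finset.sum_comm]
  exact Finset.sum_congr rfl fun b _ => pequiv_sum_eq N f b

lemma pequiv_sum_elim_le [Fintype A] [Fintype B] (N : A ≃. B) (f : B → ℕ) :
    ∑ a, (N a).elim 0 f ≤ ∑ b, f b := by
  rw [pequiv_sum_elim]
  exact Finset.sum_le_sum fun b _ => by split_ifs <;> simp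

lemma msize_eq_sum [Fintype A] (N : A ≃. B) : msize N = ∑ a, (N a).elim 0 (fun _ => 1) := by
  rw [msize, Finset.card_filter]
  refine Finset.sum_congr rfl fun a _ => ?_
  rcases N a with _ | b <;> simp

/-- Levels of at most `κ` that support a perfect matching certify that it is popular. -/
lemma Instance.popular_of_levels [Fintype A] [Fintype B] (G : Instance A B) {κ : ℕ}
    (hcard : Fintype.card A = Fintype.card B) {ℓ : B → ℕ} (hℓ : ∀ b, ℓ b ≤ κ) {M : A ≃. B}
    (hM : IsMatching (G.LevelEdge ℓ) M) (hp : IsPerfect M) : G.PopularWithPenalty κ M := by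
  refine ⟨fun a b h => (hM a b h).1, fun N hN => ?_⟩
  -- If N leaves a unmatched, her vote -κ is covered because levels are nonnegative. Otherwise this
  -- is the inequality of `levelEdge_iff` at the edge of M, with ℓ(b') rewritten as κ - (κ - ℓ(b')).
  have h1 : ∀ a, G.vote κ N M a ≤
      (((M a).elim 0 ℓ : ℕ) : ℤ) + ((N a).elim 0 (fun b => κ - ℓ b) : ℕ) - κ := by
    intro a
    obtain ⟨b, hb⟩ := Option.isSome_iff_exists.1 (hp.1 a)
    rcases h : N a with _ | b'
    · rw [G.vote_none κ h hb]; simp [hb]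
    · rw [G.vote_some κ h hb]
      have := ((G.levelEdge_iff ℓ a b).1 (hM a b hb)).2 b' (hN a b' h)
      have := hℓ b'
      simp only [hb, Option.elim]
      omega
  have h2 := pequiv_sum_elim_le M ℓ
  have h3 := pequiv_sum_elim_le N (fun b => κ - ℓ b)
  have h4 : ∑ b, ℓ b + ∑ b, (κ - ℓ b) = Fintype.card A * κ := by
    rw [← Finset.sum_add_distrib, hcard, Finset.sum_congr rfl fun b _ => Nat.add_sub_cancel' (hℓ b)]
    simp
  calc ∑ a, G.vote κ N M a ≤ ∑ a, ((((M a).elim 0 ℓ : ℕ) : ℤ) +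
        ((N a).elim 0 (fun b => κ - ℓ b) : ℕ) - κ) := Finset.sum_le_sum fun a _ => h1 a
    _ = ((∑ a, (M a).elim 0 ℓ : ℕ) : ℤ) + ((∑ a, (N a).elim 0 (fun b => κ - ℓ b) : ℕ) : ℤ)
        - ((Fintype.card A * κ : ℕ) : ℤ) := by
      rw [Finset.sum_sub_distrib, Finset.sum_add_distrib]; simp
    _ ≤ 0 := by omega

/-! ### Potentials -/

section Potential

variable {V : Type*}

/-- The weight of a path, given by the list of its nodes. -/
def pathWeight (w : V → V → ℤ) : List V → ℤ
  | [] => 0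
  | [_] => 0
  | x :: y :: l => w x y + pathWeight w (y :: l)

lemma pathWeight_append (w : V → V → ℤ) (y : V) (l₂ : List V) : ∀ l₁ : List V,
    pathWeight w (l₁ ++ y :: l₂) = pathWeight w (l₁ ++ [y]) + pathWeight w (y :: l₂)
  | [] => by simp [pathWeight]
  | [x] => by simp [pathWeight]
  | x :: x' :: l => by
    have := pathWeight_append w y l₂ (x' :: l)
    simp only [List.cons_append, pathWeight] at this ⊢
    rw [this]; ring

open Classical in
/-- A simple path from `x` to `y` closes up to a permutation of the nodes. -/
lemma exists_perm_of_path [Fintype V] {E : V → V → Prop} (hE : ∀ x, E x x) (w : V → V → ℤ)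
    (hw : ∀ x, w x x = 0) : ∀ (x : V) (l : List V), (x :: l).Nodup → (x :: l).IsChain E →
    ∃ σ : Equiv.Perm V, ∃ y, (x :: l).getLast? = some y ∧ σ y = x ∧ (∀ z, z ∉ x :: l → σ z = z) ∧
      (∀ z, z ≠ y → E z (σ z)) ∧ ∑ z ∈ univ.erase y, w z (σ z) = pathWeight w (x :: l) := by
  intro x l
  induction l generalizing x with
  | nil =>
    intro _ _
    exact ⟨1, x, by simp, by simp, by simp, by simp [hE], by simp [hw, pathWeight]⟩
  | cons x' l ih =>
    intro hnd hch
    obtain ⟨σ, y, hy, hσy, hout, hEσ, hsum⟩ := ih x' hnd.of_cons (List.isChain_cons_cons.1 hch).2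
    have hx : x ∉ x' :: l := (List.nodup_cons.1 hnd).1
    have hyl : y ∈ x' :: l := List.mem_of_getLast? hy
    have hxy : x ≠ y := fun h => hx (h ▸ hyl)
    have hσx : σ x = x := hout x hx
    have hother : ∀ z, z ≠ y → z ≠ x → (Equiv.swap x x' * σ) z = σ z := by
      intro z hzy hzx
      rw [Equiv.Perm.mul_apply, Equiv.swap_apply_of_ne_of_ne]
      · rw [← hσx]; exact fun h => hzx (σ.injective h)
      · rw [← hσy]; exact fun h => hzy (σ.injective h)
    have hτx : (Equiv.swap x x' * σ) x = x' := by simp [hσx]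
    -- The transposition inserts x in front of x' in the cycle: the last node y, which was sent to
    -- x', now goes to x, and the former fixed point x goes to x'.
    refine ⟨Equiv.swap x x' * σ, y, ?_, ?_, ?_, ?_, ?_⟩
    · rw [List.getLast?_cons_cons]; exact hy
    · simp [hσy]
    · intro z hz
      simp only [List.mem_cons, not_or] at hz
      rw [hother z _ hz.1, hout z (by simp [hz])]
      rintro rfl
      simp_all
    · intro z hz
      by_cases h : z = x
      · rw [h, hτx]; exact (List.isChain_cons_cons.1 hch).1
      · rw [hother z hz h]; exact hEσ z hz
    · have hxm : x ∈ univ.erase y := by simp [hxy]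
      rw [← Finset.add_sum_erase _ _ hxm] at hsum ⊢
      rw [hτx, pathWeight, ← hsum, hσx, hw, zero_add]
      congr 1
      refine Finset.sum_congr rfl fun z hz => ?_
      simp only [mem_erase, mem_univ, and_true] at hz
      rw [hother z hz.2 hz.1]

open Classical in
/-- If no permutation along edges has positive weight, and none has weight more than `κ` when one of
its arcs is omitted, then there is a potential with values in `{0, …, κ}`. -/
lemma exists_potential [Fintype V] {E : V → V → Prop} (hE : ∀ x, E x x) (w : V → V → ℤ)
    (hw : ∀ x, w x x = 0) (κ : ℕ)
    (hcyc : ∀ σ : Equiv.Perm V, (∀ z, E z (σ z)) → ∑ z, w z (σ z) ≤ 0)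
    (hpath : ∀ (σ : Equiv.Perm V) (y : V), (∀ z, z ≠ y → E z (σ z)) →
      ∑ z ∈ univ.erase y, w z (σ z) ≤ κ) :
    ∃ p : V → ℕ, (∀ x, p x ≤ κ) ∧ ∀ x y, E y x → w y x + p x ≤ p y := by
  -- The potential of x is the maximal weight of a simple path that starts in x. The empty
  -- continuation gives weight 0, and the hypothesis on permutations with an omitted arc gives the
  -- bound κ.
  let S : V → Set ℤ := fun x =>
    {t | ∃ l : List V, (x :: l).Nodup ∧ (x :: l).IsChain E ∧ pathWeight w (x :: l) = t}
  have hbdd : ∀ x, ∀ t ∈ S x, t ≤ κ := by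
    rintro x t ⟨l, h1, h2, rfl⟩
    obtain ⟨σ, y, -, -, -, h3, h4⟩ := exists_perm_of_path hE w hw x l h1 h2
    rw [← h4]; exact hpath σ y h3
  have h0 : ∀ x, (0 : ℤ) ∈ S x := fun x => ⟨[], by simp, by simp, rfl⟩
  have hgr : ∀ x, ∃ t, IsGreatest (S x) t := fun x => by
    obtain ⟨t, ht, hm⟩ := Int.exists_greatest_of_bdd ⟨(κ : ℤ), hbdd x⟩ ⟨0, h0 x⟩
    exact ⟨t, ht, hm⟩
  choose p hp using hgr
  have hp0 : ∀ x, 0 ≤ p x := fun x => (hp x).2 (h0 x)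
  have key : ∀ x y, E y x → w y x + p x ≤ p y := by
    intro x y hxy
    obtain ⟨l, h1, h2, h3⟩ := (hp x).1
    -- If y is not on the optimal path from x, it can be put in front. If it is, the part of the
    -- path up to y closes with the arc from y to x to a cycle of weight at most 0, and the
    -- remaining part is a simple path from y.
    by_cases hy : y ∈ x :: l
    · obtain ⟨l₁, l₂, hl⟩ := List.append_of_mem hy
      have hsuf : (y :: l₂) <:+ (x :: l) := ⟨l₁, hl.symm⟩
      have hle : pathWeight w (y :: l₂) ≤ p y :=
        (hp y).2 ⟨l₂, h1.sublist hsuf.sublist, h2.suffix hsuf, rfl⟩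
      have hpre : (l₁ ++ [y]) <+: (x :: l) := ⟨l₂, by simp [hl]⟩
      obtain ⟨l₃, hl₃⟩ : ∃ l₃, l₁ ++ [y] = x :: l₃ := by
        rcases l₁ with _ | ⟨z, l₁⟩
        · simp at hl; exact ⟨[], by simp [hl.1]⟩
        · simp at hl; exact ⟨l₁ ++ [y], by simp [hl.1]⟩
      rw [hl₃] at hpre
      obtain ⟨σ, y', hy', hσ, -, h4, h5⟩ := exists_perm_of_path hE w hw x l₃
        (h1.sublist hpre.sublist) (h2.prefix hpre)
      rw [← hl₃, List.getLast?_concat, Option.some_inj] at hy'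
      subst hy'
      have h6 := hcyc σ (fun z => by
        by_cases hz : z = y
        · rw [hz, hσ]; exact hxy
        · exact h4 z hz)
      rw [← Finset.add_sum_erase _ _ (mem_univ y), hσ, h5, ← hl₃] at h6
      have h7 := pathWeight_append w y l₂ l₁
      rw [← hl, h3] at h7
      linarith
    · have : w y x + p x ∈ S y := ⟨x :: l, List.nodup_cons.2 ⟨hy, h1⟩,
        List.isChain_cons_cons.2 ⟨hxy, h2⟩, by rw [pathWeight, h3]⟩
      exact (hp y).2 this
  refine ⟨fun x => (p x).toNat, fun x => ?_, fun x y h => ?_⟩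
  · have := hbdd x _ (hp x).1
    have := hp0 x
    dsimp only
    omega
  · have := key x y h
    have := hp0 x
    have := hp0 y
    dsimp only
    omega

end Potential

/-! ### From popular assignments to levels. -/

lemma IsPerfect.exists_equiv {M : A ≃. B} (h : IsPerfect M) :
    ∃ e : A ≃ B, ∀ a, M a = some (e a) := by
  choose f hf using fun a => Option.isSome_iff_exists.1 (h.1 a)
  choose g hg using fun b => Option.isSome_iff_exists.1 (h.2 b)
  refine ⟨⟨f, g, fun a => ?_, fun b => ?_⟩, hf⟩
  · have := M.eq_some_iff.2 (hf a)
    rw [hg] at this; simpa using this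
  · have := M.eq_some_iff.1 (hg b)
    rw [hf] at this; simpa using this

open Classical in
/-- Popularity of an assignment is certified by levels of at most `κ`. -/
lemma Instance.exists_levels_of_popular [Fintype A] [Fintype B] (G : Instance A B) {κ : ℕ}
    {M : A ≃. B} (hM : G.IsAssignment M) (hpop : G.PopularWithPenalty κ M) :
    ∃ ℓ : B → ℕ, (∀ b, ℓ b ≤ κ) ∧ IsMatching (G.LevelEdge ℓ) M := by
  obtain ⟨e, he⟩ := hM.2.exists_equiv
  have hadj : ∀ a, G.Adj a (e a) := fun a => hM.1 a _ (he a)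
  -- A permutation σ along arcs is the assignment that gives σ(b) to the partner of b, and its
  -- weight is its total vote against M. Omitting the arc at y leaves the partner of y unmatched,
  -- which contributes -κ to the vote, so popularity bounds the remaining weight by κ.
  obtain ⟨p, hpκ, hp⟩ := exists_potential (V := B) (E := fun y x => G.Adj (e.symm y) x)
    (fun x => by simpa using hadj (e.symm x)) (fun y x => G.gain (e.symm y) y x)
    (fun x => G.gain_self _ _) κ
    (fun σ hσ => by
      have h1 := hpop.2 (e.trans σ).toPEquiv (fun a b h => by
        simp only [Equiv.toPEquiv_apply, Option.some_inj] at h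
        subst h
        simpa using hσ (e a))
      rw [← Equiv.sum_comp e]
      refine le_of_eq_of_le (Finset.sum_congr rfl fun a _ => ?_) h1
      rw [G.vote_some κ (b := e a) (b' := σ (e a)) (by simp [Equiv.toPEquiv_apply]) (he a)]
      simp)
    (fun σ y hσ => by
      let N : A ≃. B := (PEquiv.ofSet {a | a ≠ e.symm y}).trans (e.trans σ).toPEquiv
      have hN1 : ∀ a, a ≠ e.symm y → N a = some (σ (e a)) := fun a ha => by
        simp [N, PEquiv.trans, PEquiv.ofSet, ha, Equiv.toPEquiv_apply]
      have hN2 : N (e.symm y) = none := by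
        simp [N, PEquiv.trans, PEquiv.ofSet]
      have h1 := hpop.2 N (fun a b h => by
        by_cases ha : a = e.symm y
        · rw [ha, hN2] at h; simp at h
        · rw [hN1 a ha, Option.some_inj] at h
          subst h
          have := hσ (e a) (fun h => ha (by rw [← h]; simp))
          simpa using this)
      rw [← Finset.add_sum_erase _ _ (mem_univ (e.symm y)), G.vote_none κ hN2 (he _)] at h1
      have h2 : ∑ z ∈ univ.erase y, G.gain (e.symm z) z (σ z) =
          ∑ a ∈ univ.erase (e.symm y), G.vote κ N M a := by
        symm
        refine Finset.sum_bij (fun a _ => e a) (fun a ha => ?_) (fun _ _ _ _ h => e.injective h)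
          (fun b hb => ⟨e.symm b, ?_, by simp⟩) (fun a ha => ?_)
        · simp only [mem_erase, mem_univ, and_true] at ha ⊢
          exact fun h => ha (by rw [← h]; simp)
        · simpa using hb
        · rw [G.vote_some κ (hN1 a (by simpa using ha)) (he a)]; simp
      rw [h2]; linarith)
  refine ⟨p, hpκ, fun a b hab => ?_⟩
  rw [he, Option.some_inj] at hab
  subst hab
  refine (G.levelEdge_iff p a _).2 ⟨hadj a, fun b' hb' => ?_⟩
  have := hp b' (e a) (by simpa using hb')
  simpa using this

open Classical in
/-- Levels can be compressed so that they are less than the number of objects. -/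
lemma Instance.exists_small_levels [Fintype B] (G : Instance A B) {M : A ≃. B}
    {ℓ : B → ℕ} (hM : IsMatching (G.LevelEdge ℓ) M) :
    ∃ ℓ' : B → ℕ, (∀ b, ℓ' b ≤ ℓ b) ∧ (∀ b, ℓ' b < Fintype.card B) ∧
      IsMatching (G.LevelEdge ℓ') M := by
  -- The rank of a level among the levels in use. Passing to ranks keeps strict inequalities and
  -- does not enlarge a difference of one.
  let r : ℕ → ℕ := fun v => ((univ.image ℓ).filter (· < v)).card
  have hr1 : ∀ b b', ℓ b' < ℓ b → r (ℓ b') + 1 ≤ r (ℓ b) := by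
    intro b b' h
    refine Finset.card_lt_card (Finset.ssubset_iff_subset_ne.2 ⟨fun x hx => ?_, fun he => ?_⟩)
    · simp only [mem_filter] at hx ⊢; exact ⟨hx.1, hx.2.trans h⟩
    · have : ℓ b' ∈ (univ.image ℓ).filter (· < ℓ b') := by rw [he]; simp [h]
      simp at this
  have hr2 : ∀ v, r (v + 1) ≤ r v + 1 := by
    intro v
    refine (Finset.card_le_card (t := insert v ((univ.image ℓ).filter (· < v))) fun x hx => ?_).trans
      (Finset.card_insert_le _ _)
    simp only [mem_filter, mem_insert] at hx ⊢
    have := hx.2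
    by_cases h : x = v
    · exact Or.inl h
    · exact Or.inr ⟨hx.1, by omega⟩
  refine ⟨fun b => r (ℓ b), fun b => ?_, fun b => ?_, fun a b hab => ?_⟩
  · refine (Finset.card_le_card (t := range (ℓ b)) fun x hx => ?_).trans (by simp)
    simp only [mem_filter] at hx; simpa using hx.2
  · refine lt_of_lt_of_le (Finset.card_lt_card (t := univ.image ℓ)
      (Finset.ssubset_iff_subset_ne.2 ⟨Finset.filter_subset _ _, fun he => ?_⟩)) Finset.card_image_le
    have : ℓ b ∈ (univ.image ℓ).filter (· < ℓ b) := by rw [he]; simp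
    simp at this
  · obtain ⟨h1, h2⟩ := (G.levelEdge_iff ℓ a b).1 (hM a b hab)
    refine (G.levelEdge_iff _ a b).2 ⟨h1, fun b' hb' => ?_⟩
    have h3 := h2 b' hb'
    have h4 := G.gain_le_one a b b'
    have h5 := G.neg_one_le_gain a b b'
    -- A neighbour above b can only be one level above, because the gain is at least -1. So larger
    -- gaps, which the ranks may shrink, occur only below b, where a rank difference of one
    -- suffices.
    rcases lt_trichotomy (ℓ b') (ℓ b) with h | h | h
    · have := hr1 b b' h
      omega
    · rw [h] at h3 ⊢; omega
    · have h6 : ℓ b' = ℓ b + 1 := by omega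
      have := hr2 (ℓ b)
      rw [h6]; omega

/-! ### Invariance of the levels -/

open Classical in
/-- An object that is unmatched in a maximum matching of `G_ℓ` lies strictly below any larger level
function with a perfect matching. -/
lemma Instance.level_lt_of_unmatched [Fintype A] [Fintype B] (G : Instance A B)
    {ℓ ℓ' : B → ℕ} (hle : ∀ b, ℓ b ≤ ℓ' b) {M M' : A ≃. B}
    (hM : IsMaximumMatching (G.LevelEdge ℓ) M) (hM' : IsMatching (G.LevelEdge ℓ') M')
    (hp : IsPerfect M') {b₀ : B} (hb₀ : M.symm b₀ = none) : ℓ b₀ < ℓ' b₀ := by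
  by_contra hlt
  have h0 : ℓ b₀ = ℓ' b₀ := le_antisymm (hle _) (not_lt.1 hlt)
  obtain ⟨e, he⟩ := hp.exists_equiv
  -- Call an object tight if ℓ and ℓ' agree on it. Passing from ℓ' down to ℓ keeps the level of a
  -- tight object and only lowers its competitors, so an edge of M' at a tight object survives in
  -- G_ℓ.
  have hT : ∀ a, ℓ (e a) = ℓ' (e a) → G.LevelEdge ℓ a (e a) := by
    intro a ha
    obtain ⟨h1, h2⟩ := (G.levelEdge_iff ℓ' _ _).1 (hM' a _ (he a))
    refine (G.levelEdge_iff ℓ _ _).2 ⟨h1, fun b' hb' => ?_⟩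
    have := h2 b' hb'
    have := hle b'
    omega
  -- Adding the edge inequalities for ℓ' at (a, e a) and for ℓ at (a, b) cancels the antisymmetric
  -- gains and leaves ℓ'(b) ≤ ℓ(b).
  have hS : ∀ a b, ℓ (e a) = ℓ' (e a) → G.LevelEdge ℓ a b → ℓ b = ℓ' b := by
    intro a b ha hab
    obtain ⟨h1, h2⟩ := (G.levelEdge_iff ℓ' _ _).1 (hM' a _ (he a))
    obtain ⟨h3, h4⟩ := (G.levelEdge_iff ℓ _ _).1 hab
    have h5 := h2 b h3
    have h6 := h4 _ h1
    rw [G.gain_swap] at h6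
    have := hle b
    omega
  -- N uses M' on the agents whose M'-partner is tight, and M elsewhere except for its edges into
  -- tight objects.
  let N : A ≃. B :=
    { toFun := fun a => if ℓ (e a) = ℓ' (e a) then some (e a) else
        (M a).bind fun b => if ℓ b = ℓ' b then none else some b
      invFun := fun b => if ℓ b = ℓ' b then some (e.symm b) else
        (M.symm b).bind fun a => if ℓ (e a) = ℓ' (e a) then none else some a
      inv := by
        intro a b
        by_cases ha : ℓ (e a) = ℓ' (e a) <;> by_cases hb : ℓ b = ℓ' b
        · simp only [ha, hb, if_true, Option.some_inj]
          exact ⟨fun h => by rw [← h]; simp, fun h => by rw [← h]; simp⟩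
        · simp only [ha, hb, if_true, if_false, Option.some_inj,
            Option.bind_eq_some_iff]
          constructor
          · rintro ⟨a', h1, h2⟩
            split_ifs at h2 with h3
            simp only [Option.some_inj] at h2
            exact absurd ha (h2 ▸ h3)
          · rintro rfl; exact absurd ha hb
        · simp only [ha, hb, if_true, if_false, Option.some_inj,
            Option.bind_eq_some_iff]
          constructor
          · rintro rfl; simp at ha; exact absurd hb ha
          · rintro ⟨b', h1, h2⟩
            split_ifs at h2 with h3
            simp only [Option.some_inj] at h2
            exact absurd hb (h2 ▸ h3)
        · simp only [ha, hb, if_false, Option.bind_eq_some_iff]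
          constructor
          · rintro ⟨a', h1, h2⟩
            split_ifs at h2 with h3
            simp only [Option.some_inj] at h2
            subst h2
            exact ⟨b, M.eq_some_iff.1 h1, by simp [hb]⟩
          · rintro ⟨b', h1, h2⟩
            split_ifs at h2 with h3
            simp only [Option.some_inj] at h2
            subst h2
            exact ⟨a, M.eq_some_iff.2 h1, by simp [ha]⟩ }
  have hNa : ∀ a, N a = if ℓ (e a) = ℓ' (e a) then some (e a) else
        (M a).bind fun b => if ℓ b = ℓ' b then none else some b := fun _ => rfl
  have hNb : ∀ b, N.symm b = if ℓ b = ℓ' b then some (e.symm b) else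
        (M.symm b).bind fun a => if ℓ (e a) = ℓ' (e a) then none else some a := fun _ => rfl
  have hN : IsMatching (G.LevelEdge ℓ) N := by
    intro a b hab
    rw [hNa] at hab
    split_ifs at hab with h
    · simp only [Option.some_inj] at hab; subst hab; exact hT a h
    · obtain ⟨b', h1, h2⟩ := Option.bind_eq_some_iff.1 hab
      split_ifs at h2 with h3
      simp only [Option.some_inj] at h2
      subst h2
      exact hM.1 a b' h1
  -- N covers all tight objects, among them b₀. It loses no other object: by `hS`, an M-edge at an
  -- object that is not tight belongs to an agent who keeps her M-partner.
  have hlt : msize M < msize N := by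
    rw [msize_eq_sum, msize_eq_sum, pequiv_sum_elim, pequiv_sum_elim]
    refine Finset.sum_lt_sum (fun b _ => ?_) ⟨b₀, mem_univ _, ?_⟩
    · rw [hNb]
      by_cases hb : ℓ b = ℓ' b
      · simp only [hb]; simp; split_ifs <;> simp
      · simp only [hb, if_false]
        rcases h : M.symm b with _ | a
        · simp
        · have : ¬ ℓ (e a) = ℓ' (e a) := fun h' => hb (hS a b h' (hM.1 a b (M.eq_some_iff.1 h)))
          simp [this]
    · rw [hNb]; simp [h0, hb₀]
  exact absurd (hM.2 N hN) (not_le.2 hlt)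

/-! ### Termination and outcome of the truncated algorithm. -/

lemma exists_maximumMatching [Fintype A] [Fintype B] (R : A → B → Prop) :
    ∃ M : A ≃. B, IsMaximumMatching R M := by
  have : Finite (A ≃. B) := Finite.of_injective (fun M : A ≃. B => (M : A → Option B))
    DFunLike.coe_injective
  have : Nonempty {M : A ≃. B // IsMatching R M} := ⟨⟨⊥, fun a b h => by simp at h⟩⟩
  obtain ⟨⟨M, h⟩, hm⟩ := Finite.exists_max fun M : {M : A ≃. B // IsMatching R M} => msize M.1
  exact ⟨M, h, fun N hN => hm ⟨N, hN⟩⟩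

lemma exists_unmatched [Fintype A] [Fintype B] (hcard : Fintype.card A = Fintype.card B)
    {M : A ≃. B} (h : ¬ IsPerfect M) : ∃ b, M.symm b = none := by
  by_contra hc
  push Not at hc
  have hb : ∀ b, (M.symm b).isSome := fun b => Option.isSome_iff_ne_none.2 (hc b)
  have h1 := msize_eq_sum M
  rw [pequiv_sum_elim] at h1
  simp only [hb, if_true, sum_const, card_univ, smul_eq_mul, mul_one] at h1
  rw [← hcard, msize] at h1
  refine h ⟨fun a => ?_, hb⟩
  have := (Finset.card_eq_iff_eq_univ _).1 h1
  have h2 := mem_univ a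
  rw [← this] at h2
  simpa using h2

lemma sum_raiseLevels [Fintype B] {ℓ : B → ℕ} {M : A ≃. B} {t : ℕ} (hℓ : ∀ b, ℓ b < t)
    (hM : ∃ b, M.symm b = none) :
    ∑ b, (t - raiseLevels ℓ M b) < ∑ b, (t - ℓ b) := by
  obtain ⟨b, hb⟩ := hM
  refine Finset.sum_lt_sum (fun b _ => ?_) ⟨b, mem_univ _, ?_⟩
  · unfold raiseLevels; split_ifs <;> omega
  · have := hℓ b
    simp [raiseLevels, hb]; omega

/-- An accepted matching is certified by the current levels, which the loop condition keeps at most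
κ. A rejection is justified by the invariant that the levels stay below every certificate with
values at most κ and less than the number of objects. -/
theorem alwaysHaltsWith [Fintype A] [Fintype B] (G : Instance A B) (κ : ℕ)
    (hcard : Fintype.card A = Fintype.card B) :
    AlwaysHaltsWith G (κ + 1)
        (fun o =>
          (∀ M, o = some M → G.IsAssignment M ∧ G.PopularWithPenalty κ M) ∧
          ((∃ M, G.IsAssignment M ∧ G.PopularWithPenalty κ M) → o ≠ none))
        Conf.start := by
  -- The total distance of the levels to κ + 1 drops in each iteration, since a matching that is not
  -- perfect misses an object.
  suffices H : ∀ (s : ℕ) (ℓ : B → ℕ), ∑ b, (κ + 1 - ℓ b) = s →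
      (∀ ℓ' : B → ℕ, (∀ b, ℓ' b ≤ κ) → (∀ b, ℓ' b < Fintype.card B) →
        (∃ M', IsMatching (G.LevelEdge ℓ') M' ∧ IsPerfect M') → ∀ b, ℓ b ≤ ℓ' b) →
      AlwaysHaltsWith G (κ + 1)
        (fun o =>
          (∀ M, o = some M → G.IsAssignment M ∧ G.PopularWithPenalty κ M) ∧
          ((∃ M, G.IsAssignment M ∧ G.PopularWithPenalty κ M) → o ≠ none))
        (Conf.test ℓ) from H _ _ rfl (fun _ _ _ _ _ => Nat.zero_le _)
  intro s
  induction s using Nat.strong_induction_on with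
  | _ s ih =>
    intro ℓ hs hinv
    by_cases hguard : ∀ b, ℓ b < Fintype.card B ∧ ℓ b < κ + 1
    · obtain ⟨M₀, hM₀⟩ := exists_maximumMatching (G.LevelEdge ℓ)
      refine AlwaysHaltsWith.step _ ⟨_, Step.enter ℓ M₀ hguard hM₀⟩ fun c' hc' => ?_
      cases hc' with
      | exit _ h => exact absurd hguard h
      | enter _ M _ hM =>
        by_cases hperf : IsPerfect M
        · refine AlwaysHaltsWith.step _ ⟨_, Step.accept ℓ M hperf⟩ fun c' hc' => ?_
          cases hc' with
          | raise _ _ h => exact absurd hperf h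
          | accept _ _ _ =>
            refine AlwaysHaltsWith.halt _ ⟨fun M' h => ?_, fun _ => by simp⟩
            rw [Option.some_inj] at h
            subst h
            exact ⟨⟨fun a b h => (hM.1 a b h).1, hperf⟩, G.popular_of_levels hcard
              (fun b => Nat.lt_succ_iff.1 (hguard b).2) hM.1 hperf⟩
        · refine AlwaysHaltsWith.step _ ⟨_, Step.raise ℓ M hperf⟩ fun c' hc' => ?_
          cases hc' with
          | accept _ _ h => exact absurd h hperf
          | raise _ _ _ =>
            refine ih _ ?_ _ rfl fun ℓ' h1 h2 h3 b => ?_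
            · rw [← hs]
              exact sum_raiseLevels (fun b => (hguard b).2) (exists_unmatched hcard hperf)
            · have hle := hinv ℓ' h1 h2 h3
              obtain ⟨M', hM', hp'⟩ := h3
              unfold raiseLevels
              split_ifs with h
              · exact hle b
              · exact G.level_lt_of_unmatched hle hM hM' hp' (by simpa using h)
    · refine AlwaysHaltsWith.step _ ⟨_, Step.exit ℓ hguard⟩ fun c' hc' => ?_
      cases hc' with
      | enter _ _ h _ => exact absurd h hguard
      | exit _ _ =>
        refine AlwaysHaltsWith.halt _ ⟨fun M h => by simp at h, ?_⟩
        rintro ⟨M, hM, hpop⟩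
        exfalso
        -- The compression is needed because the loop also stops at level n, which may come before κ
        -- + 1.
        obtain ⟨ℓ₁, h1, h2⟩ := G.exists_levels_of_popular hM hpop
        obtain ⟨ℓ', h3, h4, h5⟩ := G.exists_small_levels h2
        have h6 := hinv ℓ' (fun b => (h3 b).trans (h1 b)) h4 ⟨M, h5, hM.2⟩
        exact hguard fun b => ⟨(h6 b).trans_lt (h4 b),
          Nat.lt_succ_iff.2 ((h6 b).trans ((h3 b).trans (h1 b)))⟩

end Correctness

/-! ### Reasoning about programs -/

/-- The semantics of programs without a bound on the size of words. -/
inductive Run : Prog → State → ℕ → State → Prop where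
  | skip (σ : State) : Run Prog.skip σ 1 σ
  | assign (x : ℕ) (e : Expr) (σ : State) :
      Run (Prog.assign x e) σ (e.cost + 1) ⟨Function.update σ.reg x (e.eval σ), σ.arr, σ.out⟩
  | put (r : ℕ) (e e' : Expr) (σ : State) :
      Run (Prog.put r e e') σ (e.cost + e'.cost + 1)
        ⟨σ.reg, Function.update σ.arr r (Function.update (σ.arr r) (e.eval σ) (e'.eval σ)), σ.out⟩
  | emit (e : Expr) (σ : State) :
      Run (Prog.emit e) σ (e.cost + 1) ⟨σ.reg, σ.arr, σ.out ++ [e.eval σ]⟩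
  | seq (c d : Prog) (σ σ₁ σ₂ : State) (t₁ t₂ : ℕ) :
      Run c σ t₁ σ₁ → Run d σ₁ t₂ σ₂ → Run (Prog.seq c d) σ (t₁ + t₂) σ₂
  | ite_true (e e' : Expr) (c d : Prog) (σ σ₁ : State) (t : ℕ) :
      e.eval σ < e'.eval σ → Run c σ t σ₁ →
      Run (Prog.ite e e' c d) σ (e.cost + e'.cost + 1 + t) σ₁
  | ite_false (e e' : Expr) (c d : Prog) (σ σ₁ : State) (t : ℕ) :
      ¬ e.eval σ < e'.eval σ → Run d σ t σ₁ →
      Run (Prog.ite e e' c d) σ (e.cost + e'.cost + 1 + t) σ₁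
  | loop_true (e e' : Expr) (c : Prog) (σ σ₁ σ₂ : State) (t₁ t₂ : ℕ) :
      e.eval σ < e'.eval σ → Run c σ t₁ σ₁ → Run (Prog.loop e e' c) σ₁ t₂ σ₂ →
      Run (Prog.loop e e' c) σ (e.cost + e'.cost + 1 + t₁ + t₂) σ₂
  | loop_false (e e' : Expr) (c : Prog) (σ : State) :
      ¬ e.eval σ < e'.eval σ → Run (Prog.loop e e' c) σ (e.cost + e'.cost + 1) σ

/-! #### Words of bounded size -/

/-- Only the literals `0`, `1` and `2` occur. -/
def Expr.smallLits : Expr → Bool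
  | .lit k => decide (k ≤ 2)
  | .var _ => true
  | .get _ e => e.smallLits
  | .add e e' => e.smallLits && e'.smallLits
  | .sub e e' => e.smallLits && e'.smallLits
  | .mul e e' => e.smallLits && e'.smallLits

/-- The value exceeds the contents of the memory at most by the cost of its evaluation. -/
def Expr.slow : Expr → Bool
  | .lit k => decide (k ≤ 2)
  | .var _ => true
  | .get _ _ => true
  | .add e (.lit k) => e.slow && decide (k ≤ 1)
  | .add _ _ => false
  | .sub e _ => e.slow
  | .mul _ _ => false

/-- Expressions with small literals that are cheap to evaluate. -/
def Expr.tame (D : ℕ) (e : Expr) : Bool := e.smallLits && decide (e.cost ≤ D)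

/-- All expressions are tame, and only slowly growing values are stored. -/
def Prog.tame (D : ℕ) : Prog → Bool
  | .skip => true
  | .assign _ e => e.tame D && e.slow
  | .put _ e e' => e.tame D && e'.tame D && e'.slow
  | .emit e => e.tame D
  | .seq c d => c.tame D && d.tame D
  | .ite e e' c d => e.tame D && e'.tame D && c.tame D && d.tame D
  | .loop e e' c => e.tame D && e'.tame D && c.tame D

/-- All memory cells contain numbers that are at most `b`. -/
def State.Bounded (σ : State) (b : ℕ) : Prop := (∀ x, σ.reg x ≤ b) ∧ ∀ r i, σ.arr r i ≤ b

lemma State.Bounded.mono {σ : State} {b b' : ℕ} (h : σ.Bounded b) (hb : b ≤ b') :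
    σ.Bounded b' := ⟨fun x => (h.1 x).trans hb, fun r i => (h.2 r i).trans hb⟩

lemma Expr.eval_le_of_slow {σ : State} {b : ℕ} (hσ : σ.Bounded b) (hb : 2 ≤ b) :
    ∀ e : Expr, e.slow = true → e.eval σ ≤ b + e.cost
  | .lit k, h => by simp [Expr.slow] at h; simp [Expr.eval]; omega
  | .var x, _ => (hσ.1 x).trans (Nat.le_add_right _ _)
  | .get r e, _ => (hσ.2 r _).trans (Nat.le_add_right _ _)
  | .add e (.lit k), h => by
    simp [Expr.slow] at h
    have := Expr.eval_le_of_slow hσ hb e h.1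
    simp [Expr.eval, Expr.cost]; omega
  | .add _ (.var _), h | .add _ (.get _ _), h | .add _ (.add _ _), h | .add _ (.sub _ _), h
  | .add _ (.mul _ _), h => by simp [Expr.slow] at h
  | .sub e e', h => by
    have := Expr.eval_le_of_slow hσ hb e h
    simp [Expr.eval, Expr.cost]; omega
  | .mul _ _, h => by simp [Expr.slow] at h

/-- As 2 ≤ b, the extra unit of cost at an operation pays for an addition, and exponents add up at a
multiplication. So b to the power of the cost bounds all intermediate values, including addresses
such as a·n + b, which are computed but never stored. -/
lemma Expr.fits_of_smallLits {σ : State} {b W : ℕ} (hσ : σ.Bounded b) (hb : 2 ≤ b) :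
    ∀ e : Expr, e.smallLits = true → b ^ e.cost ≤ W → e.Fits W σ ∧ e.eval σ ≤ b ^ e.cost
  | .lit k, h, hW => by
    simp [Expr.smallLits] at h
    simp only [Expr.cost, pow_one, Expr.Fits, Expr.eval] at hW ⊢; omega
  | .var x, _, hW => by
    have := hσ.1 x
    simp only [Expr.cost, pow_one, Expr.Fits, Expr.eval] at hW ⊢; omega
  | .get r e, h, hW => by
    have h1 : b ^ e.cost ≤ b ^ (e.cost + 1) := Nat.pow_le_pow_right (by omega) (by omega)
    have h2 : b ^ 1 ≤ b ^ (e.cost + 1) := Nat.pow_le_pow_right (by omega) (by omega)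
    obtain ⟨h3, h4⟩ := Expr.fits_of_smallLits (W := W) hσ hb e h (h1.trans hW)
    have := hσ.2 r (e.eval σ)
    rw [pow_one] at h2
    simp only [Expr.cost, Expr.Fits, Expr.eval] at hW ⊢
    exact ⟨⟨h3, by omega⟩, by omega⟩
  | .add e e', h, hW => by
    simp only [Expr.smallLits, Bool.and_eq_true] at h
    have h1 : b ^ e.cost ≤ b ^ (e.cost + e'.cost) := Nat.pow_le_pow_right (by omega) (by omega)
    have h2 : b ^ e'.cost ≤ b ^ (e.cost + e'.cost) := Nat.pow_le_pow_right (by omega) (by omega)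
    have h3 : 2 * b ^ (e.cost + e'.cost) ≤ b ^ (e.cost + e'.cost + 1) := by
      rw [pow_succ, mul_comm]; exact Nat.mul_le_mul_left _ hb
    simp only [Expr.cost, Expr.Fits, Expr.eval] at hW ⊢
    obtain ⟨h4, h5⟩ := Expr.fits_of_smallLits (W := W) hσ hb e h.1 (by omega)
    obtain ⟨h6, h7⟩ := Expr.fits_of_smallLits (W := W) hσ hb e' h.2 (by omega)
    exact ⟨⟨h4, h6, by omega⟩, by omega⟩
  | .sub e e', h, hW => by
    simp only [Expr.smallLits, Bool.and_eq_true] at h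
    simp only [Expr.cost, Expr.Fits, Expr.eval] at hW ⊢
    have h1 : b ^ e.cost ≤ b ^ (e.cost + e'.cost + 1) :=
      Nat.pow_le_pow_right (by omega) (by omega)
    have h2 : b ^ e'.cost ≤ b ^ (e.cost + e'.cost + 1) :=
      Nat.pow_le_pow_right (by omega) (by omega)
    obtain ⟨h4, h5⟩ := Expr.fits_of_smallLits (W := W) hσ hb e h.1 (by omega)
    obtain ⟨h6, h7⟩ := Expr.fits_of_smallLits (W := W) hσ hb e' h.2 (by omega)
    exact ⟨⟨h4, h6⟩, by omega⟩
  | .mul e e', h, hW => by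
    simp only [Expr.smallLits, Bool.and_eq_true] at h
    simp only [Expr.cost, Expr.Fits, Expr.eval] at hW ⊢
    have h1 : b ^ e.cost ≤ b ^ (e.cost + e'.cost + 1) :=
      Nat.pow_le_pow_right (by omega) (by omega)
    have h2 : b ^ e'.cost ≤ b ^ (e.cost + e'.cost + 1) :=
      Nat.pow_le_pow_right (by omega) (by omega)
    have h3 : b ^ (e.cost + e'.cost) ≤ b ^ (e.cost + e'.cost + 1) :=
      Nat.pow_le_pow_right (by omega) (by omega)
    obtain ⟨h4, h5⟩ := Expr.fits_of_smallLits (W := W) hσ hb e h.1 (by omega)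
    obtain ⟨h6, h7⟩ := Expr.fits_of_smallLits (W := W) hσ hb e' h.2 (by omega)
    have h8 : e.eval σ * e'.eval σ ≤ b ^ (e.cost + e'.cost) := by
      rw [pow_add]; exact Nat.mul_le_mul h5 h7
    exact ⟨⟨h4, h6, by omega⟩, by omega⟩

lemma Expr.fits_of_tame {σ : State} {b W D : ℕ} (hσ : σ.Bounded b) (hb : 2 ≤ b)
    (hW : b ^ D ≤ W) {e : Expr} (he : e.tame D = true) : e.Fits W σ := by
  simp only [Expr.tame, Bool.and_eq_true, decide_eq_true_eq] at he
  exact (Expr.fits_of_smallLits hσ hb e he.1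
    ((Nat.pow_le_pow_right (by omega) he.2).trans hW)).1

lemma State.Bounded.setReg {σ : State} {b v : ℕ} (h : σ.Bounded b) (hv : v ≤ b) (x : ℕ) :
    State.Bounded ⟨Function.update σ.reg x v, σ.arr, σ.out⟩ b :=
  ⟨fun y => by
    by_cases hy : y = x
    · subst hy; simpa using hv
    · simpa [hy] using h.1 y, h.2⟩

lemma State.Bounded.setArr {σ : State} {b v : ℕ} (h : σ.Bounded b) (hv : v ≤ b) (r i : ℕ) :
    State.Bounded ⟨σ.reg, Function.update σ.arr r (Function.update (σ.arr r) i v), σ.out⟩ b :=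
  ⟨h.1, fun r' j => by
    by_cases hr : r' = r
    · subst hr
      by_cases hj : j = i
      · subst hj; simpa using hv
      · simpa [hj] using h.2 r' j
    · simpa [hr] using h.2 r' j⟩

/-- A tame program that halts after `t` steps only needs words of logarithmic length. -/
theorem Run.exec {D W : ℕ} {c : Prog} {σ σ' : State} {t : ℕ} (h : Run c σ t σ') :
    ∀ b, c.tame D = true → σ.Bounded b → 2 ≤ b → (b + t) ^ D ≤ W →
      Exec W c σ t σ' ∧ σ'.Bounded (b + t) := by
  have fit : ∀ {σ : State} {b s : ℕ} {e : Expr}, σ.Bounded b → 2 ≤ b → (b + s) ^ D ≤ W →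
      e.tame D = true → e.Fits W σ := fun hσ hb hW he =>
    Expr.fits_of_tame hσ hb ((Nat.pow_le_pow_left (Nat.le_add_right _ _) _).trans hW) he
  have low : ∀ {s s' : ℕ}, s' ^ D ≤ W → s ≤ s' → s ^ D ≤ W := fun h h' =>
    (Nat.pow_le_pow_left h' _).trans h
  -- The bound on the memory grows additively with time, so in a sequence the second program starts
  -- with the bound b + t₁. This is why products must not be stored.
  induction h with
  | skip σ => exact fun b _ hσ _ _ => ⟨Exec.skip σ, hσ.mono (by omega)⟩
  | assign x e σ =>
    intro b hc hσ hb hW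
    simp only [Prog.tame, Bool.and_eq_true] at hc
    exact ⟨Exec.assign x e σ (fit hσ hb hW hc.1), (hσ.mono (by omega)).setReg
      ((Expr.eval_le_of_slow hσ hb e hc.2).trans (by omega)) x⟩
  | put r e e' σ =>
    intro b hc hσ hb hW
    simp only [Prog.tame, Bool.and_eq_true] at hc
    exact ⟨Exec.put r e e' σ (fit hσ hb hW hc.1.1) (fit hσ hb hW hc.1.2),
      (hσ.mono (by omega)).setArr
      ((Expr.eval_le_of_slow hσ hb e' hc.2).trans (by omega)) r _⟩
  | emit e σ =>
    intro b hc hσ hb hW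
    exact ⟨Exec.emit e σ (fit hσ hb hW hc), (hσ.mono (by omega) : σ.Bounded _)⟩
  | seq c d σ σ₁ σ₂ t₁ t₂ _ _ ih₁ ih₂ =>
    intro b hc hσ hb hW
    simp only [Prog.tame, Bool.and_eq_true] at hc
    obtain ⟨h1, h2⟩ := ih₁ b hc.1 hσ hb (low hW (by omega))
    obtain ⟨h3, h4⟩ := ih₂ _ hc.2 h2 (by omega) (low hW (by omega))
    exact ⟨Exec.seq _ _ _ _ _ _ _ h1 h3, h4.mono (by omega)⟩
  | ite_true e e' c d σ σ₁ t hlt _ ih =>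
    intro b hc hσ hb hW
    simp only [Prog.tame, Bool.and_eq_true] at hc
    obtain ⟨h1, h2⟩ := ih b hc.1.2 hσ hb (low hW (by omega))
    exact ⟨Exec.ite_true _ _ _ _ _ _ _ (fit hσ hb hW hc.1.1.1) (fit hσ hb hW hc.1.1.2) hlt h1,
      h2.mono (by omega)⟩
  | ite_false e e' c d σ σ₁ t hlt _ ih =>
    intro b hc hσ hb hW
    simp only [Prog.tame, Bool.and_eq_true] at hc
    obtain ⟨h1, h2⟩ := ih b hc.2 hσ hb (low hW (by omega))
    exact ⟨Exec.ite_false _ _ _ _ _ _ _ (fit hσ hb hW hc.1.1.1) (fit hσ hb hW hc.1.1.2) hlt h1,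
      h2.mono (by omega)⟩
  | loop_true e e' c σ σ₁ σ₂ t₁ t₂ hlt _ _ ih₁ ih₂ =>
    intro b hc hσ hb hW
    have hc' := hc
    simp only [Prog.tame, Bool.and_eq_true] at hc
    obtain ⟨h1, h2⟩ := ih₁ b hc.2 hσ hb (low hW (by omega))
    obtain ⟨h3, h4⟩ := ih₂ _ hc' h2 (by omega) (low hW (by omega))
    exact ⟨Exec.loop_true _ _ _ _ _ _ _ _ (fit hσ hb hW hc.1.1) (fit hσ hb hW hc.1.2) hlt h1 h3,
      h4.mono (by omega)⟩
  | loop_false e e' c σ hlt =>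
    intro b hc hσ hb hW
    simp only [Prog.tame, Bool.and_eq_true] at hc
    exact ⟨Exec.loop_false _ _ _ _ (fit hσ hb hW hc.1.1) (fit hσ hb hW hc.1.2) hlt,
      hσ.mono (by omega)⟩

/-! #### Frames -/

/-- The program assigns to the register `x`. -/
def Prog.writesReg (x : ℕ) : Prog → Bool
  | .assign y _ => decide (x = y)
  | .seq c d | .ite _ _ c d => c.writesReg x || d.writesReg x
  | .loop _ _ c => c.writesReg x
  | _ => false

/-- The program writes into the array `r`. -/
def Prog.writesArr (r : ℕ) : Prog → Bool
  | .put r' _ _ => decide (r = r')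
  | .seq c d | .ite _ _ c d => c.writesArr r || d.writesArr r
  | .loop _ _ c => c.writesArr r
  | _ => false

/-- The program emits output. -/
def Prog.emits : Prog → Bool
  | .emit _ => true
  | .seq c d | .ite _ _ c d => c.emits || d.emits
  | .loop _ _ c => c.emits
  | _ => false

/-- The two states agree where the program `c` does not write. -/
structure Frame (c : Prog) (σ σ' : State) : Prop where
  reg : ∀ x, c.writesReg x = false → σ'.reg x = σ.reg x
  arr : ∀ r, c.writesArr r = false → σ'.arr r = σ.arr r
  out : c.emits = false → σ'.out = σ.out

/-- The write sets are Boolean functions of the syntax, so for a concrete program the side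
conditions of a frame are closed by `rfl`. -/
lemma Run.frame {c : Prog} {σ σ' : State} {t : ℕ} (h : Run c σ t σ') : Frame c σ σ' := by
  induction h with
  | skip σ => exact ⟨fun _ _ => rfl, fun _ _ => rfl, fun _ => rfl⟩
  | assign x e σ =>
    exact ⟨fun y hy => by simp [Prog.writesReg] at hy; simp [hy], fun _ _ => rfl, fun _ => rfl⟩
  | put r e e' σ =>
    exact ⟨fun _ _ => rfl, fun y hy => by simp [Prog.writesArr] at hy; simp [hy], fun _ => rfl⟩
  | emit e σ => exact ⟨fun _ _ => rfl, fun _ _ => rfl, fun h => by simp [Prog.emits] at h⟩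
  | seq c d σ σ₁ σ₂ t₁ t₂ _ _ ih₁ ih₂ =>
    refine ⟨fun x hx => ?_, fun x hx => ?_, fun hx => ?_⟩
    · simp only [Prog.writesReg, Bool.or_eq_false_iff] at hx
      rw [ih₂.reg x hx.2, ih₁.reg x hx.1]
    · simp only [Prog.writesArr, Bool.or_eq_false_iff] at hx
      rw [ih₂.arr x hx.2, ih₁.arr x hx.1]
    · simp only [Prog.emits, Bool.or_eq_false_iff] at hx
      rw [ih₂.out hx.2, ih₁.out hx.1]
  | ite_true e e' c d σ σ₁ t hlt _ ih =>
    refine ⟨fun x hx => ?_, fun x hx => ?_, fun hx => ?_⟩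
    · simp only [Prog.writesReg, Bool.or_eq_false_iff] at hx
      exact ih.reg x hx.1
    · simp only [Prog.writesArr, Bool.or_eq_false_iff] at hx
      exact ih.arr x hx.1
    · simp only [Prog.emits, Bool.or_eq_false_iff] at hx
      exact ih.out hx.1
  | ite_false e e' c d σ σ₁ t hlt _ ih =>
    refine ⟨fun x hx => ?_, fun x hx => ?_, fun hx => ?_⟩
    · simp only [Prog.writesReg, Bool.or_eq_false_iff] at hx
      exact ih.reg x hx.2
    · simp only [Prog.writesArr, Bool.or_eq_false_iff] at hx
      exact ih.arr x hx.2
    · simp only [Prog.emits, Bool.or_eq_false_iff] at hx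
      exact ih.out hx.2
  | loop_true e e' c σ σ₁ σ₂ t₁ t₂ hlt _ _ ih₁ ih₂ =>
    exact ⟨fun x hx => by rw [ih₂.reg x hx, ih₁.reg x hx],
      fun x hx => by rw [ih₂.arr x hx, ih₁.arr x hx],
      fun hx => by rw [ih₂.out hx, ih₁.out hx]⟩
  | loop_false e e' c σ hlt => exact ⟨fun _ _ => rfl, fun _ _ => rfl, fun _ => rfl⟩

/-! #### Total correctness with a time bound -/

/-- The program `c` started in `σ` halts, and `Q` holds of the number of steps and the final
state. -/
def Runs (c : Prog) (σ : State) (Q : ℕ → State → Prop) : Prop :=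
  ∃ t σ', Run c σ t σ' ∧ Q t σ'

/-- The state after the assignment of `v` to the register `x`. -/
def State.setReg (σ : State) (x v : ℕ) : State := ⟨Function.update σ.reg x v, σ.arr, σ.out⟩

/-- The state after writing `v` at position `i` of the array `r`. -/
def State.setArr (σ : State) (r i v : ℕ) : State :=
  ⟨σ.reg, Function.update σ.arr r (Function.update (σ.arr r) i v), σ.out⟩

/-- The state after printing `v`. -/
def State.print (σ : State) (v : ℕ) : State := ⟨σ.reg, σ.arr, σ.out ++ [v]⟩

namespace State

variable (σ : State) (x y r r' i v : ℕ)

@[simp]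
lemma setReg_reg : (σ.setReg x v).reg y = if y = x then v else σ.reg y := by
  simp [setReg, Function.update_apply]

@[simp]
lemma setReg_arr : (σ.setReg x v).arr = σ.arr := rfl

@[simp]
lemma setReg_out : (σ.setReg x v).out = σ.out := rfl

@[simp]
lemma setArr_reg : (σ.setArr r i v).reg = σ.reg := rfl

@[simp]
lemma setArr_arr : (σ.setArr r i v).arr r' =
    if r' = r then Function.update (σ.arr r) i v else σ.arr r' := by
  simp [setArr, Function.update_apply]

@[simp]
lemma setArr_out : (σ.setArr r i v).out = σ.out := rfl

@[simp]
lemma print_reg : (σ.print v).reg = σ.reg := rfl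

@[simp]
lemma print_arr : (σ.print v).arr = σ.arr := rfl

@[simp]
lemma print_out : (σ.print v).out = σ.out ++ [v] := rfl

end State

namespace Runs

variable {c d : Prog} {σ : State} {Q Q' : ℕ → State → Prop} {e e' : Expr}

/-- The rule of consequence, which also supplies the frame; specifications therefore need not list
what stays unchanged. -/
lemma mono (h : Runs c σ Q) (hQ : ∀ t σ', Frame c σ σ' → Q t σ' → Q' t σ') : Runs c σ Q' := by
  obtain ⟨t, σ', h1, h2⟩ := h
  exact ⟨t, σ', h1, hQ _ _ h1.frame h2⟩

@[simp]
lemma skip_iff : Runs Prog.skip σ Q ↔ Q 1 σ :=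
  ⟨fun ⟨_, _, h, hQ⟩ => by cases h; exact hQ, fun h => ⟨_, _, Run.skip σ, h⟩⟩

@[simp]
lemma assign_iff {x : ℕ} :
    Runs (Prog.assign x e) σ Q ↔ Q (e.cost + 1) (σ.setReg x (e.eval σ)) :=
  ⟨fun ⟨_, _, h, hQ⟩ => by cases h; exact hQ, fun h => ⟨_, _, Run.assign x e σ, h⟩⟩

@[simp]
lemma put_iff {r : ℕ} :
    Runs (Prog.put r e e') σ Q ↔ Q (e.cost + e'.cost + 1) (σ.setArr r (e.eval σ) (e'.eval σ)) :=
  ⟨fun ⟨_, _, h, hQ⟩ => by cases h; exact hQ, fun h => ⟨_, _, Run.put r e e' σ, h⟩⟩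

@[simp]
lemma emit_iff : Runs (Prog.emit e) σ Q ↔ Q (e.cost + 1) (σ.print (e.eval σ)) :=
  ⟨fun ⟨_, _, h, hQ⟩ => by cases h; exact hQ, fun h => ⟨_, _, Run.emit e σ, h⟩⟩

@[simp]
lemma seq_iff :
    Runs (Prog.seq c d) σ Q ↔ Runs c σ fun t σ' => Runs d σ' fun t' σ'' => Q (t + t') σ'' := by
  constructor
  · rintro ⟨_, _, h, hQ⟩
    cases h with
    | seq _ _ _ σ₁ _ t₁ t₂ h1 h2 => exact ⟨_, _, h1, _, _, h2, hQ⟩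
  · rintro ⟨t₁, σ₁, h1, t₂, σ₂, h2, hQ⟩
    exact ⟨_, _, Run.seq _ _ _ _ _ _ _ h1 h2, hQ⟩

@[simp]
lemma ite_iff :
    Runs (Prog.ite e e' c d) σ Q ↔
      (e.eval σ < e'.eval σ → Runs c σ fun t σ' => Q (e.cost + e'.cost + 1 + t) σ') ∧
      (¬ e.eval σ < e'.eval σ → Runs d σ fun t σ' => Q (e.cost + e'.cost + 1 + t) σ') := by
  constructor
  · rintro ⟨_, _, h, hQ⟩
    cases h with
    | ite_true _ _ _ _ _ _ t hlt h => exact ⟨fun _ => ⟨_, _, h, hQ⟩, fun h => absurd hlt h⟩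
    | ite_false _ _ _ _ _ _ t hlt h => exact ⟨fun h => absurd h hlt, fun _ => ⟨_, _, h, hQ⟩⟩
  · rintro ⟨h1, h2⟩
    by_cases hlt : e.eval σ < e'.eval σ
    · obtain ⟨t, σ', h, hQ⟩ := h1 hlt
      exact ⟨_, _, Run.ite_true _ _ _ _ _ _ _ hlt h, hQ⟩
    · obtain ⟨t, σ', h, hQ⟩ := h2 hlt
      exact ⟨_, _, Run.ite_false _ _ _ _ _ _ _ hlt h, hQ⟩

/-- A loop whose body preserves an invariant and whose running time is paid from a potential. -/
lemma loop (I : State → Prop) (Φ : State → ℕ) (hI : I σ)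
    (hbody : ∀ σ, I σ → e.eval σ < e'.eval σ →
      Runs c σ fun t σ' => I σ' ∧ e.cost + e'.cost + 1 + t + Φ σ' ≤ Φ σ) :
    Runs (Prog.loop e e' c) σ fun t σ' => I σ' ∧ ¬ e.eval σ' < e'.eval σ' ∧
      t + Φ σ' ≤ Φ σ + (e.cost + e'.cost + 1) := by
  -- A round takes at least one step for its test, so the potential strictly decreases and the loop
  -- terminates.
  induction h : Φ σ using Nat.strong_induction_on generalizing σ with
  | _ s ih =>
    by_cases hlt : e.eval σ < e'.eval σ
    · obtain ⟨t, σ', h1, h2, h3⟩ := hbody σ hI hlt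
      obtain ⟨t', σ'', h4, h5, h6, h7⟩ := ih (Φ σ') (by omega) h2 rfl
      exact ⟨_, _, Run.loop_true _ _ _ _ _ _ _ _ hlt h1 h4, h5, h6, by omega⟩
    · exact ⟨_, _, Run.loop_false _ _ _ _ hlt, hI, hlt, by omega⟩

end Runs

/-- `for x < e do c`. -/
def Prog.for (x : ℕ) (e : Expr) (c : Prog) : Prog :=
  .seq (.assign x (.lit 0)) (.loop (.var x) e (.seq c (.assign x (.add (.var x) (.lit 1)))))

/-- A counting loop; `cost i` bounds the running time of the body in round `i`. -/
lemma Runs.for {x : ℕ} {e : Expr} {c : Prog} {σ : State} (N : ℕ) (cost : ℕ → ℕ)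
    (I : ℕ → State → Prop) (hx : c.writesReg x = false)
    (hI : I 0 (σ.setReg x 0))
    (he : ∀ i σ', Frame (Prog.for x e c) σ σ' → σ'.reg x = i → I i σ' → e.eval σ' = N)
    (hbody : ∀ i σ', Frame (Prog.for x e c) σ σ' → σ'.reg x = i → i < N → I i σ' →
      Runs c σ' fun t σ'' => I (i + 1) (σ''.setReg x (i + 1)) ∧ t ≤ cost i) :
    Runs (Prog.for x e c) σ fun t σ' => I N σ' ∧ σ'.reg x = N ∧
      t ≤ ∑ i ∈ range N, (cost i + (e.cost + 6)) + e.cost + 4 := by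
  have hfr : ∀ {σ₁ σ₂ : State}, Frame (Prog.for x e c) σ σ₁ →
      Frame (.seq c (.assign x (.add (.var x) (.lit 1)))) σ₁ σ₂ →
      Frame (Prog.for x e c) σ σ₂ := by
    intro σ₁ σ₂ h1 h2
    refine ⟨fun y hy => ?_, fun y hy => ?_, fun hy => ?_⟩
    · rw [h2.reg y, h1.reg y hy]
      simp_all [Prog.for, Prog.writesReg]
    · rw [h2.arr y, h1.arr y hy]
      simp_all [Prog.for, Prog.writesArr]
    · rw [h2.out, h1.out hy]
      simp_all [Prog.for, Prog.emits]
  have hloop := Runs.loop (c := .seq c (.assign x (.add (.var x) (.lit 1)))) (e := .var x) (e' := e)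
    (σ := σ.setReg x 0)
    (fun σ' => Frame (Prog.for x e c) σ σ' ∧ σ'.reg x ≤ N ∧ I (σ'.reg x) σ')
    -- Apart from the body, a round pays e.cost + 2 for the test and 4 for the increment.
    (fun σ' => ∑ i ∈ Ico (σ'.reg x) N, (cost i + (e.cost + 6)))
    ⟨⟨fun y hy => by
        simp only [Prog.for, Prog.writesReg, Bool.or_eq_false_iff, decide_eq_false_iff_not] at hy
        simp [State.setReg_reg, hy.1], fun _ _ => rfl, fun _ => rfl⟩,
      by simp [State.setReg_reg], by simpa [State.setReg_reg] using hI⟩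
    (by
      rintro σ₁ ⟨h1, h2, h3⟩ hlt
      rw [he _ σ₁ h1 rfl h3] at hlt
      simp only [Expr.eval] at hlt
      obtain ⟨t, σ₂, h4, h5, h6⟩ := hbody _ σ₁ h1 rfl hlt h3
      have h7 : σ₂.reg x = σ₁.reg x := h4.frame.reg x hx
      have h8 := Run.seq _ _ _ _ _ _ _ h4 (Run.assign x (.add (.var x) (.lit 1)) σ₂)
      refine ⟨_, _, h8, ⟨hfr h1 h8.frame, ?_⟩, ?_⟩
      · simp only [Expr.eval, Function.update_self, h7]
        refine ⟨hlt, ?_⟩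
        simpa [State.setReg] using h5
      · simp only [Expr.eval, Function.update_self, h7, Expr.cost]
        rw [Finset.sum_eq_sum_Ico_succ_bot hlt]
        omega)
  refine Runs.seq_iff.2 (Runs.assign_iff.2 ?_)
  refine hloop.mono fun t σ' _ ⟨⟨h1, h2, h3⟩, h4, h5⟩ => ?_
  rw [he _ σ' h1 rfl h3] at h4
  simp only [Expr.eval] at h4
  have h6 : σ'.reg x = N := by omega
  rw [h6] at h3 h5
  refine ⟨h3, h6, ?_⟩
  simp only [State.setReg_reg, if_true, Expr.cost, Nat.Ico_zero_eq_range, Ico_self, sum_empty]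
    at h5 ⊢
  omega

/-! ### Matchings stored in arrays -/

section Arrays

variable {n k : ℕ} {R : ℕ → ℕ → Prop} {L : ℕ → List ℕ} {mA mB : ℕ → ℕ}

/-- The arrays `mA` and `mB` store a matching in the graph `R`: `0` stands for an unmatched node,
and `x + 1` for the partner `x`. -/
structure Mates (n : ℕ) (R : ℕ → ℕ → Prop) (mA mB : ℕ → ℕ) : Prop where
  left : ∀ a b, a < n → mA a = b + 1 → b < n ∧ R a b ∧ mB b = a + 1
  right : ∀ a b, b < n → mB b = a + 1 → a < n ∧ mA a = b + 1

/-- The matching stored in two arrays. -/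
def Mates.toPEquiv (h : Mates n R mA mB) : Fin n ≃. Fin n where
  toFun a := if ha : mA a = 0 then none else
    some ⟨mA a - 1, (h.left a _ a.2 (Nat.succ_pred ha).symm).1⟩
  invFun b := if hb : mB b = 0 then none else
    some ⟨mB b - 1, (h.right _ b b.2 (Nat.succ_pred hb).symm).1⟩
  inv a b := by
    simp only [Option.dite_none_left_eq_some, Option.some_inj, Fin.ext_iff]
    constructor
    · rintro ⟨hb, e⟩
      have := (h.right _ b b.2 (Nat.succ_pred hb).symm).2
      rw [Nat.pred_eq_sub_one, e] at this
      exact ⟨by omega, by omega⟩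
    · rintro ⟨ha, e⟩
      have := (h.left a _ a.2 (Nat.succ_pred ha).symm).2.2
      rw [Nat.pred_eq_sub_one, e] at this
      exact ⟨by omega, by omega⟩

lemma Mates.toPEquiv_eq_some (h : Mates n R mA mB) {a b : Fin n} :
    h.toPEquiv a = some b ↔ mA a = b + 1 := by
  change (if ha : mA a = 0 then none else some _) = some b ↔ _
  simp only [Option.dite_none_left_eq_some, Option.some_inj, Fin.ext_iff]
  exact ⟨fun ⟨_, _⟩ => by omega, fun _ => ⟨by omega, by omega⟩⟩

lemma Mates.toPEquiv_eq_none (h : Mates n R mA mB) {a : Fin n} :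
    h.toPEquiv a = none ↔ mA a = 0 := by
  change (if ha : mA a = 0 then none else some _) = none ↔ _
  simp

lemma Mates.symm_eq_none (h : Mates n R mA mB) {b : Fin n} :
    h.toPEquiv.symm b = none ↔ mB b = 0 := by
  change (if hb : mB b = 0 then none else some _) = none ↔ _
  simp

lemma Mates.isMatching (h : Mates n R mA mB) :
    IsMatching (fun a b : Fin n => R a b) h.toPEquiv :=
  fun a b hab => (h.left a b a.2 (h.toPEquiv_eq_some.1 hab)).2.1

/-- The number of unmatched agents. -/
def freeCount (n : ℕ) (mA : ℕ → ℕ) : ℕ := ∑ a ∈ range n, if mA a = 0 then 1 else 0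

lemma Mates.msize_add_freeCount (h : Mates n R mA mB) :
    msize h.toPEquiv + freeCount n mA = n := by
  rw [msize, Finset.card_filter, freeCount, Finset.sum_range, ← Finset.sum_add_distrib]
  have : ∀ a : Fin n, (if (h.toPEquiv a).isSome then 1 else 0) + (if mA a = 0 then 1 else 0) = 1 := by
    intro a
    by_cases ha : mA a = 0
    · simp [ha, h.toPEquiv_eq_none.2 ha]
    · have : (h.toPEquiv a).isSome :=
        Option.isSome_iff_ne_none.2 fun h' => ha (h.toPEquiv_eq_none.1 h')
      simp [ha, this]
  simp [this]

/-- A sum over the matched objects is a sum over the matched agents. -/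
lemma Mates.sum_eq (h : Mates n R mA mB) (f : ℕ → ℕ) :
    ∑ a ∈ range n, (if mA a = 0 then 0 else f (mA a - 1)) =
      ∑ b ∈ range n, if mB b = 0 then 0 else f b := by
  have := pequiv_sum_elim h.toPEquiv (fun b => f b)
  rw [Finset.sum_range, Finset.sum_range]
  convert this using 2 with a _ b _
  · rcases e : h.toPEquiv a with _ | b
    · rw [h.toPEquiv_eq_none] at e; simp [e]
    · rw [h.toPEquiv_eq_some] at e; simp [e]
  · by_cases hb : mB b = 0
    · simp [hb, h.symm_eq_none.2 hb]
    · have : (h.toPEquiv.symm b).isSome :=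
        Option.isSome_iff_ne_none.2 fun h' => hb (h.symm_eq_none.1 h')
      simp [hb, this]

/-- The symmetric situation, with a function of the agents. -/
lemma Mates.sum_eq' (h : Mates n R mA mB) (f : ℕ → ℕ) :
    ∑ b ∈ range n, (if mB b = 0 then 0 else f (mB b - 1)) =
      ∑ a ∈ range n, if mA a = 0 then 0 else f a := by
  have h' : Mates n (fun _ _ => True) mB mA :=
    ⟨fun b a hb e => ⟨(h.right a b hb e).1, trivial, (h.right a b hb e).2⟩,
      fun b a ha e => ⟨(h.left a b ha e).1, (h.left a b ha e).2.2⟩⟩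
  exact h'.sum_eq f

/-- Weak duality: the size of a matching is at most that of a vertex cover. -/
lemma msize_le_cover {N : Fin n ≃. Fin n} (hN : IsMatching (fun a b : Fin n => R a b) N)
    (CA CB : ℕ → Prop) [DecidablePred CA] [DecidablePred CB]
    (hC : ∀ a b, a < n → b < n → R a b → CA a ∨ CB b) :
    msize N ≤ (∑ a ∈ range n, if CA a then 1 else 0) + ∑ b ∈ range n, if CB b then 1 else 0 := by
  have h1 := pequiv_sum_elim_le N (fun b => if CB b then 1 else 0)
  rw [Finset.sum_range, Finset.sum_range]
  refine le_trans ?_ (Nat.add_le_add_left h1 _)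
  rw [msize_eq_sum, ← Finset.sum_add_distrib]
  refine Finset.sum_le_sum fun a _ => ?_
  rcases e : N a with _ | b
  · simp
  · rcases hC a b a.2 b.2 (hN a b e) with h | h <;> simp [h]

/-- The number `ν` bounds the size of all matchings in `R`. -/
def MatchingBound (n : ℕ) (R : ℕ → ℕ → Prop) (ν : ℕ) : Prop :=
  ∀ N : Fin n ≃. Fin n, IsMatching (fun a b : Fin n => R a b) N → msize N ≤ ν

lemma Mates.le_bound (h : Mates n R mA mB) {ν : ℕ} (hν : MatchingBound n R ν) :
    n ≤ ν + freeCount n mA := by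
  have := hν _ h.isMatching
  have := h.msize_add_freeCount
  omega

lemma Mates.isMaximum (h : Mates n R mA mB) (hν : MatchingBound n R (n - freeCount n mA)) :
    IsMaximumMatching (fun a b : Fin n => R a b) h.toPEquiv := by
  refine ⟨h.isMatching, fun N hN => (hν N hN).trans ?_⟩
  have := h.msize_add_freeCount
  omega

/-- The change of a single summand, in a form without truncated subtraction. -/
lemma sum_update_add {n i : ℕ} (hi : i < n) (f : ℕ → ℕ → ℕ) (g : ℕ → ℕ) (v : ℕ) :
    (∑ j ∈ range n, f j (Function.update g i v j)) + f i (g i) =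
      (∑ j ∈ range n, f j (g j)) + f i v := by
  have hm : i ∈ range n := mem_range.2 hi
  rw [← Finset.add_sum_erase _ _ hm, ← Finset.add_sum_erase _ (fun j => f j (g j)) hm]
  have : ∑ j ∈ (range n).erase i, f j (Function.update g i v j) =
      ∑ j ∈ (range n).erase i, f j (g j) :=
    Finset.sum_congr rfl fun j hj => by rw [Function.update_of_ne (Finset.ne_of_mem_erase hj)]
  simp only [Function.update_self, this]; omega

/-! #### The labelling phase -/

/-- The invariant of the labelling phase. Object `b` has the label `d b`; agent `a` has tried all
objects with labels less than `v a`, and at label `v a` those at positions less than `p a` of her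
list. The agent `cur - 1` is about to be matched, and those from `nxt` on are still waiting. -/
structure PushInv (n k : ℕ) (R : ℕ → ℕ → Prop) (L : ℕ → List ℕ) (mA mB d v p : ℕ → ℕ)
    (cur nxt : ℕ) : Prop where
  mates : Mates n R mA mB
  d_le : ∀ b, b < n → d b ≤ k
  d_zero : ∀ b, b < n → mB b = 0 → d b = 0
  v_le : ∀ a, a < n → v a ≤ k
  p_le : ∀ a, a < n → p a ≤ (L a).length
  lower : ∀ a b, a < n → R a b → v a ≤ d b
  passed : ∀ a, a < n → ∀ i (h : i < (L a).length), i < p a → R a (L a)[i] → v a < d (L a)[i]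
  upper : ∀ a b, a < n → mA a = b + 1 → d b ≤ v a + 1
  gave_up : ∀ a, a < n → a < nxt → mA a = 0 → a + 1 ≠ cur → v a = k
  fresh : ∀ a, a < n → nxt ≤ a → mA a = 0
  cur_le : cur ≤ nxt
  cur_free : cur ≠ 0 → mA (cur - 1) = 0
  nxt_le : nxt ≤ n

/-- The potential of the labelling phase. -/
def pushPot (n k : ℕ) (L : ℕ → List ℕ) (d v p : ℕ → ℕ) (cur nxt : ℕ) : ℕ :=
  (∑ a ∈ range n, ((k + 1) * ((L a).length + 1) - (v a * ((L a).length + 1) + p a))) +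
    (∑ b ∈ range n, (k - d b)) + 2 * (n - nxt) + if cur = 0 then 0 else 1

section Push

variable {d v p : ℕ → ℕ} {cur nxt : ℕ}

lemma PushInv.init (hA : ∀ i, i < n → mA i = 0) (hB : ∀ i, i < n → mB i = 0)
    (hd : ∀ i, i < n → d i = 0) (hv : ∀ i, i < n → v i = 0) (hp : ∀ i, i < n → p i = 0) :
    PushInv n k R L mA mB d v p 0 0 where
  mates := ⟨fun a b ha e => by simp [hA a ha] at e, fun a b hb e => by simp [hB b hb] at e⟩
  d_le b hb := by simp [hd b hb]
  d_zero b hb _ := hd b hb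
  v_le a ha := by simp [hv a ha]
  p_le a ha := by simp [hp a ha]
  lower a b ha _ := by simp [hv a ha]
  passed a ha i _ h := by simp [hp a ha] at h
  upper a b ha h := by simp [hA a ha] at h
  gave_up a _ h := absurd h (Nat.not_lt_zero _)
  fresh a ha _ := hA a ha
  cur_le := le_rfl
  cur_free h := absurd rfl h
  nxt_le := Nat.zero_le _

/-- A waiting agent has weight 2 in the potential: one unit pays for this step, the other is held as
long as some agent is active. -/
lemma PushInv.activate (h : PushInv n k R L mA mB d v p 0 nxt) (hn : nxt < n) :
    PushInv n k R L mA mB d v p (nxt + 1) (nxt + 1) ∧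
      pushPot n k L d v p (nxt + 1) (nxt + 1) + 1 ≤ pushPot n k L d v p 0 nxt := by
  refine ⟨{ h with
    gave_up := fun a ha h1 h2 h3 => h.gave_up a ha (by omega) h2 (by omega)
    fresh := fun a ha h1 => h.fresh a ha (by omega)
    cur_le := le_rfl
    cur_free := fun _ => h.fresh nxt hn le_rfl
    nxt_le := hn }, ?_⟩
  simp only [pushPot]
  simp
  omega

lemma PushInv.giveUp (h : PushInv n k R L mA mB d v p cur nxt) (hc : cur ≠ 0)
    (hv : ¬ v (cur - 1) < k) :
    PushInv n k R L mA mB d v p 0 nxt ∧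
      pushPot n k L d v p 0 nxt + 1 ≤ pushPot n k L d v p cur nxt := by
  have := h.cur_le
  have := h.nxt_le
  refine ⟨{ h with
    gave_up := fun a ha h1 h2 h3 => by
      by_cases hac : a + 1 = cur
      · have e : a = cur - 1 := by omega
        have := h.v_le a ha
        subst e
        omega
      · exact h.gave_up a ha h1 h2 hac
    cur_le := Nat.zero_le _
    cur_free := fun h => absurd rfl h }, ?_⟩
  simp [pushPot, hc]

/-- Keeps the truncated difference of an agent in `pushPot` positive, so that one more step really
lowers it. -/
lemma PushInv.agentPot_le (h : PushInv n k R L mA mB d v p cur nxt) {a : ℕ} (ha : a < n) :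
    v a * ((L a).length + 1) + p a + 1 ≤ (k + 1) * ((L a).length + 1) := by
  have h1 := h.p_le a ha
  have h2 := Nat.mul_le_mul_right ((L a).length + 1) (h.v_le a ha)
  rw [Nat.add_mul]
  omega

/-- The list is exhausted, so by `passed` all objects along edges of the agent have labels above v,
and `lower` survives v + 1. The pair (v, p) advances from (v, deg) to (v + 1, 0), which is one step
in the count v(deg + 1) + p. Since the agent is unmatched, `upper` does not concern her. -/
lemma PushInv.relabel (hL : ∀ a b, R a b → b ∈ L a)
    (h : PushInv n k R L mA mB d v p cur nxt) (hc : cur ≠ 0)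
    (hv : v (cur - 1) < k) (hp : ¬ p (cur - 1) < (L (cur - 1)).length) :
    PushInv n k R L mA mB d (Function.update v (cur - 1) (v (cur - 1) + 1))
        (Function.update p (cur - 1) 0) cur nxt ∧
      pushPot n k L d (Function.update v (cur - 1) (v (cur - 1) + 1))
        (Function.update p (cur - 1) 0) cur nxt + 1 ≤ pushPot n k L d v p cur nxt := by
  have hcn : cur - 1 < n := by
    have := h.cur_le
    have := h.nxt_le
    omega
  have hfree := h.cur_free hc
  have hpot := h.agentPot_le hcn
  have hple := h.p_le _ hcn
  generalize hcc : cur - 1 = c at *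
  refine ⟨{ h with
    v_le := fun a ha => ?_
    p_le := fun a ha => ?_
    lower := fun a b ha hab => ?_
    passed := fun a ha i hi hip hab => ?_
    upper := fun a b ha hab => ?_
    gave_up := fun a ha h1 h2 h3 => ?_ }, ?_⟩
  · by_cases e : a = c
    · subst e; simpa using hv
    · simpa [e] using h.v_le a ha
  · by_cases e : a = c
    · subst e; simp
    · simpa [e] using h.p_le a ha
  · by_cases e : a = c
    · subst e
      obtain ⟨i, hi, rfl⟩ := List.getElem_of_mem (hL a b hab)
      simpa using h.passed a ha i hi (by omega) hab
    · simpa [e] using h.lower a b ha hab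
  · by_cases e : a = c
    · subst e; simp at hip
    · simp only [Function.update_of_ne e] at hip ⊢
      exact h.passed a ha i hi hip hab
  · by_cases e : a = c
    · subst e; omega
    · simpa [e] using h.upper a b ha hab
  · by_cases e : a = c
    · omega
    · simpa [e] using h.gave_up a ha h1 h2 h3
  · have h1 : (∑ a ∈ range n, ((k + 1) * ((L a).length + 1) -
        (Function.update v c (v c + 1) a * ((L a).length + 1) + Function.update p c 0 a))) + 1 ≤
        ∑ a ∈ range n, ((k + 1) * ((L a).length + 1) - (v a * ((L a).length + 1) + p a)) := by
      refine Nat.succ_le_of_lt (Finset.sum_lt_sum (fun a _ => ?_) ⟨c, mem_range.2 hcn, ?_⟩)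
      · by_cases e : a = c
        · subst e
          simp only [Function.update_self, Nat.add_mul]
          omega
        · simp [e]
      · simp only [Function.update_self, Nat.add_mul] at hpot ⊢
        omega
    simp only [pushPot]
    omega

lemma PushInv.advance (h : PushInv n k R L mA mB d v p cur nxt) (hc : cur ≠ 0)
    (hp : p (cur - 1) < (L (cur - 1)).length)
    (hb : R (cur - 1) (L (cur - 1))[p (cur - 1)] → v (cur - 1) < d (L (cur - 1))[p (cur - 1)]) :
    PushInv n k R L mA mB d v (Function.update p (cur - 1) (p (cur - 1) + 1)) cur nxt ∧
      pushPot n k L d v (Function.update p (cur - 1) (p (cur - 1) + 1)) cur nxt + 1 ≤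
        pushPot n k L d v p cur nxt := by
  have hcn : cur - 1 < n := by
    have := h.cur_le
    have := h.nxt_le
    omega
  have hpot := h.agentPot_le hcn
  generalize hcc : cur - 1 = c at *
  refine ⟨{ h with
    p_le := fun a ha => ?_
    passed := fun a ha i hi hip hab => ?_ }, ?_⟩
  · by_cases e : a = c
    · subst e; simpa using hp
    · simpa [e] using h.p_le a ha
  · by_cases e : a = c
    · subst e
      simp only [Function.update_self] at hip
      rcases Nat.lt_succ_iff_lt_or_eq.1 hip with h1 | rfl
      · exact h.passed a ha i hi h1 hab
      · exact hb hab
    · simp only [Function.update_of_ne e] at hip ⊢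
      exact h.passed a ha i hi hip hab
  · have h1 : (∑ a ∈ range n, ((k + 1) * ((L a).length + 1) -
        (v a * ((L a).length + 1) + Function.update p c (p c + 1) a))) + 1 ≤
        ∑ a ∈ range n, ((k + 1) * ((L a).length + 1) - (v a * ((L a).length + 1) + p a)) := by
      refine Nat.succ_le_of_lt (Finset.sum_lt_sum (fun a _ => ?_) ⟨c, mem_range.2 hcn, ?_⟩)
      · by_cases e : a = c
        · subst e
          simp only [Function.update_self]
          omega
        · simp [e]
      · simp only [Function.update_self] at hpot ⊢
        omega
    simp only [pushPot]
    omega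

/-- The array of the agents' partners after the partner `x - 1` of an object has been dismissed. -/
def dismiss (m : ℕ → ℕ) (x : ℕ) : ℕ → ℕ := if 0 < x then Function.update m (x - 1) 0 else m

lemma dismiss_apply (m : ℕ → ℕ) (x a : ℕ) : dismiss m x a = if a + 1 = x then 0 else m a := by
  unfold dismiss
  rcases x with _ | x
  · simp
  · simp [Function.update_apply]

/-- An unmatched node takes b, and the former owner of b, if any, is released. This serves both the
labelling phase and, with the two sides exchanged, the augmentation. -/
lemma Mates.steal (h : Mates n R mA mB) {c b : ℕ} (hc : c < n) (hb : b < n) (hR : R c b)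
    (hfree : mA c = 0) :
    Mates n R (dismiss (Function.update mA c (b + 1)) (mB b)) (Function.update mB b (c + 1)) := by
  have hne : c + 1 ≠ mB b := fun e => by
    have := (h.right c b hb e.symm).2
    omega
  constructor
  · intro a b' ha e
    rw [dismiss_apply] at e
    split_ifs at e with h1
    by_cases hac : a = c
    · subst hac
      simp only [Function.update_self] at e
      have e : b' = b := by omega
      subst e
      exact ⟨hb, hR, by simp⟩
    · rw [Function.update_of_ne hac] at e
      obtain ⟨h2, h3, h4⟩ := h.left a b' ha e
      refine ⟨h2, h3, ?_⟩
      rw [Function.update_of_ne, h4]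
      rintro rfl
      omega
  · intro a b' hb' e
    rw [dismiss_apply]
    by_cases hbb : b' = b
    · subst hbb
      simp only [Function.update_self] at e
      have e : a = c := by omega
      subst e
      simp [hne, hc]
    · rw [Function.update_of_ne hbb] at e
      obtain ⟨h2, h3⟩ := h.right a b' hb' e
      have hac : a ≠ c := by rintro rfl; omega
      have : a + 1 ≠ mB b := fun e' => by
        have := (h.right a b hb e'.symm).2
        omega
      simp [this, hac, h2, h3]

/-- By `lower`, the label of b equals v, so it grows by one and stays at most k. Growing labels
preserve `lower` and `passed`. A displaced owner becomes the active agent and inherits its unit of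
potential. -/
lemma PushInv.bid (h : PushInv n k R L mA mB d v p cur nxt) (hc : cur ≠ 0)
    (hv : v (cur - 1) < k) {b : ℕ} (hb : b < n) (hR : R (cur - 1) b) (hd : ¬ v (cur - 1) < d b) :
    PushInv n k R L (dismiss (Function.update mA (cur - 1) (b + 1)) (mB b))
        (Function.update mB b cur) (Function.update d b (v (cur - 1) + 1)) v p (mB b) nxt ∧
      pushPot n k L (Function.update d b (v (cur - 1) + 1)) v p (mB b) nxt + 1 ≤
        pushPot n k L d v p cur nxt := by
  have hcn : cur - 1 < n := by
    have := h.cur_le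
    have := h.nxt_le
    omega
  have hfree := h.cur_free hc
  have hmates := h.mates.steal hcn hb hR hfree
  have hcur : cur - 1 + 1 = cur := by omega
  have hcl := h.cur_le
  rw [hcur] at hmates
  generalize hcc : cur - 1 = c at *
  have hlow := h.lower c b hcn hR
  have hd' : ∀ b', d b' ≤ Function.update d b (v c + 1) b' := fun b' => by
    by_cases e : b' = b
    · subst e; simp; omega
    · simp [e]
  have hold : mB b ≠ 0 → mB b - 1 < n ∧ mA (mB b - 1) = b + 1 := fun h0 =>
    h.mates.right _ b hb (by omega)
  refine ⟨⟨hmates, fun b' hb' => ?_, fun b' hb' e0 => ?_, h.v_le, h.p_le,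
    fun a b' ha hab => (h.lower a b' ha hab).trans (hd' b'),
    fun a ha i hi hip hab => (h.passed a ha i hi hip hab).trans_le (hd' _),
    fun a b' ha e => ?_, fun a ha h1 h2 h3 => ?_, fun a ha h1 => ?_, ?_, fun h0 => ?_,
    h.nxt_le⟩, ?_⟩
  · by_cases e : b' = b
    · subst e; simpa using hv
    · simpa [e] using h.d_le b' hb'
  · by_cases e : b' = b
    · subst e; simp at e0; omega
    · simp only [Function.update_of_ne e] at e0 ⊢
      exact h.d_zero b' hb' e0
  · rw [dismiss_apply] at e
    split_ifs at e with h1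
    by_cases hac : a = c
    · subst hac
      simp only [Function.update_self] at e
      have e : b' = b := by omega
      subst e
      simp
    · rw [Function.update_of_ne hac] at e
      rw [Function.update_of_ne]
      · exact h.upper a b' ha e
      · rintro rfl
        have := (h.mates.left a b' ha e).2.2
        omega
  · rw [dismiss_apply, if_neg h3] at h2
    by_cases hac : a = c
    · subst hac; simp at h2
    · rw [Function.update_of_ne hac] at h2
      exact h.gave_up a ha h1 h2 (by omega)
  · rw [dismiss_apply]
    split_ifs
    · rfl
    · rw [Function.update_of_ne (by omega)]
      exact h.fresh a ha h1
  · by_contra hlt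
    obtain ⟨h1, h2⟩ := hold (by omega)
    have := h.fresh _ h1 (by omega)
    omega
  · rw [dismiss_apply, if_pos (by omega)]
  · have h1 : (∑ b' ∈ range n, (k - Function.update d b (v c + 1) b')) + 1 ≤
        ∑ b ∈ range n, (k - d b) := by
      refine Nat.succ_le_of_lt (Finset.sum_lt_sum (fun a _ => Nat.sub_le_sub_left (hd' a) k)
        ⟨b, mem_range.2 hb, ?_⟩)
      simp only [Function.update_self]
      omega
    simp only [pushPot, hc, if_false]
    split_ifs <;> omega

/-- After the labelling phase, the number of unmatched agents exceeds the optimum by at most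
`n / k`. -/
lemma PushInv.bound (h : PushInv n k R L mA mB d v p 0 n) {ν : ℕ}
    (hν : ∃ N : Fin n ≃. Fin n, IsMatching (fun a b : Fin n => R a b) N ∧ msize N = ν) :
    k * (ν + freeCount n mA - n) ≤ n := by
  classical
  obtain ⟨N, hN, rfl⟩ := hν
  -- For each threshold j, the agents whose partner has label at most j and the objects with label
  -- at least j form a vertex cover. Indeed, an edge to an object with label below j has v(a) < j ≤
  -- k, so a has not given up, and her partner has label at most v(a) + 1 ≤ j. Unmatched objects
  -- have label 0, so the cover exceeds the matching only by the objects with label exactly j.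
  have hcov : ∀ j ∈ Ico 1 (k + 1), msize N + freeCount n mA ≤
      n + ∑ b ∈ range n, if d b = j then 1 else 0 := by
    intro j hj
    rw [mem_Ico] at hj
    have h1 := msize_le_cover hN (fun a => mA a ≠ 0 ∧ d (mA a - 1) ≤ j) (fun b => j ≤ d b)
      (by
        intro a b ha hb hab
        by_contra hc
        push Not at hc
        obtain ⟨hc1, hc2⟩ := hc
        have h1 := h.lower a b ha hab
        have hm : mA a ≠ 0 := fun h0 => by
          have := h.gave_up a ha ha h0 (by omega)
          omega
        have h2 := h.upper a (mA a - 1) ha (by omega)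
        have := hc1 hm
        omega)
    have h2 := h.mates.sum_eq (fun b => if d b ≤ j then 1 else 0)
    have h3 : ∑ a ∈ range n, (if mA a ≠ 0 ∧ d (mA a - 1) ≤ j then 1 else 0) =
        ∑ a ∈ range n, (if mA a = 0 then 0 else if d (mA a - 1) ≤ j then 1 else 0) :=
      Finset.sum_congr rfl fun a _ => by by_cases h0 : mA a = 0 <;> simp [h0]
    have h5 := h.mates.sum_eq (fun _ => 1)
    have h6 : freeCount n mA + ∑ a ∈ range n, (if mA a = 0 then 0 else 1) = n := by
      rw [freeCount, ← Finset.sum_add_distrib]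
      rw [Finset.sum_congr rfl (g := fun _ => 1) fun a _ => by split_ifs <;> rfl]
      simp
    have h4 : ∑ b ∈ range n, (if mB b = 0 then 0 else if d b ≤ j then 1 else 0) +
        ∑ b ∈ range n, (if j ≤ d b then 1 else 0) =
        ∑ b ∈ range n, (if mB b = 0 then 0 else 1) + ∑ b ∈ range n, if d b = j then 1 else 0 := by
      rw [← Finset.sum_add_distrib, ← Finset.sum_add_distrib]
      refine Finset.sum_congr rfl fun b hb => ?_
      by_cases h0 : mB b = 0
      · have := h.d_zero b (mem_range.1 hb) h0
        rw [if_pos h0, if_neg (by omega), if_pos h0, if_neg (by omega)]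
      · simp only [h0, if_false]
        split_ifs <;> omega
    rw [h3, h2] at h1
    omega
  -- Every object has one label, so over all k thresholds the excess is at most n.
  have h1 : ∑ j ∈ Ico 1 (k + 1), ∑ b ∈ range n, (if d b = j then 1 else 0) ≤ n := by
    rw [Finset.sum_comm]
    refine (Finset.sum_le_sum (g := fun _ => 1) fun b _ => ?_).trans (by simp)
    rw [Finset.sum_ite_eq]
    split_ifs <;> simp
  have h2 := Finset.sum_le_sum (f := fun _ => msize N + freeCount n mA - n)
    (g := fun j => ∑ b ∈ range n, if d b = j then 1 else 0)
    (fun j hj => by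
      have := hcov j hj
      omega)
  simp only [sum_const, Nat.card_Ico, Nat.add_sub_cancel, smul_eq_mul] at h2
  exact h2.trans h1

end Push

/-! #### The search phase -/

/-- The invariant of a breadth-first search for an augmenting path. An object `b` that was reached
from the agent `a` has `par b = a + 1`; the queue `Q` has its head and its tail at the given
positions; `j` is the position in the list of the first agent of the queue. When an unmatched object
has been reached, it is `found - 1`. -/
structure SearchInv (n : ℕ) (R : ℕ → ℕ → Prop) (L : ℕ → List ℕ) (mA mB par Q : ℕ → ℕ)
    (head tail j found : ℕ) : Prop where
  mates : Mates n R mA mB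
  queue_lt : ∀ i, i < tail → Q i < n
  queue_src : ∀ i, i < tail → mA (Q i) = 0 ∨ ∃ b, b < n ∧ mA (Q i) = b + 1 ∧ par b ≠ 0
  free_mem : ∀ a, a < n → mA a = 0 → ∃ i, i < tail ∧ Q i = a
  par_spec : ∀ b a, b < n → par b = a + 1 → R a b ∧ ∃ i, i < tail ∧ Q i = a
  reached : ∀ b, b < n → par b ≠ 0 → b + 1 ≠ found → ∃ i, i < tail ∧ mB b = Q i + 1
  scanned : ∀ i, i < head → ∀ b, b < n → R (Q i) b → par b ≠ 0
  scanning : head < tail → j ≤ (L (Q head)).length ∧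
    ∀ i (h : i < (L (Q head)).length), i < j → R (Q head) (L (Q head))[i] →
      par (L (Q head))[i] ≠ 0
  rank : ∃ dep : ℕ → ℕ, ∀ b a a', b < n → par b = a + 1 → mB b = a' + 1 → dep a < dep a'
  found_spec : found ≠ 0 → found - 1 < n ∧ mB (found - 1) = 0 ∧ par (found - 1) ≠ 0
  head_le : head ≤ tail

/-- The potential of the search. -/
def searchPot (n : ℕ) (L : ℕ → List ℕ) (mB par Q : ℕ → ℕ) (head tail j : ℕ) : ℕ :=
  (∑ b ∈ range n, if mB b = 0 then 0 else if par b = 0 then (L (mB b - 1)).length + 1 else 0) +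
    (∑ i ∈ Ico head tail, ((L (Q i)).length + 1)) - j

section Search

variable {par Q : ℕ → ℕ} {head tail j found : ℕ}

lemma SearchInv.next (hL : ∀ a b, R a b → b ∈ L a)
    (h : SearchInv n R L mA mB par Q head tail j found) (ht : head < tail)
    (hj : ¬ j < (L (Q head)).length) :
    SearchInv n R L mA mB par Q (head + 1) tail 0 found ∧
      searchPot n L mB par Q (head + 1) tail 0 + 1 ≤ searchPot n L mB par Q head tail j := by
  obtain ⟨h1, h2⟩ := h.scanning ht
  refine ⟨{ h with
    scanned := fun i hi b hb hR => ?_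
    scanning := fun _ => ⟨Nat.zero_le _, fun i _ hi => absurd hi (Nat.not_lt_zero _)⟩
    head_le := ht }, ?_⟩
  · rcases Nat.lt_succ_iff_lt_or_eq.1 hi with h3 | rfl
    · exact h.scanned i h3 b hb hR
    · obtain ⟨l, hl, rfl⟩ := List.getElem_of_mem (hL _ b hR)
      exact h2 l hl (by omega) hR
  · simp only [searchPot]
    rw [Finset.sum_eq_sum_Ico_succ_bot ht]
    omega

lemma SearchInv.advance (h : SearchInv n R L mA mB par Q head tail j found) (ht : head < tail)
    (hj : j < (L (Q head)).length)
    (hb : R (Q head) (L (Q head))[j] → par (L (Q head))[j] ≠ 0) :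
    SearchInv n R L mA mB par Q head tail (j + 1) found ∧
      searchPot n L mB par Q head tail (j + 1) + 1 ≤ searchPot n L mB par Q head tail j := by
  refine ⟨{ h with
    scanning := fun _ => ⟨hj, fun i hi hij hR => ?_⟩ }, ?_⟩
  · rcases Nat.lt_succ_iff_lt_or_eq.1 hij with h3 | rfl
    · exact (h.scanning ht).2 i hi h3 hR
    · exact hb hR
  · simp only [searchPot]
    rw [Finset.sum_eq_sum_Ico_succ_bot ht]
    omega

/-- An unmatched object contributes neither to the potential nor to the rank condition, so only the
position in the list matters. -/
lemma SearchInv.find (h : SearchInv n R L mA mB par Q head tail j 0) (ht : head < tail)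
    (hj : j < (L (Q head)).length) {b : ℕ} (hbj : (L (Q head))[j] = b) (hb : b < n)
    (hR : R (Q head) b) (hp : par b = 0) (hm : mB b = 0) :
    SearchInv n R L mA mB (Function.update par b (Q head + 1)) Q head tail (j + 1) (b + 1) ∧
      searchPot n L mB (Function.update par b (Q head + 1)) Q head tail (j + 1) + 1 ≤
        searchPot n L mB par Q head tail j := by
  have hmono : ∀ b', par b' ≠ 0 → Function.update par b (Q head + 1) b' ≠ 0 := fun b' h' => by
    by_cases e : b' = b
    · subst e; simp
    · simpa [e] using h'
  obtain ⟨dep, hdep⟩ := h.rank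
  refine ⟨{ h with
    queue_src := fun i hi => (h.queue_src i hi).imp_right fun ⟨b', h1, h2, h3⟩ =>
      ⟨b', h1, h2, hmono _ h3⟩
    par_spec := fun b' a hb' e => ?_
    reached := fun b' hb' hp' hne => ?_
    scanned := fun i hi b' hb' hR' => hmono _ (h.scanned i hi b' hb' hR')
    scanning := fun _ => ⟨hj, fun i hi hij hR' => ?_⟩
    rank := ⟨dep, fun b' a a' hb' e e' => ?_⟩
    found_spec := fun _ => ⟨by simpa using hb, by simpa using hm, by simp⟩ }, ?_⟩
  · by_cases hbb : b' = b
    · subst hbb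
      simp only [Function.update_self] at e
      have e : a = Q head := by omega
      subst e
      exact ⟨hR, head, ht, rfl⟩
    · rw [Function.update_of_ne hbb] at e
      exact h.par_spec b' a hb' e
  · have hbb : b' ≠ b := by omega
    rw [Function.update_of_ne hbb] at hp'
    exact h.reached b' hb' hp' (by omega)
  · rcases Nat.lt_succ_iff_lt_or_eq.1 hij with h3 | rfl
    · exact hmono _ ((h.scanning ht).2 i hi h3 hR')
    · rw [hbj]; simp
  · have hbb : b' ≠ b := by rintro rfl; omega
    rw [Function.update_of_ne hbb] at e
    exact hdep b' a a' hb' e e'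
  · simp only [searchPot]
    rw [Finset.sum_eq_sum_Ico_succ_bot ht]
    have : ∑ b' ∈ range n, (if mB b' = 0 then 0 else
        if Function.update par b (Q head + 1) b' = 0 then (L (mB b' - 1)).length + 1 else 0) =
        ∑ b ∈ range n, if mB b = 0 then 0 else if par b = 0 then (L (mB b - 1)).length + 1 else 0 :=
      Finset.sum_congr rfl fun b' _ => by
        by_cases e : b' = b
        · subst e; simp [hm]
        · simp [e]
    omega

/-- The list of the mate of b moves from the first sum of the potential, over unreached objects, to
the second, over the queue. The mate is ranked one above the agent that reached b. -/
lemma SearchInv.extend (h : SearchInv n R L mA mB par Q head tail j 0) (ht : head < tail)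
    (hj : j < (L (Q head)).length) {b : ℕ} (hbj : (L (Q head))[j] = b) (hb : b < n)
    (hR : R (Q head) b) (hp : par b = 0) (hm : mB b ≠ 0) :
    SearchInv n R L mA mB (Function.update par b (Q head + 1))
        (Function.update Q tail (mB b - 1)) head (tail + 1) (j + 1) 0 ∧
      searchPot n L mB (Function.update par b (Q head + 1))
        (Function.update Q tail (mB b - 1)) head (tail + 1) (j + 1) + 1 ≤
        searchPot n L mB par Q head tail j := by
  have hmono : ∀ b', par b' ≠ 0 → Function.update par b (Q head + 1) b' ≠ 0 := fun b' h' => by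
    by_cases e : b' = b
    · subst e; simp
    · simpa [e] using h'
  have hQ : ∀ i, i < tail → Function.update Q tail (mB b - 1) i = Q i := fun i hi =>
    Function.update_of_ne (by omega) _ _
  have hmem : ∀ {P : ℕ → Prop}, (∃ i, i < tail ∧ P (Q i)) →
      ∃ i, i < tail + 1 ∧ P (Function.update Q tail (mB b - 1) i) := by
    rintro P ⟨i, hi, hP⟩
    exact ⟨i, by omega, by rwa [hQ i hi]⟩
  obtain ⟨hbn, hbm⟩ := h.mates.right (mB b - 1) b hb (by omega)
  obtain ⟨dep, hdep⟩ := h.rank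
  refine ⟨⟨h.mates, fun i hi => ?_, fun i hi => ?_, fun a ha h0 => hmem (P := fun x => x = a) (h.free_mem a ha h0),
    fun b' a hb' e => ?_, fun b' hb' hp' hne => ?_, fun i hi b' hb' hR' => ?_, fun _ => ?_,
    ⟨Function.update dep (mB b - 1) (dep (Q head) + 1), fun b' a a' hb' e e' => ?_⟩,
    fun h0 => absurd rfl h0, by omega⟩, ?_⟩
  · rcases Nat.lt_succ_iff_lt_or_eq.1 hi with h3 | rfl
    · rw [hQ i h3]; exact h.queue_lt i h3
    · simpa using hbn
  · rcases Nat.lt_succ_iff_lt_or_eq.1 hi with h3 | rfl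
    · rw [hQ i h3]
      exact (h.queue_src i h3).imp_right fun ⟨b', h1, h2, h3⟩ => ⟨b', h1, h2, hmono _ h3⟩
    · right
      exact ⟨b, hb, by simpa using hbm, by simp⟩
  · by_cases hbb : b' = b
    · subst hbb
      simp only [Function.update_self] at e
      have e : a = Q head := by omega
      subst e
      exact ⟨hR, hmem (P := fun x => x = Q head) ⟨head, ht, rfl⟩⟩
    · rw [Function.update_of_ne hbb] at e
      obtain ⟨h1, h2⟩ := h.par_spec b' a hb' e
      exact ⟨h1, hmem (P := fun x => x = a) h2⟩
  · by_cases hbb : b' = b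
    · subst hbb
      exact ⟨tail, by omega, by simp; omega⟩
    · rw [Function.update_of_ne hbb] at hp'
      exact hmem (P := fun x => mB b' = x + 1) (h.reached b' hb' hp' (by omega))
  · rw [hQ i (by omega)] at hR'
    exact hmono _ (h.scanned i hi b' hb' hR')
  · rw [hQ head ht]
    refine ⟨hj, fun i hi hij hR' => ?_⟩
    rcases Nat.lt_succ_iff_lt_or_eq.1 hij with h3 | rfl
    · exact hmono _ ((h.scanning ht).2 i hi h3 hR')
    · rw [hbj]; simp
  · have hsrc : ∀ i, i < tail → Q i ≠ mB b - 1 := fun i hi e => by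
      rcases h.queue_src i hi with h1 | ⟨b'', h1, h2, h3⟩
      · rw [e] at h1; omega
      · rw [e] at h2
        have : b'' = b := by omega
        subst this
        exact h3 hp
    by_cases hbb : b' = b
    · subst hbb
      simp only [Function.update_self] at e
      have e : a = Q head := by omega
      have e' : a' = mB b' - 1 := by omega
      subst e e'
      rw [Function.update_of_ne (hsrc head ht)]
      simp
    · rw [Function.update_of_ne hbb] at e
      obtain ⟨_, i, hi, hi'⟩ := h.par_spec b' a hb' e
      have hne : a' ≠ mB b - 1 := by
        rintro rfl
        have := (h.mates.right _ b' hb' e').2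
        omega
      rw [Function.update_of_ne hne, Function.update_of_ne (hi' ▸ hsrc i hi)]
      exact hdep b' a a' hb' e e'
  · simp only [searchPot]
    have h1 : ∑ i ∈ Ico head (tail + 1), ((L (Function.update Q tail (mB b - 1) i)).length + 1) =
        ∑ i ∈ Ico head tail, ((L (Q i)).length + 1) + ((L (mB b - 1)).length + 1) := by
      rw [Finset.sum_Ico_succ_top ht.le, Function.update_self]
      congr 1
      exact Finset.sum_congr rfl fun i hi => by rw [hQ i (mem_Ico.1 hi).2]
    have h2 := sum_update_add hb
      (fun b x => if mB b = 0 then 0 else if x = 0 then (L (mB b - 1)).length + 1 else 0) par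
      (Q head + 1)
    simp only [hm, hp, if_false, if_true, Nat.succ_ne_zero, Nat.add_zero] at h2
    rw [h1, Finset.sum_eq_sum_Ico_succ_bot ht]
    omega

/-- A failed search proves that the matching is maximum. -/
lemma SearchInv.isMaximum (h : SearchInv n R L mA mB par Q head tail j 0)
    (ht : ¬ head < tail) : MatchingBound n R (n - freeCount n mA) := by
  classical
  have hht : head = tail := by have := h.head_le; omega
  subst hht
  intro N hN
  -- König's cover: agents that were not reached and objects that were. Reached objects are matched
  -- and their mates are in the queue, so each edge of the matching is counted at most once, and
  -- unmatched agents not at all.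
  have h1 := msize_le_cover hN (fun a => ¬ ∃ i, i < head ∧ Q i = a) (fun b => par b ≠ 0)
    (by
      intro a b ha hb hR
      by_contra hc
      push Not at hc
      obtain ⟨⟨i, hi, rfl⟩, h2⟩ := hc
      exact h.scanned i hi b hb hR h2)
  have h2 := h.mates.sum_eq (fun b => if par b = 0 then 0 else 1)
  have h3 : ∑ b ∈ range n, (if par b ≠ 0 then 1 else 0) =
      ∑ b ∈ range n, (if mB b = 0 then 0 else if par b = 0 then 0 else 1) := by
    refine Finset.sum_congr rfl fun b hb => ?_
    by_cases hp : par b = 0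
    · simp [hp]
    · obtain ⟨i, hi, e⟩ := h.reached b (mem_range.1 hb) hp (by omega)
      simp [hp, e]
  have h4 : (∑ a ∈ range n, (if ¬ ∃ i, i < head ∧ Q i = a then 1 else 0)) +
      (∑ a ∈ range n, (if mA a = 0 then 0 else if par (mA a - 1) = 0 then 0 else 1)) +
      freeCount n mA ≤ n := by
    rw [freeCount, ← Finset.sum_add_distrib, ← Finset.sum_add_distrib]
    refine (Finset.sum_le_sum (g := fun _ => 1) fun a ha => ?_).trans (by simp)
    have ha := mem_range.1 ha
    by_cases h0 : mA a = 0
    · have := h.free_mem a ha h0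
      simp only [h0, this, not_true, if_true, if_false]; omega
    · simp only [h0, if_false]
      by_cases hp : par (mA a - 1) = 0
      · simp only [hp, if_true]; split_ifs <;> simp
      · obtain ⟨hb, -, e⟩ := h.mates.left a (mA a - 1) ha (by omega)
        obtain ⟨i, hi, e'⟩ := h.reached _ hb hp (by omega)
        have : ∃ i, i < head ∧ Q i = a := ⟨i, hi, by omega⟩
        simp [this, hp]
  omega

/-- The invariant of the augmentation along the path that ends in the object `cur - 1`. -/
structure AugInv (n : ℕ) (R : ℕ → ℕ → Prop) (mA₀ par dep : ℕ → ℕ) (mA mB : ℕ → ℕ)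
    (cur : ℕ) : Prop where
  mates : Mates n R mA mB
  working : cur ≠ 0 → cur - 1 < n ∧ mB (cur - 1) = 0 ∧ par (cur - 1) ≠ 0 ∧
    freeCount n mA = freeCount n mA₀ ∧
    ∀ a, a < n → dep a ≤ dep (par (cur - 1) - 1) → mA a = mA₀ a
  finished : cur = 0 → freeCount n mA + 1 = freeCount n mA₀

/-- The potential of the augmentation. -/
def augPot (n : ℕ) (par dep : ℕ → ℕ) (cur : ℕ) : ℕ :=
  if cur = 0 then 0 else ∑ a ∈ range n, if dep a ≤ dep (par (cur - 1) - 1) then 1 else 0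

lemma augPot_le (dep : ℕ → ℕ) (cur : ℕ) : augPot n par dep cur ≤ n := by
  unfold augPot
  split_ifs
  · simp
  · refine (Finset.sum_le_sum (g := fun _ => 1) fun a _ => ?_).trans (by simp)
    split_ifs <;> simp

/-- The parent a takes the object and releases her old partner, who is handled next; if she had
none, the path is complete. The next parent has smaller rank than a, so the agents still ahead on
the path keep their original partners, and a leaves the set counted by the potential. -/
lemma AugInv.step {mA₀ mB₀ dep : ℕ → ℕ} {cur : ℕ} (h₀ : Mates n R mA₀ mB₀)
    (hpar : ∀ b a, b < n → par b = a + 1 → a < n ∧ R a b ∧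
      (mA₀ a = 0 ∨ ∃ b', b' < n ∧ mA₀ a = b' + 1 ∧ par b' ≠ 0))
    (hdep : ∀ b a a', b < n → par b = a + 1 → mB₀ b = a' + 1 → dep a < dep a')
    (h : AugInv n R mA₀ par dep mA mB cur) (hc : cur ≠ 0) :
    AugInv n R mA₀ par dep (Function.update mA (par (cur - 1) - 1) cur)
        (dismiss (Function.update mB (cur - 1) (par (cur - 1))) (mA (par (cur - 1) - 1)))
        (mA (par (cur - 1) - 1)) ∧
      augPot n par dep (mA (par (cur - 1) - 1)) + 1 ≤ augPot n par dep cur := by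
  obtain ⟨hb, hmB, hp, hfc, hsame⟩ := h.working hc
  obtain ⟨b, rfl⟩ : ∃ b, cur = b + 1 := ⟨cur - 1, by omega⟩
  simp only [Nat.add_sub_cancel] at *
  obtain ⟨a, ha⟩ : ∃ a, par b = a + 1 := ⟨par b - 1, by omega⟩
  rw [ha] at hp hsame ⊢
  simp only [Nat.add_sub_cancel] at hp hsame ⊢
  obtain ⟨han, hR, hsrc⟩ := hpar b a hb ha
  have hmAa : mA a = mA₀ a := hsame a han le_rfl
  have hmates : Mates n R (Function.update mA a (b + 1))
      (dismiss (Function.update mB b (a + 1)) (mA a)) := by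
    have h' : Mates n (fun b a => R a b) mB mA :=
      ⟨fun b a hb e => ⟨(h.mates.right a b hb e).1,
        (h.mates.left a b (h.mates.right a b hb e).1 (h.mates.right a b hb e).2).2.1,
        (h.mates.right a b hb e).2⟩,
      fun b a ha e => ⟨(h.mates.left a b ha e).1, (h.mates.left a b ha e).2.2⟩⟩
    have h'' := h'.steal hb han hR hmB
    exact ⟨fun a b ha e => ⟨(h''.right b a ha e).1,
        (h''.left b a (h''.right b a ha e).1 (h''.right b a ha e).2).2.1,
        (h''.right b a ha e).2⟩,
      fun a b hb e => ⟨(h''.left b a hb e).1, (h''.left b a hb e).2.2⟩⟩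
  have hfree := sum_update_add han (fun _ x => if x = 0 then 1 else 0) mA (b + 1)
  have e1 : ∑ j ∈ range n, (if Function.update mA a (b + 1) j = 0 then 1 else 0) =
    freeCount n (Function.update mA a (b + 1)) := rfl
  have e2 : ∑ j ∈ range n, (if mA j = 0 then 1 else 0) = freeCount n mA := rfl
  rw [e1, e2] at hfree
  simp only [Nat.succ_ne_zero, if_false, Nat.add_zero] at hfree
  refine ⟨⟨hmates, fun hx => ?_, fun hx => ?_⟩, ?_⟩
  · rw [if_neg hx, Nat.add_zero] at hfree
    obtain ⟨b', hb', e', hp'⟩ : ∃ b', b' < n ∧ mA₀ a = b' + 1 ∧ par b' ≠ 0 := by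
      rcases hsrc with h1 | h1
      · omega
      · exact h1
    rw [hmAa, e']
    simp only [Nat.add_sub_cancel]
    have hd := hdep b' (par b' - 1) a hb' (by omega) (h₀.left a b' han e').2.2
    refine ⟨hb', ?_, hp', by omega, fun a' ha' hd' => ?_⟩
    · rw [dismiss_apply, if_pos rfl]
    · have hne : a' ≠ a := by rintro rfl; omega
      rw [Function.update_of_ne hne]
      exact hsame a' ha' (by omega)
  · rw [if_pos hx] at hfree
    omega
  · unfold augPot
    rw [if_neg (Nat.succ_ne_zero b)]
    split_ifs with hx
    · refine Nat.succ_le_of_lt (Finset.sum_pos' (fun _ _ => Nat.zero_le _)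
        ⟨a, mem_range.2 han, by simp [ha]⟩)
    · obtain ⟨b', hb', e', hp'⟩ : ∃ b', b' < n ∧ mA₀ a = b' + 1 ∧ par b' ≠ 0 := by
        rcases hsrc with h1 | h1
        · omega
        · exact h1
      rw [hmAa, e']
      simp only [Nat.add_sub_cancel, ha]
      have hd := hdep b' (par b' - 1) a hb' (by omega) (h₀.left a b' han e').2.2
      refine Nat.succ_le_of_lt (Finset.sum_lt_sum (fun a' _ => ?_) ⟨a, mem_range.2 han, ?_⟩)
      · split_ifs <;> omega
      · rw [if_neg (by omega), if_pos le_rfl]; simp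

end Search

end Arrays

/-! ### The program for maximum matchings -/

section MatchingProgram

open PopAssign.Prog PopAssign.Expr

variable {n k : ℕ} {R : ℕ → ℕ → Prop} {L : ℕ → List ℕ} {σ σ' : State}

/-- The memory contains the adjacency lists `L` and flags for the edges of the subgraph `R`. -/
structure HasGraph (n : ℕ) (R : ℕ → ℕ → Prop) (L : ℕ → List ℕ) (σ : State) : Prop where
  size : σ.reg 0 = n
  deg : ∀ a, a < n → σ.arr 2 a = (L a).length
  list : ∀ a, a < n → ∀ j (h : j < (L a).length), σ.arr 3 (a * n + j) = (L a)[j]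
  lt : ∀ a b, b ∈ L a → b < n
  sub : ∀ a b, R a b → b ∈ L a
  edge : ∀ a b, a < n → b ∈ L a → (R a b ↔ 0 < σ.arr 8 (a * n + b))

lemma HasGraph.congr (h : HasGraph n R L σ) (h0 : σ'.reg 0 = σ.reg 0)
    (h2 : σ'.arr 2 = σ.arr 2) (h3 : σ'.arr 3 = σ.arr 3) (h8 : σ'.arr 8 = σ.arr 8) :
    HasGraph n R L σ' := by
  constructor
  · rw [h0, h.size]
  · rw [h2]; exact h.deg
  · rw [h3]; exact h.list
  · exact h.lt
  · exact h.sub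
  · rw [h8]; exact h.edge

/-- Clears the matching and the arrays of the labelling phase. -/
def clearProg : Prog :=
  .for 4 (var 0) (seq (put 9 (var 4) (lit 0)) (seq (put 10 (var 4) (lit 0))
    (seq (put 11 (var 4) (lit 0)) (seq (put 12 (var 4) (lit 0)) (put 13 (var 4) (lit 0))))))

lemma clearProg_spec (hn : σ.reg 0 = n) :
    Runs clearProg σ fun t σ' => t ≤ 30 * n + 10 ∧ ∀ i, i < n →
      σ'.arr 9 i = 0 ∧ σ'.arr 10 i = 0 ∧ σ'.arr 11 i = 0 ∧ σ'.arr 12 i = 0 ∧ σ'.arr 13 i = 0 := by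
  refine (Runs.for n (fun _ => 20) (fun i σ' => ∀ j, j < i → σ'.arr 9 j = 0 ∧ σ'.arr 10 j = 0 ∧
    σ'.arr 11 j = 0 ∧ σ'.arr 12 j = 0 ∧ σ'.arr 13 j = 0) rfl (by simp) ?_ ?_).mono ?_
  · intro i σ' hf hi _
    simp [eval, hf.reg 0 rfl, hn]
  · intro i σ' hf hi hin hI
    simp only [Runs.seq_iff, Runs.put_iff, State.setArr_arr, State.setReg_arr, eval, cost,
      State.setArr_reg, hi]
    refine ⟨fun j hj => ?_, by simp⟩
    by_cases e : j = i
    · subst e; simp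
    · have := hI j (by omega)
      simpa [e] using this
  · rintro t σ' - ⟨h1, -, h2⟩
    refine ⟨?_, h1⟩
    simp only [sum_const, card_range, smul_eq_mul, cost] at h2
    omega

/-- The labelling phase: register `5` holds the active agent plus one, register `6` the number of
agents that have been activated. -/
def pushProg : Prog :=
  loop (lit 0) (add (var 5) (sub (var 0) (var 6)))
    (ite (var 5) (lit 1)
      (seq (assign 5 (add (var 6) (lit 1))) (assign 6 (add (var 6) (lit 1))))
      (seq (assign 4 (sub (var 5) (lit 1)))
        (ite (get 12 (var 4)) (var 2)
          (ite (get 13 (var 4)) (get 2 (var 4))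
            (seq (assign 7 (get 3 (add (mul (var 4) (var 0)) (get 13 (var 4)))))
              (ite (lit 0) (get 8 (add (mul (var 4) (var 0)) (var 7)))
                (ite (get 12 (var 4)) (get 11 (var 7))
                  (put 13 (var 4) (add (get 13 (var 4)) (lit 1)))
                  (seq (assign 8 (get 10 (var 7)))
                    (seq (put 9 (var 4) (add (var 7) (lit 1)))
                      (seq (put 10 (var 7) (var 5))
                        (seq (put 11 (var 7) (add (get 12 (var 4)) (lit 1)))
                          (seq (ite (lit 0) (var 8) (put 9 (sub (var 8) (lit 1)) (lit 0)) skip)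
                            (assign 5 (var 8))))))))
                (put 13 (var 4) (add (get 13 (var 4)) (lit 1)))))
            (seq (put 12 (var 4) (add (get 12 (var 4)) (lit 1))) (put 13 (var 4) (lit 0))))
          (assign 5 (lit 0)))))

lemma pushProg_spec (hG : HasGraph n R L σ) (hk : σ.reg 2 = k)
    (hP : PushInv n k R L (σ.arr 9) (σ.arr 10) (σ.arr 11) (σ.arr 12) (σ.arr 13)
      (σ.reg 5) (σ.reg 6)) :
    Runs pushProg σ fun t σ' =>
      PushInv n k R L (σ'.arr 9) (σ'.arr 10) (σ'.arr 11) (σ'.arr 12) (σ'.arr 13) 0 n ∧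
      t ≤ 100 * pushPot n k L (σ.arr 11) (σ.arr 12) (σ.arr 13) (σ.reg 5) (σ.reg 6) + 100 := by
  refine (Runs.loop
    (fun σ => HasGraph n R L σ ∧ σ.reg 2 = k ∧
      PushInv n k R L (σ.arr 9) (σ.arr 10) (σ.arr 11) (σ.arr 12) (σ.arr 13) (σ.reg 5) (σ.reg 6))
    (fun σ => 100 * pushPot n k L (σ.arr 11) (σ.arr 12) (σ.arr 13) (σ.reg 5) (σ.reg 6))
    ⟨hG, hk, hP⟩ ?_).mono ?_
  · rintro σ ⟨hG, hk, hP⟩ hlt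
    simp only [eval, hG.size] at hlt
    rw [Runs.ite_iff]
    refine ⟨fun h1 => ?_, fun h1 => ?_⟩
    · simp only [eval] at h1
      have h0 : σ.reg 5 = 0 := by omega
      rw [h0] at hP hlt
      obtain ⟨h2, h3⟩ := hP.activate (by omega)
      simp only [Runs.seq_iff, Runs.assign_iff]
      refine ⟨⟨hG.congr rfl rfl rfl rfl, by simp [hk], by simpa [eval] using h2⟩, ?_⟩
      simp [cost, eval, h0]
      omega
    · simp only [eval] at h1
      have hc : σ.reg 5 ≠ 0 := by omega
      have hcn : σ.reg 5 - 1 < n := by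
        have := hP.cur_le
        have := hP.nxt_le
        omega
      simp only [Runs.seq_iff, Runs.assign_iff]
      rw [Runs.ite_iff]
      refine ⟨fun h2 => ?_, fun h2 => ?_⟩
      · simp [eval, hk] at h2
        rw [Runs.ite_iff]
        refine ⟨fun h3 => ?_, fun h3 => ?_⟩
        · simp [eval, hG.deg _ hcn] at h3
          have hlist := hG.list _ hcn _ h3
          have hbm := List.getElem_mem h3
          have hbn := hG.lt _ _ hbm
          have hE := hG.edge _ _ hcn hbm
          have hadv := hP.advance hc h3
          have hbid := hP.bid hc h2 hbn
          generalize hb : (L (σ.reg 5 - 1))[σ.arr 13 (σ.reg 5 - 1)] = b at *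
          simp only [Runs.seq_iff, Runs.assign_iff]
          rw [Runs.ite_iff]
          refine ⟨fun h4 => ?_, fun h4 => ?_⟩
          · simp [eval, hG.size, hlist] at h4
            have h4 := hE.2 h4
            rw [Runs.ite_iff]
            refine ⟨fun h5 => ?_, fun h5 => ?_⟩
            · simp [eval, hG.size, hlist] at h5
              obtain ⟨h6, h7⟩ := hadv fun _ => h5
              simp only [Runs.put_iff]
              refine ⟨⟨hG.congr rfl rfl rfl rfl, by simp [hk], by simpa [eval] using h6⟩, ?_⟩
              simp [cost, eval]
              omega
            · simp [eval, hG.size, hlist] at h5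
              obtain ⟨h6, h7⟩ := hbid h4 (by omega)
              simp [eval, hG.size, hlist, cost, hk]
              unfold dismiss at h6
              refine ⟨fun h8 => ?_, fun h8 => ?_⟩
              · rw [if_pos h8] at h6
                exact ⟨⟨hG.congr rfl rfl rfl rfl, h6⟩, by omega⟩
              · rw [if_neg (by omega)] at h6
                exact ⟨⟨hG.congr rfl rfl rfl rfl, h6⟩, by omega⟩
          · simp [eval, hG.size, hlist] at h4
            obtain ⟨h6, h7⟩ := hadv fun hR => by have := hE.1 hR; omega
            simp only [Runs.put_iff]
            refine ⟨⟨hG.congr rfl rfl rfl rfl, by simp [hk], by simpa [eval] using h6⟩, ?_⟩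
            simp [cost, eval]
            omega
        · simp [eval, hG.deg _ hcn] at h3
          obtain ⟨h4, h5⟩ := hP.relabel hG.sub hc h2 (by omega)
          simp only [Runs.seq_iff, Runs.put_iff]
          refine ⟨⟨hG.congr rfl rfl rfl rfl, by simp [hk], by simpa [eval] using h4⟩, ?_⟩
          simp [cost, eval]
          omega
      · simp [eval, hk] at h2
        obtain ⟨h3, h4⟩ := hP.giveUp hc (by omega)
        simp only [Runs.assign_iff]
        refine ⟨⟨hG.congr rfl rfl rfl rfl, by simp [hk], by simpa [eval] using h3⟩, ?_⟩
        simp [cost, eval]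
        omega
  · rintro t σ' - ⟨⟨hG', -, hP'⟩, h1, h2⟩
    simp only [eval, hG'.size] at h1
    have h3 : σ'.reg 5 = 0 := by omega
    have h4 : σ'.reg 6 = n := by
      have := hP'.nxt_le
      omega
    rw [h3, h4] at hP'
    refine ⟨hP', ?_⟩
    simp only [cost] at h2
    omega

/-- Clears the parents and puts all unmatched agents into the queue. Registers `10`, `11`: head and
tail of the queue; `12`: position in the list of the first agent; `13`: the unmatched object that
was found, plus one. -/
def initSearchProg : Prog :=
  seq (assign 11 (lit 0))
    (seq (.for 4 (var 0) (seq (put 14 (var 4) (lit 0))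
      (ite (get 9 (var 4)) (lit 1)
        (seq (put 15 (var 11) (var 4)) (assign 11 (add (var 11) (lit 1)))) skip)))
      (seq (assign 10 (lit 0)) (seq (assign 12 (lit 0)) (assign 13 (lit 0)))))

lemma initSearchProg_spec (hG : HasGraph n R L σ) (hM : Mates n R (σ.arr 9) (σ.arr 10)) :
    Runs initSearchProg σ fun t σ' => t ≤ 40 * n + 20 ∧
      SearchInv n R L (σ'.arr 9) (σ'.arr 10) (σ'.arr 14) (σ'.arr 15) (σ'.reg 10) (σ'.reg 11)
        (σ'.reg 12) (σ'.reg 13) ∧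
      searchPot n L (σ'.arr 10) (σ'.arr 14) (σ'.arr 15) (σ'.reg 10) (σ'.reg 11) (σ'.reg 12) ≤
        ∑ a ∈ range n, ((L a).length + 1) := by
  simp only [initSearchProg, Runs.seq_iff, Runs.assign_iff]
  refine (Runs.for n (fun _ => 25) (fun i σ' => (∀ j, j < i → σ'.arr 14 j = 0) ∧
    (∀ j, j < σ'.reg 11 → σ'.arr 15 j < n ∧ σ.arr 9 (σ'.arr 15 j) = 0) ∧
    (∀ a, a < i → σ.arr 9 a = 0 → ∃ j, j < σ'.reg 11 ∧ σ'.arr 15 j = a) ∧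
    ∑ j ∈ range (σ'.reg 11), ((L (σ'.arr 15 j)).length + 1) =
      ∑ a ∈ range i, if σ.arr 9 a = 0 then (L a).length + 1 else 0) rfl (by simp [eval]) ?_ ?_).mono ?_
  · intro i σ' hf hi _
    simp [eval, hf.reg 0 rfl, hG.size]
  · intro i σ' hf hi hin ⟨h1, h2, h3, h4⟩
    have h9 : σ'.arr 9 = σ.arr 9 := hf.arr 9 rfl
    have hp : ∀ j, j < i + 1 → Function.update (σ'.arr 14) i 0 j = 0 := fun j hj => by
      by_cases e : j = i
      · subst e; simp
      · simpa [e] using h1 j (by omega)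
    simp [eval, cost, hi, h9, -Order.lt_add_one_iff]
    refine ⟨fun h0 => ⟨hp, fun j hj => ?_, fun a ha ha0 => ?_, ?_⟩, fun h0 => ⟨hp, h2, ?_, ?_⟩⟩
    · rcases Nat.lt_succ_iff_lt_or_eq.1 hj with h5 | rfl
      · rw [Function.update_of_ne (by omega)]; exact h2 j h5
      · simp [hin, h0]
    · rcases Nat.lt_succ_iff_lt_or_eq.1 ha with h5 | rfl
      · obtain ⟨j, hj, e⟩ := h3 a h5 ha0
        exact ⟨j, by omega, by rw [Function.update_of_ne (by omega)]; exact e⟩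
      · exact ⟨σ'.reg 11, by omega, by simp⟩
    · rw [Finset.sum_range_succ, Finset.sum_range_succ, if_pos h0, ← h4, Function.update_self]
      congr 1
      exact Finset.sum_congr rfl fun j hj => by
        rw [Function.update_of_ne (mem_range.1 hj).ne]
    · intro a ha ha0
      rcases Nat.lt_succ_iff_lt_or_eq.1 ha with h5 | rfl
      · exact h3 a h5 ha0
      · exact absurd ha0 h0
    · rw [Finset.sum_range_succ, if_neg h0, h4, Nat.add_zero]
  · rintro t σ' hf ⟨⟨h1, h2, h3, h4⟩, -, h5⟩
    have h9 : σ'.arr 9 = σ.arr 9 := hf.arr 9 rfl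
    have h10 : σ'.arr 10 = σ.arr 10 := hf.arr 10 rfl
    simp [eval, cost, h9, h10] at h5 ⊢
    refine ⟨by omega, ⟨hM, fun i hi => (h2 i hi).1, fun i hi => Or.inl (h2 i hi).2, h3,
      fun b a hb e => ?_, fun b hb e => absurd (h1 b hb) e, fun i hi => absurd hi (Nat.not_lt_zero _),
      fun _ => ⟨Nat.zero_le _, fun i _ hi => absurd hi (Nat.not_lt_zero _)⟩,
      ⟨fun _ => 0, fun b a a' hb e => ?_⟩, fun h => absurd rfl h, Nat.zero_le _⟩, ?_⟩
    · rw [h1 b hb] at e; omega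
    · rw [h1 b hb] at e; omega
    · have h6 := hM.sum_eq' (fun a => (L a).length + 1)
      have h7 : ∑ b ∈ range n, (if σ.arr 10 b = 0 then 0 else
          if σ'.arr 14 b = 0 then (L (σ.arr 10 b - 1)).length + 1 else 0) =
          ∑ b ∈ range n, if σ.arr 10 b = 0 then 0 else (L (σ.arr 10 b - 1)).length + 1 :=
        Finset.sum_congr rfl fun b hb => by rw [if_pos (h1 b (mem_range.1 hb))]
      rw [searchPot, h7, h6, Nat.Ico_zero_eq_range, h4, ← Finset.sum_add_distrib, Nat.sub_zero]
      exact (Finset.sum_congr rfl fun a _ => by split_ifs <;> simp).le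

/-- Breadth-first search for an unmatched object. -/
def searchProg : Prog :=
  loop (add (mul (var 13) (add (var 11) (lit 1))) (var 10)) (var 11)
    (seq (assign 4 (get 15 (var 10)))
      (ite (var 12) (get 2 (var 4))
        (seq (assign 7 (get 3 (add (mul (var 4) (var 0)) (var 12))))
          (seq
            (ite (lit 0) (get 8 (add (mul (var 4) (var 0)) (var 7)))
              (ite (get 14 (var 7)) (lit 1)
                (seq (put 14 (var 7) (add (var 4) (lit 1)))
                  (ite (get 10 (var 7)) (lit 1)
                    (assign 13 (add (var 7) (lit 1)))
                    (seq (put 15 (var 11) (sub (get 10 (var 7)) (lit 1)))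
                      (assign 11 (add (var 11) (lit 1))))))
                skip)
              skip)
            (assign 12 (add (var 12) (lit 1)))))
        (seq (assign 10 (add (var 10) (lit 1))) (assign 12 (lit 0)))))

lemma searchProg_spec (hG : HasGraph n R L σ)
    (hS : SearchInv n R L (σ.arr 9) (σ.arr 10) (σ.arr 14) (σ.arr 15) (σ.reg 10) (σ.reg 11)
        (σ.reg 12) (σ.reg 13)) :
    Runs searchProg σ fun t σ' =>
      SearchInv n R L (σ'.arr 9) (σ'.arr 10) (σ'.arr 14) (σ'.arr 15) (σ'.reg 10) (σ'.reg 11)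
        (σ'.reg 12) (σ'.reg 13) ∧ (σ'.reg 13 = 0 → ¬ σ'.reg 10 < σ'.reg 11) ∧
      t ≤ 100 * searchPot n L (σ.arr 10) (σ.arr 14) (σ.arr 15) (σ.reg 10) (σ.reg 11) (σ.reg 12)
        + 100 := by
  refine (Runs.loop
    (fun σ => HasGraph n R L σ ∧
      SearchInv n R L (σ.arr 9) (σ.arr 10) (σ.arr 14) (σ.arr 15) (σ.reg 10) (σ.reg 11)
        (σ.reg 12) (σ.reg 13))
    (fun σ => 100 * searchPot n L (σ.arr 10) (σ.arr 14) (σ.arr 15) (σ.reg 10) (σ.reg 11)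
      (σ.reg 12)) ⟨hG, hS⟩ ?_).mono ?_
  · rintro σ ⟨hG, hS⟩ hlt
    simp only [eval] at hlt
    have hf : σ.reg 13 = 0 := by
      by_contra h0
      have : σ.reg 11 + 1 ≤ σ.reg 13 * (σ.reg 11 + 1) := Nat.le_mul_of_pos_left _ (by omega)
      omega
    rw [hf, Nat.zero_mul, Nat.zero_add] at hlt
    have hqn := hS.queue_lt _ hlt
    rw [Runs.seq_iff, Runs.assign_iff, Runs.ite_iff]
    refine ⟨fun h1 => ?_, fun h1 => ?_⟩
    · simp [eval, hG.deg _ hqn] at h1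
      have hlist := hG.list _ hqn _ h1
      have hbm := List.getElem_mem h1
      have hbn := hG.lt _ _ hbm
      have hE := hG.edge _ _ hqn hbm
      have hadv := hS.advance hlt h1
      rw [hf] at hS
      have hfind := fun b h => hS.find (b := b) hlt h1 h
      have hext := fun b h => hS.extend (b := b) hlt h1 h
      generalize hb : (L (σ.arr 15 (σ.reg 10)))[σ.reg 12] = b at *
      have hfind := hfind b rfl hbn
      have hext := hext b rfl hbn
      simp [eval, hG.size, hlist, cost, hf]
      rw [hf] at hadv
      refine ⟨fun h2 => ?_, fun h2 => ?_⟩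
      · have hR := hE.2 h2
        refine ⟨fun h3 => ⟨fun h4 => ?_, fun h4 => ?_⟩, fun h3 => ?_⟩
        · obtain ⟨h5, h6⟩ := hfind hR h3 h4
          exact ⟨⟨hG.congr rfl rfl rfl rfl, h5⟩, by omega⟩
        · obtain ⟨h5, h6⟩ := hext hR h3 h4
          exact ⟨⟨hG.congr rfl rfl rfl rfl, h5⟩, by omega⟩
        · obtain ⟨h5, h6⟩ := hadv fun _ => h3
          exact ⟨⟨hG.congr rfl rfl rfl rfl, h5⟩, by omega⟩
      · obtain ⟨h5, h6⟩ := hadv fun hR => by have := hE.1 hR; omega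
        exact ⟨⟨hG.congr rfl rfl rfl rfl, h5⟩, by omega⟩
    · simp [eval, hG.deg _ hqn] at h1
      obtain ⟨h2, h3⟩ := hS.next hG.sub hlt (by omega)
      simp [eval, cost]
      exact ⟨⟨hG.congr rfl rfl rfl rfl, h2⟩, by omega⟩
  · rintro t σ' - ⟨⟨hG', hS'⟩, h1, h2⟩
    simp only [eval] at h1
    refine ⟨hS', fun h0 => ?_, ?_⟩
    · simpa [h0] using h1
    · simp only [cost] at h2
      omega

/-- Augmentation of the matching along the path that was found. -/
def augmentProg : Prog :=
  loop (lit 0) (var 13)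
    (seq (assign 7 (sub (var 13) (lit 1)))
      (seq (assign 4 (sub (get 14 (var 7)) (lit 1)))
        (seq (assign 8 (get 9 (var 4)))
          (seq (put 9 (var 4) (var 13))
            (seq (put 10 (var 7) (get 14 (var 7)))
              (seq (ite (lit 0) (var 8) (put 10 (sub (var 8) (lit 1)) (lit 0)) skip)
                (assign 13 (var 8))))))))

lemma augmentProg_spec
    (hS : SearchInv n R L (σ.arr 9) (σ.arr 10) (σ.arr 14) (σ.arr 15) (σ.reg 10) (σ.reg 11)
        (σ.reg 12) (σ.reg 13)) (hf : σ.reg 13 ≠ 0) :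
    Runs augmentProg σ fun t σ' => Mates n R (σ'.arr 9) (σ'.arr 10) ∧
      freeCount n (σ'.arr 9) + 1 = freeCount n (σ.arr 9) ∧ t ≤ 50 * n + 10 := by
  obtain ⟨dep, hdep⟩ := hS.rank
  obtain ⟨hf1, hf2, hf3⟩ := hS.found_spec hf
  have hpar : ∀ b a, b < n → σ.arr 14 b = a + 1 → a < n ∧ R a b ∧
      (σ.arr 9 a = 0 ∨ ∃ b', b' < n ∧ σ.arr 9 a = b' + 1 ∧ σ.arr 14 b' ≠ 0) := by
    intro b a hb e
    obtain ⟨h1, i, h2, rfl⟩ := hS.par_spec b a hb e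
    exact ⟨hS.queue_lt i h2, h1, hS.queue_src i h2⟩
  refine (Runs.loop
    (fun σ' => σ'.arr 14 = σ.arr 14 ∧
      AugInv n R (σ.arr 9) (σ.arr 14) dep (σ'.arr 9) (σ'.arr 10) (σ'.reg 13))
    (fun σ' => 50 * augPot n (σ.arr 14) dep (σ'.reg 13))
    ⟨rfl, hS.mates, fun _ => ⟨hf1, hf2, hf3, rfl, fun _ _ _ => rfl⟩, fun h => absurd h hf⟩
    ?_).mono ?_
  · rintro σ' ⟨h14, hA⟩ hlt
    simp only [eval] at hlt
    obtain ⟨h1, h2⟩ := hA.step hS.mates hpar hdep (by omega)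
    simp [eval, cost, h14]
    unfold dismiss at h1
    refine ⟨fun h3 => ?_, fun h3 => ?_⟩
    · rw [if_pos h3] at h1
      exact ⟨h1, by omega⟩
    · rw [if_neg (by omega)] at h1
      exact ⟨h1, by omega⟩
  · rintro t σ' - ⟨⟨-, hA⟩, h1, h2⟩
    simp only [eval] at h1
    have := augPot_le (n := n) (par := σ.arr 14) dep (σ.reg 13)
    simp only [cost] at h2
    exact ⟨hA.mates, hA.finished (by omega), by omega⟩

/-- One round of the second phase: augments the matching, or clears register `9` if it is
maximum. -/
def roundProg : Prog :=
  seq initSearchProg (seq searchProg (ite (var 13) (lit 1) (assign 9 (lit 0)) augmentProg))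

lemma roundProg_spec (hG : HasGraph n R L σ) (hM : Mates n R (σ.arr 9) (σ.arr 10)) :
    Runs roundProg σ fun t σ' => Mates n R (σ'.arr 9) (σ'.arr 10) ∧
      ((σ'.reg 9 = σ.reg 9 ∧ freeCount n (σ'.arr 9) + 1 = freeCount n (σ.arr 9)) ∨
        (σ'.reg 9 = 0 ∧ freeCount n (σ'.arr 9) = freeCount n (σ.arr 9) ∧
          MatchingBound n R (n - freeCount n (σ'.arr 9)))) ∧
      t ≤ 200 * ∑ a ∈ range n, ((L a).length + 1) + 150 := by
  have hn : n ≤ ∑ a ∈ range n, ((L a).length + 1) := by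
    rw [Finset.sum_add_distrib]; simp
  rw [roundProg, Runs.seq_iff]
  refine (initSearchProg_spec hG hM).mono fun t₁ σ₁ hf₁ ⟨ht₁, hS₁, hp₁⟩ => ?_
  rw [Runs.seq_iff]
  refine (searchProg_spec (hG.congr (hf₁.reg 0 rfl) (hf₁.arr 2 rfl) (hf₁.arr 3 rfl)
    (hf₁.arr 8 rfl)) hS₁).mono fun t₂ σ₂ hf₂ ⟨hS₂, hd, ht₂⟩ => ?_
  have h9 : σ₂.arr 9 = σ.arr 9 := by rw [hf₂.arr 9 rfl, hf₁.arr 9 rfl]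
  have hr9 : σ₂.reg 9 = σ.reg 9 := by rw [hf₂.reg 9 rfl, hf₁.reg 9 rfl]
  rw [Runs.ite_iff]
  refine ⟨fun h0 => ?_, fun h0 => ?_⟩
  · simp [eval] at h0
    rw [h0] at hS₂
    have := hS₂.isMaximum (hd h0)
    simp [eval, cost, h9]
    rw [h9] at this
    exact ⟨h9 ▸ hS₂.mates, this, by omega⟩
  · simp [eval] at h0
    refine (augmentProg_spec hS₂ h0).mono fun t₃ σ₃ hf₃ ⟨h1, h2, h3⟩ => ⟨h1, Or.inl ⟨?_, ?_⟩, ?_⟩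
    · rw [hf₃.reg 9 rfl, hr9]
    · rw [h2, h9]
    · simp [cost]
      omega

/-- Computes a maximum matching. -/
def matchProg : Prog :=
  seq clearProg (seq (assign 5 (lit 0)) (seq (assign 6 (lit 0)) (seq pushProg
    (seq (assign 9 (lit 1)) (loop (lit 0) (var 9) roundProg)))))

lemma matchProg_spec (hG : HasGraph n R L σ) (hk : σ.reg 2 = k) (hk0 : 0 < k) (hnk : n ≤ k * k)
    (hn : 0 < n) :
    Runs matchProg σ fun t σ' => Mates n R (σ'.arr 9) (σ'.arr 10) ∧
      MatchingBound n R (n - freeCount n (σ'.arr 9)) ∧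
      t ≤ 3000 * (k * ∑ a ∈ range n, ((L a).length + 1)) := by
  have hnS : n ≤ ∑ a ∈ range n, ((L a).length + 1) := by
    rw [Finset.sum_add_distrib]; simp
  set S := ∑ a ∈ range n, ((L a).length + 1) with hS
  obtain ⟨N, hN⟩ := exists_maximumMatching (fun a b : Fin n => R a b)
  rw [matchProg, Runs.seq_iff]
  refine (clearProg_spec hG.size).mono fun t₁ σ₁ hf₁ ⟨ht₁, h₁⟩ => ?_
  rw [Runs.seq_iff, Runs.assign_iff, Runs.seq_iff, Runs.assign_iff, Runs.seq_iff]
  have hP : PushInv n k R L (σ₁.arr 9) (σ₁.arr 10) (σ₁.arr 11) (σ₁.arr 12) (σ₁.arr 13) 0 0 :=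
    PushInv.init (fun i hi => (h₁ i hi).1) (fun i hi => (h₁ i hi).2.1)
      (fun i hi => (h₁ i hi).2.2.1) (fun i hi => (h₁ i hi).2.2.2.1)
      (fun i hi => (h₁ i hi).2.2.2.2)
  refine (pushProg_spec (n := n) (k := k) (R := R) (L := L)
    (σ := (σ₁.setReg 5 0).setReg 6 0) (hG.congr (by simp [hf₁.reg 0 rfl]) (hf₁.arr 2 rfl) (hf₁.arr 3 rfl)
    (hf₁.arr 8 rfl)) (by simp [hf₁.reg 2 rfl, hk]) (by simpa [eval] using hP)).mono
    fun t₂ σ₂ hf₂ ⟨hP₂, ht₂⟩ => ?_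
  have hbound := hP₂.bound ⟨N, hN.1, rfl⟩
  have hν : MatchingBound n R (msize N) := hN.2
  simp at ht₂
  have hpot : pushPot n k L (σ₁.arr 11) (σ₁.arr 12) (σ₁.arr 13) 0 0 ≤
      (k + 1) * S + n * k + 2 * n := by
    rw [pushPot, hS, Finset.mul_sum]
    have h1 := Finset.sum_le_sum (s := range n) (f := fun a => (k + 1) * ((L a).length + 1) -
      (σ₁.arr 12 a * ((L a).length + 1) + σ₁.arr 13 a)) fun a _ => Nat.sub_le _ _
    have h2 := Finset.sum_le_sum (s := range n) (f := fun b => k - σ₁.arr 11 b)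
      (g := fun _ => k) fun b _ => Nat.sub_le _ _
    simp only [sum_const, card_range, smul_eq_mul] at h2
    simp
    omega
  rw [Runs.seq_iff, Runs.assign_iff]
  refine (Runs.loop (σ := σ₂.setReg 9 1)
    (fun σ' => HasGraph n R L σ' ∧ Mates n R (σ'.arr 9) (σ'.arr 10) ∧ σ'.reg 9 ≤ 1 ∧
      (σ'.reg 9 = 0 → MatchingBound n R (n - freeCount n (σ'.arr 9))))
    (fun σ' => (200 * S + 200) * (msize N + freeCount n (σ'.arr 9) - n + σ'.reg 9))
    ⟨hG.congr ?_ ?_ ?_ ?_, hP₂.mates, by simp, by simp⟩ ?_).mono ?_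
  · simp [hf₁.reg 0 rfl, hf₂.reg 0 rfl]
  · simp [hf₁.arr 2 rfl, hf₂.arr 2 rfl]
  · simp [hf₁.arr 3 rfl, hf₂.arr 3 rfl]
  · simp [hf₁.arr 8 rfl, hf₂.arr 8 rfl]
  · rintro σ' ⟨hG', hM', h9, -⟩ hlt
    simp only [eval] at hlt
    refine (roundProg_spec hG' hM').mono fun t σ'' hf ⟨h1, h2, h3⟩ => ?_
    have hle := h1.le_bound hν
    refine ⟨⟨hG'.congr (hf.reg 0 rfl) (hf.arr 2 rfl) (hf.arr 3 rfl) (hf.arr 8 rfl), h1, ?_,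
      fun h0 => ?_⟩, ?_⟩
    · omega
    · rcases h2 with ⟨h2, -⟩ | ⟨-, -, h2⟩
      · omega
      · exact h2
    · have h4 : msize N + freeCount n (σ''.arr 9) - n + σ''.reg 9 + 1 ≤
          msize N + freeCount n (σ'.arr 9) - n + σ'.reg 9 := by
        rcases h2 with ⟨h2, h2'⟩ | ⟨h2, h2', -⟩ <;> omega
      have h5 := Nat.mul_le_mul_left (200 * S + 200) h4
      rw [Nat.mul_add _ _ 1] at h5
      simp only [cost]
      omega
  · rintro t σ' - ⟨⟨-, h1, -, h2⟩, h3, h4⟩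
    simp only [eval] at h3
    refine ⟨h1, h2 (by omega), ?_⟩
    simp [cost] at h4 ⊢
    have h5 : msize N + freeCount n (σ₂.arr 9) - n ≤ k := by
      by_contra hlt
      have := Nat.mul_le_mul_left k (Nat.succ_le_of_lt (not_le.1 hlt))
      rw [Nat.mul_succ] at this
      omega
    have h6 := Nat.mul_le_mul_left (200 * S + 200) (Nat.add_le_add_right h5 1)
    have h7 : S ≤ k * S := Nat.le_mul_of_pos_left _ hk0
    have h8 : n * k ≤ k * S := by rw [mul_comm]; exact Nat.mul_le_mul_left _ hnS
    have h9 : k ≤ k * S := Nat.le_mul_of_pos_right _ (by omega)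
    have h10 : (200 * S + 200) * (k + 1) = 200 * (k * S) + 200 * S + 200 * k + 200 := by ring
    have h11 : (k + 1) * S = k * S + S := by ring
    omega

end MatchingProgram

/-! ### The program for the levels -/

section LevelProgram

open PopAssign.Prog PopAssign.Expr

variable {n κ : ℕ} {G : Instance (Fin n) (Fin n)} {σ σ' : State}

lemma index_inj {a a' b b' : ℕ} (hb : b < n) (hb' : b' < n) (h : a * n + b = a' * n + b') :
    a = a' ∧ b = b' := by
  have h1 : (a * n + b) / n = a := by
    rw [mul_comm, Nat.mul_add_div (by omega), Nat.div_eq_of_lt hb, Nat.add_zero]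
  have h2 : (a' * n + b') / n = a' := by
    rw [mul_comm, Nat.mul_add_div (by omega), Nat.div_eq_of_lt hb', Nat.add_zero]
  have h3 : a = a' := by rw [← h1, ← h2, h]
  subst h3
  exact ⟨rfl, by omega⟩

namespace Instance

variable (G)

/-- Adjacency of nodes given by numbers. -/
def adjN (a b : ℕ) : Prop := ∃ (ha : a < n) (hb : b < n), G.Adj ⟨a, ha⟩ ⟨b, hb⟩

/-- Preferences between objects given by numbers. -/
def prefN (a b b' : ℕ) : Prop :=
  ∃ (ha : a < n) (hb : b < n) (hb' : b' < n), G.pref ⟨a, ha⟩ ⟨b, hb⟩ ⟨b', hb'⟩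

open Classical in
/-- The list of the neighbours of an agent. -/
noncomputable def nbrs (a : ℕ) : List ℕ := (List.range n).filter (fun b => G.adjN a b)

lemma mem_nbrs {a b : ℕ} : b ∈ G.nbrs a ↔ G.adjN a b := by
  simp only [nbrs, List.mem_filter, List.mem_range, decide_eq_true_eq]
  exact ⟨fun h => h.2, fun h => ⟨h.2.1, h⟩⟩

open Classical in
/-- The maximum of `s` over all objects with the property `P`. -/
noncomputable def supOver (n : ℕ) (P : ℕ → Prop) (s : ℕ → ℕ) : ℕ := ((range n).filter P).sup s

lemma supOver_update {P : ℕ → Prop} {s : ℕ → ℕ} {b : ℕ} (hb : b < n) :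
    supOver n P (Function.update s b (s b + 1)) =
      (open Classical in if P b then max (supOver n P s) (s b + 1) else supOver n P s) := by
  classical
  have hle : ∀ x, s x ≤ Function.update s b (s b + 1) x := fun x => by
    by_cases e : x = b
    · subst e; simp
    · simp [e]
  unfold supOver
  split_ifs with h
  · have hm : b ∈ (range n).filter P := by simp [hb, h]
    apply le_antisymm
    · refine Finset.sup_le fun x hx => ?_
      by_cases e : x = b
      · subst e; simp
      · rw [Function.update_of_ne e]
        exact le_max_of_le_left (Finset.le_sup (f := s) hx)
    · refine max_le (Finset.sup_mono_fun fun x _ => hle x) ?_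
      have := Finset.le_sup (f := Function.update s b (s b + 1)) hm
      simpa using this
  · refine Finset.sup_congr rfl fun x hx => ?_
    rw [Function.update_of_ne]
    rintro rfl
    exact h (Finset.mem_filter.1 hx).2

/-- The maximum of `s` over the neighbours of `a`. -/
noncomputable def topN (s : ℕ → ℕ) (a : ℕ) : ℕ := supOver n (G.adjN a) s

/-- The maximum of `s` over the objects that `a` prefers to `b`. -/
noncomputable def betterN (s : ℕ → ℕ) (a b : ℕ) : ℕ :=
  supOver n (fun b' => G.adjN a b' ∧ G.prefN a b' b) s

/-- The maximum of `s` over the neighbours of `a` to which she does not prefer `b`. -/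
noncomputable def notWorseN (s : ℕ → ℕ) (a b : ℕ) : ℕ :=
  supOver n (fun b' => G.adjN a b' ∧ ¬ G.prefN a b b') s

/-- The condition for edges of the level subgraph, in terms of `s b = ℓ b + 1`. -/
def LevelCond (s : ℕ → ℕ) (a b : ℕ) : Prop :=
  G.betterN s a b < s b ∧
    (s b = G.topN s a ∨ (s b + 1 = G.topN s a ∧ G.notWorseN s a b < G.topN s a))

end Instance

/-- The memory contains the instance. -/
structure HasInput (G : Instance (Fin n) (Fin n)) (κ : ℕ) (σ : State) : Prop where
  size : σ.reg 0 = n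
  penalty : σ.reg 1 = κ
  adj : ∀ a b, a < n → b < n → (0 < σ.arr 0 (a * n + b) ↔ G.adjN a b)
  pref : ∀ a b b', a < n → b < n → b' < n →
    (0 < σ.arr 1 ((a * n + b) * n + b') ↔ G.prefN a b b')

lemma HasInput.congr (h : HasInput G κ σ) (h0 : σ'.reg 0 = σ.reg 0) (h1 : σ'.reg 1 = σ.reg 1)
    (h2 : σ'.arr 0 = σ.arr 0) (h3 : σ'.arr 1 = σ.arr 1) : HasInput G κ σ' := by
  constructor
  · rw [h0, h.size]
  · rw [h1, h.penalty]
  · rw [h2]; exact h.adj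
  · rw [h3]; exact h.pref

lemma hasInput_inputState : HasInput G κ (inputState G κ) := by
  classical
  refine ⟨by simp [inputState], by simp [inputState], fun a b ha hb => ?_,
    fun a b b' ha hb hb' => ?_⟩
  · have : (∃ a' b' : Fin n, a * n + b = a' * n + b' ∧ G.Adj a' b') ↔ G.adjN a b := by
      constructor
      · rintro ⟨a', b', e, h⟩
        obtain ⟨rfl, rfl⟩ := index_inj hb b'.2 e
        exact ⟨ha, hb, h⟩
      · rintro ⟨_, _, h⟩
        exact ⟨_, _, rfl, h⟩
    simp only [inputState, if_true, this]
    split_ifs with h <;> simp [h]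
  · have : (∃ a' b₁ b₂ : Fin n, (a * n + b) * n + b' = (a' * n + b₁) * n + b₂ ∧
        G.pref a' b₁ b₂) ↔ G.prefN a b b' := by
      constructor
      · rintro ⟨a', b₁, b₂, e, h⟩
        obtain ⟨e₁, rfl⟩ := index_inj hb' b₂.2 e
        obtain ⟨rfl, rfl⟩ := index_inj hb b₁.2 e₁
        exact ⟨ha, hb, hb', h⟩
      · rintro ⟨_, _, _, h⟩
        exact ⟨_, _, _, rfl, h⟩
    simp only [inputState, one_ne_zero, if_false, if_true, this]
    split_ifs with h <;> simp [h]

/-- The memory contains the adjacency lists. -/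
structure HasLists (G : Instance (Fin n) (Fin n)) (σ : State) : Prop where
  deg : ∀ a, a < n → σ.arr 2 a = (G.nbrs a).length
  list : ∀ a, a < n → ∀ j (h : j < (G.nbrs a).length), σ.arr 3 (a * n + j) = (G.nbrs a)[j]

/-- Builds the adjacency lists. -/
def listsProg : Prog :=
  .for 4 (var 0) (.for 5 (var 0)
    (ite (lit 0) (get 0 (add (mul (var 4) (var 0)) (var 5)))
      (seq (put 3 (add (mul (var 4) (var 0)) (get 2 (var 4))) (var 5))
        (put 2 (var 4) (add (get 2 (var 4)) (lit 1))))
      skip))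

lemma length_nbrs_le (a : ℕ) : (G.nbrs a).length ≤ n :=
  (List.length_filter_le _ _).trans (by simp)

open Classical in
lemma listsProg_spec (hI : HasInput G κ σ) (h2 : ∀ a, σ.arr 2 a = 0) :
    Runs listsProg σ fun t σ' => HasLists G σ' ∧ t ≤ 60 * (n * n) + 40 * n + 10 := by
  have hlen : ∀ (a i : ℕ), ((List.range i).filter (fun b => G.adjN a b)).length ≤ i := fun a i =>
    (List.length_filter_le _ _).trans (by simp)
  refine (Runs.for n (fun _ => 50 * n + 10) (fun i σ' =>
    (∀ a, a < i → σ'.arr 2 a = (G.nbrs a).length ∧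
      ∀ j (h : j < (G.nbrs a).length), σ'.arr 3 (a * n + j) = (G.nbrs a)[j]) ∧
    ∀ a, i ≤ a → σ'.arr 2 a = 0) rfl ⟨by simp, fun a _ => h2 a⟩ ?_ ?_).mono ?_
  · intro i σ₁ hf hi _
    simp [eval, hf.reg 0 rfl, hI.size]
  · intro i σ₁ hf hi hin ⟨h3, h4⟩
    have hI₁ : HasInput G κ σ₁ :=
      hI.congr (hf.reg 0 rfl) (hf.reg 1 rfl) (hf.arr 0 rfl) (hf.arr 1 rfl)
    refine (Runs.for n (fun _ => 40) (fun j σ' =>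
      (∀ a, a < i → σ'.arr 2 a = (G.nbrs a).length ∧
        ∀ j (h : j < (G.nbrs a).length), σ'.arr 3 (a * n + j) = (G.nbrs a)[j]) ∧
      (∀ a, i + 1 ≤ a → σ'.arr 2 a = 0) ∧
      σ'.arr 2 i = ((List.range j).filter (fun b => G.adjN i b)).length ∧
      ∀ l (h : l < ((List.range j).filter (fun b => G.adjN i b)).length),
        σ'.arr 3 (i * n + l) = ((List.range j).filter (fun b => G.adjN i b))[l]) rfl
      ⟨h3, fun a ha => h4 a (by omega), h4 i le_rfl, by simp⟩ ?_ ?_).mono ?_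
    · intro j σ₂ hf₂ hj _
      simp [eval, hf₂.reg 0 rfl, hI₁.size]
    · intro j σ₂ hf₂ hj hjn ⟨h5, h6, h7, h8⟩
      have hI₂ : HasInput G κ σ₂ :=
        hI₁.congr (hf₂.reg 0 rfl) (hf₂.reg 1 rfl) (hf₂.arr 0 rfl) (hf₂.arr 1 rfl)
      have hi₂ : σ₂.reg 4 = i := by rw [hf₂.reg 4 rfl, hi]
      have hlj := hlen i j
      rw [Runs.ite_iff]
      have hadj : (eval σ₂ (lit 0) < eval σ₂ (get 0 (add (mul (var 4) (var 0)) (var 5)))) ↔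
          G.adjN i j := by
        simp only [eval, hi₂, hj, hI₂.size]
        exact hI₂.adj i j hin hjn
      rw [hadj]
      refine ⟨fun h => ?_, fun h => ?_⟩
      · have hL : (List.range (j + 1)).filter (fun b => G.adjN i b) =
            (List.range j).filter (fun b => G.adjN i b) ++ [j] := by
          rw [List.range_succ, List.filter_append]
          simp [h]
        rw [hL]
        simp only [Runs.seq_iff, Runs.put_iff, eval, hi₂, hj, hI₂.size, State.setArr_arr,
          State.setReg_arr, State.setArr_reg, h7, cost]
        refine ⟨⟨fun a ha => ⟨?_, fun l hl => ?_⟩, fun a ha => ?_, ?_, fun l hl => ?_⟩, by simp⟩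
        · have hne : a ≠ i := by omega
          simpa [hne] using (h5 a ha).1
        · have : a * n + l ≠ i * n + ((List.range j).filter (fun b => G.adjN i b)).length := by
            intro e
            have := length_nbrs_le (G := G) a
            have := index_inj (by omega) (by omega) e
            omega
          simpa [this] using (h5 a ha).2 l hl
        · have hne : a ≠ i := by omega
          simpa [hne] using h6 a ha
        · simp [h7]
        · rw [List.length_append, List.length_singleton] at hl
          rcases Nat.lt_succ_iff_lt_or_eq.1 hl with h9 | rfl
          · rw [List.getElem_append_left h9]
            simpa [h9.ne] using h8 l h9
          · simp
      · have hL : (List.range (j + 1)).filter (fun b => G.adjN i b) =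
            (List.range j).filter (fun b => G.adjN i b) := by
          rw [List.range_succ, List.filter_append]
          simp [h]
        rw [hL]
        simp only [Runs.skip_iff, cost, State.setReg_arr]
        exact ⟨⟨h5, h6, h7, h8⟩, by norm_num⟩
    · rintro t σ₂ - ⟨⟨h5, h6, h7, h8⟩, -, ht⟩
      refine ⟨⟨fun a ha => ?_, fun a ha => ?_⟩, ?_⟩
      · rcases Nat.lt_succ_iff_lt_or_eq.1 ha with h9 | rfl
        · exact h5 a h9
        · exact ⟨h7, h8⟩
      · exact h6 a ha
      · simp only [sum_const, card_range, smul_eq_mul, cost] at ht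
        omega
  · rintro t σ₁ - ⟨⟨h3, -⟩, -, ht⟩
    refine ⟨⟨fun a ha => (h3 a ha).1, fun a ha => (h3 a ha).2⟩, ?_⟩
    simp only [sum_const, card_range, smul_eq_mul, cost] at ht
    have : n * (50 * n + 10 + (1 + 6)) = 50 * (n * n) + 17 * n := by ring
    omega

/-- The arrays derived from the levels are up to date. -/
structure HasLevels (G : Instance (Fin n) (Fin n)) (s : ℕ → ℕ) (σ : State) : Prop where
  level : σ.arr 4 = s
  top : ∀ a, a < n → σ.arr 5 a = G.topN s a
  better : ∀ a b, a < n → b < n → σ.arr 6 (a * n + b) = G.betterN s a b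
  notWorse : ∀ a b, a < n → b < n → σ.arr 7 (a * n + b) = G.notWorseN s a b

lemma HasLevels.congr {s : ℕ → ℕ} (h : HasLevels G s σ) (h4 : σ'.arr 4 = σ.arr 4)
    (h5 : σ'.arr 5 = σ.arr 5) (h6 : σ'.arr 6 = σ.arr 6) (h7 : σ'.arr 7 = σ.arr 7) :
    HasLevels G s σ' := by
  constructor
  · rw [h4, h.level]
  · rw [h5]; exact h.top
  · rw [h6]; exact h.better
  · rw [h7]; exact h.notWorse

/-- Updates the maxima for the agent in register `5` and the object in register `6`. -/
def bumpPairProg : Prog :=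
  seq (ite (lit 0) (get 1 (add (mul (add (mul (var 5) (var 0)) (var 4)) (var 0)) (var 6)))
      (ite (get 6 (add (mul (var 5) (var 0)) (var 6))) (get 4 (var 4))
        (put 6 (add (mul (var 5) (var 0)) (var 6)) (get 4 (var 4))) skip) skip)
    (ite (get 1 (add (mul (add (mul (var 5) (var 0)) (var 6)) (var 0)) (var 4))) (lit 1)
      (ite (get 7 (add (mul (var 5) (var 0)) (var 6))) (get 4 (var 4))
        (put 7 (add (mul (var 5) (var 0)) (var 6)) (get 4 (var 4))) skip) skip)

/-- Increases the level of the object in register `4`. -/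
def bumpProg : Prog :=
  seq (put 4 (var 4) (add (get 4 (var 4)) (lit 1)))
    (.for 5 (var 0) (ite (lit 0) (get 0 (add (mul (var 5) (var 0)) (var 4)))
      (seq (ite (get 5 (var 5)) (get 4 (var 4)) (put 5 (var 5) (get 4 (var 4))) skip)
        (.for 6 (var 0) bumpPairProg)) skip))

open Classical in
lemma bumpPairProg_spec {s : ℕ → ℕ} {a b b' : ℕ} (hI : HasInput G κ σ) (h4 : σ.reg 4 = b)
    (h5 : σ.reg 5 = a) (h6 : σ.reg 6 = b') (ha : a < n) (hb : b < n) (hb' : b' < n)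
    (hab : G.adjN a b) (hs : σ.arr 4 = Function.update s b (s b + 1))
    (h1 : σ.arr 6 (a * n + b') = G.betterN s a b')
    (h2 : σ.arr 7 (a * n + b') = G.notWorseN s a b') :
    Runs bumpPairProg σ fun t σ' =>
      σ'.arr 6 = Function.update (σ.arr 6) (a * n + b')
        (G.betterN (Function.update s b (s b + 1)) a b') ∧
      σ'.arr 7 = Function.update (σ.arr 7) (a * n + b')
        (G.notWorseN (Function.update s b (s b + 1)) a b') ∧ t ≤ 80 := by
  have hp := hI.pref a b b' ha hb hb'
  have hp' := hI.pref a b' b ha hb' hb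
  have hb1 : σ.arr 4 b = s b + 1 := by simp [hs]
  have hd : G.betterN (Function.update s b (s b + 1)) a b' =
      if G.prefN a b b' then max (G.betterN s a b') (s b + 1) else G.betterN s a b' := by
    rw [Instance.betterN, Instance.supOver_update hb]
    simp [hab, Instance.betterN]
  have hu : G.notWorseN (Function.update s b (s b + 1)) a b' =
      if G.prefN a b' b then G.notWorseN s a b' else max (G.notWorseN s a b') (s b + 1) := by
    rw [Instance.notWorseN, Instance.supOver_update hb]
    by_cases h : G.prefN a b' b <;> simp [hab, h, Instance.notWorseN]
  have hself6 : Function.update (σ.arr 6) (a * n + b') (G.betterN s a b') = σ.arr 6 := by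
    rw [← h1]; exact Function.update_eq_self _ _
  have hself7 : Function.update (σ.arr 7) (a * n + b') (G.notWorseN s a b') = σ.arr 7 := by
    rw [← h2]; exact Function.update_eq_self _ _
  rw [hd, hu]
  rw [bumpPairProg, Runs.seq_iff]
  have first : Runs (ite (lit 0) (get 1 (add (mul (add (mul (var 5) (var 0)) (var 4)) (var 0))
      (var 6))) (ite (get 6 (add (mul (var 5) (var 0)) (var 6))) (get 4 (var 4))
        (put 6 (add (mul (var 5) (var 0)) (var 6)) (get 4 (var 4))) skip) skip) σ
      fun t σ' => σ'.arr 6 = Function.update (σ.arr 6) (a * n + b')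
        (if G.prefN a b b' then max (G.betterN s a b') (s b + 1) else G.betterN s a b') ∧
        t ≤ 40 := by
    simp only [Runs.ite_iff, Runs.put_iff, Runs.skip_iff, eval, h4, h5, h6, hI.size, hp, h1, hb1,
      cost, State.setArr_arr, if_true]
    refine ⟨fun h => ⟨fun h' => ?_, fun h' => ?_⟩, fun h => ?_⟩
    · rw [if_pos h, max_eq_right h'.le]; exact ⟨rfl, by norm_num⟩
    · rw [if_pos h, max_eq_left (not_lt.1 h'), hself6]; exact ⟨rfl, by norm_num⟩
    · rw [if_neg h, hself6]; exact ⟨rfl, by norm_num⟩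
  refine first.mono fun t σ₁ hf ⟨h7, ht⟩ => ?_
  have e0 : σ₁.reg 0 = n := (hf.reg 0 rfl).trans hI.size
  have e4 : σ₁.reg 4 = b := (hf.reg 4 rfl).trans h4
  have e5 : σ₁.reg 5 = a := (hf.reg 5 rfl).trans h5
  have e6 : σ₁.reg 6 = b' := (hf.reg 6 rfl).trans h6
  have f1 : σ₁.arr 1 = σ.arr 1 := hf.arr 1 rfl
  have f4 : σ₁.arr 4 = σ.arr 4 := hf.arr 4 rfl
  have f7 : σ₁.arr 7 = σ.arr 7 := hf.arr 7 rfl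
  have hp'' : σ.arr 1 ((a * n + b') * n + b) < 1 ↔ ¬ G.prefN a b' b := by rw [← hp']; omega
  simp only [Runs.ite_iff, Runs.put_iff, Runs.skip_iff, eval, e0, e4, e5, e6, f1, f4, f7, hp'', h2,
    hb1, cost, State.setArr_arr, if_true, h7]
  refine ⟨fun h => ⟨fun h' => ?_, fun h' => ?_⟩, fun h => ?_⟩
  · rw [if_neg h, max_eq_right h'.le]; exact ⟨rfl, rfl, by omega⟩
  · rw [if_neg h, max_eq_left (not_lt.1 h'), hself7]; exact ⟨trivial, rfl, by omega⟩
  · rw [if_pos (not_not.1 h), hself7]; exact ⟨trivial, rfl, by omega⟩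

open Classical in
/-- A bound for the time to increase the level of `b`. -/
noncomputable def bumpCost (G : Instance (Fin n) (Fin n)) (b : ℕ) : ℕ :=
  ∑ a ∈ range n, (30 + if G.adjN a b then 100 * n + 50 else 0) + 30

open Classical in
lemma bumpProg_spec {s : ℕ → ℕ} {b : ℕ} (hI : HasInput G κ σ) (hs : HasLevels G s σ)
    (h4 : σ.reg 4 = b) (hb : b < n) :
    Runs bumpProg σ fun t σ' => HasLevels G (Function.update s b (s b + 1)) σ' ∧
      t ≤ bumpCost G b := by
  set s' := Function.update s b (s b + 1) with hs'
  rw [bumpProg, Runs.seq_iff, Runs.put_iff]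
  have hlev : ∀ σ₁ : State, σ₁.arr 4 = Function.update (σ.arr 4) (σ.reg 4) (σ.arr 4 (σ.reg 4) + 1) →
      σ₁.arr 4 = s' := fun σ₁ h => by rw [h, h4, hs.level]
  refine (Runs.for n (fun a => 20 + if G.adjN a b then 100 * n + 50 else 0) (fun i σ' =>
    (∀ a, a < n → σ'.arr 5 a = G.topN (if a < i then s' else s) a) ∧
    (∀ a b', a < n → b' < n →
      σ'.arr 6 (a * n + b') = G.betterN (if a < i then s' else s) a b' ∧
      σ'.arr 7 (a * n + b') = G.notWorseN (if a < i then s' else s) a b')) rfl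
    ⟨fun a ha => by simpa using hs.top a ha, fun a b' ha hb' =>
      ⟨by simpa using hs.better a b' ha hb', by simpa using hs.notWorse a b' ha hb'⟩⟩ ?_ ?_).mono ?_
  · intro i σ₁ hf hi _
    simp [eval, hf.reg 0 rfl, hI.size]
  · intro i σ₁ hf hi hin ⟨h1, h2⟩
    have hI₁ : HasInput G κ σ₁ :=
      hI.congr (hf.reg 0 rfl) (hf.reg 1 rfl) (hf.arr 0 rfl) (hf.arr 1 rfl)
    have e4 : σ₁.reg 4 = b := (hf.reg 4 rfl).trans h4
    have f4 : σ₁.arr 4 = s' := hlev σ₁ (by rw [hf.arr 4 rfl]; simp [eval])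
    have hb1 : s' b = s b + 1 := by simp [hs']
    have htop : G.topN s' i = if G.adjN i b then max (G.topN s i) (s b + 1) else G.topN s i := by
      rw [Instance.topN, hs', Instance.supOver_update hb]; rfl
    have h1i := h1 i hin
    rw [if_neg (lt_irrefl i)] at h1i
    rw [Runs.ite_iff]
    have hadj : (eval σ₁ (lit 0) < eval σ₁ (get 0 (add (mul (var 5) (var 0)) (var 4)))) ↔
        G.adjN i b := by
      simp only [eval, e4, hi, hI₁.size]
      exact hI₁.adj i b hin hb
    rw [hadj]
    refine ⟨fun h => ?_, fun h => ?_⟩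
    · rw [Runs.seq_iff]
      have first : Runs (ite (get 5 (var 5)) (get 4 (var 4)) (put 5 (var 5) (get 4 (var 4))) skip)
          σ₁ fun t σ' => σ'.arr 5 = Function.update (σ₁.arr 5) i (G.topN s' i) ∧ t ≤ 20 := by
        rw [htop, if_pos h]
        simp only [Runs.ite_iff, Runs.put_iff, Runs.skip_iff, eval, hi, e4, f4, hb1, cost,
          State.setArr_arr, if_true, h1i]
        refine ⟨fun h' => ?_, fun h' => ?_⟩
        · rw [max_eq_right h'.le]; exact ⟨rfl, by norm_num⟩
        · rw [max_eq_left (not_lt.1 h'), ← h1i, Function.update_eq_self]; exact ⟨rfl, by norm_num⟩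
      refine first.mono fun t₁ σ₂ hf₂ ⟨h5, ht₁⟩ => ?_
      have hI₂ : HasInput G κ σ₂ :=
        hI₁.congr (hf₂.reg 0 rfl) (hf₂.reg 1 rfl) (hf₂.arr 0 rfl) (hf₂.arr 1 rfl)
      refine (Runs.for n (fun _ => 80) (fun j σ' =>
        ∀ a b', a < n → b' < n →
          σ'.arr 6 (a * n + b') = G.betterN (if a < i ∨ (a = i ∧ b' < j) then s' else s) a b' ∧
          σ'.arr 7 (a * n + b') = G.notWorseN (if a < i ∨ (a = i ∧ b' < j) then s' else s) a b')
        rfl ?_ ?_ ?_).mono ?_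
      · intro a b' ha hb'
        have := h2 a b' ha hb'
        simpa [hf₂.arr 6 rfl, hf₂.arr 7 rfl] using this
      · intro j σ₃ hf₃ hj _
        simp [eval, hf₃.reg 0 rfl, hI₂.size]
      · intro j σ₃ hf₃ hj hjn h6
        have hI₃ : HasInput G κ σ₃ :=
          hI₂.congr (hf₃.reg 0 rfl) (hf₃.reg 1 rfl) (hf₃.arr 0 rfl) (hf₃.arr 1 rfl)
        have h7 := h6 i j hin hjn
        rw [if_neg (by omega)] at h7
        refine (bumpPairProg_spec (s := s) (a := i) (b := b) (b' := j) hI₃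
          (by rw [hf₃.reg 4 rfl, hf₂.reg 4 rfl, e4])
          (by rw [hf₃.reg 5 rfl, hf₂.reg 5 rfl, hi]) hj hin hb hjn h
          (by rw [hf₃.arr 4 rfl, hf₂.arr 4 rfl, f4]) h7.1 h7.2).mono
          fun t₂ σ₄ _ ⟨h8, h9, ht₂⟩ => ⟨fun a b' ha hb' => ?_, ht₂⟩
        rw [State.setReg_arr, h8, h9]
        by_cases e : a = i ∧ b' = j
        · obtain ⟨rfl, rfl⟩ := e
          simp [hs']
        · have hne : a * n + b' ≠ i * n + j := fun e' => e (index_inj hb' hjn e')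
          rw [Function.update_of_ne hne, Function.update_of_ne hne]
          have : (a < i ∨ a = i ∧ b' < j + 1) ↔ (a < i ∨ a = i ∧ b' < j) := by omega
          simp only [this]
          exact h6 a b' ha hb'
      · rintro t₂ σ₃ hf₃ ⟨h6, -, ht₂⟩
        refine ⟨⟨fun a ha => ?_, fun a b' ha hb' => ?_⟩, ?_⟩
        · rw [State.setReg_arr, hf₃.arr 5 rfl, h5]
          by_cases e : a = i
          · subst e; simp
          · rw [Function.update_of_ne e, h1 a ha]
            have : a < i ↔ a < i + 1 := by omega
            simp only [this]
        · have := h6 a b' ha hb'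
          have e : (a < i ∨ a = i ∧ b' < n) ↔ a < i + 1 := by omega
          simp only [e] at this
          exact this
        · simp only [sum_const, card_range, smul_eq_mul, cost] at ht₂ ⊢
          rw [if_pos h]
          omega
    · rw [Runs.skip_iff]
      simp only [State.setReg_arr, cost]
      have hd : ∀ b', G.betterN s' i b' = G.betterN s i b' := fun b' => by
        rw [Instance.betterN, hs', Instance.supOver_update hb, if_neg (fun h' => h h'.1)]; rfl
      have hu : ∀ b', G.notWorseN s' i b' = G.notWorseN s i b' := fun b' => by
        rw [Instance.notWorseN, hs', Instance.supOver_update hb, if_neg (fun h' => h h'.1)]; rfl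
      rw [if_neg h] at htop
      refine ⟨⟨fun a ha => ?_, fun a b' ha hb' => ?_⟩, by omega⟩
      · by_cases e : a = i
        · subst e; simp [htop, h1i]
        · rw [h1 a ha]
          have : a < i ↔ a < i + 1 := by omega
          simp only [this]
      · have := h2 a b' ha hb'
        by_cases e : a = i
        · subst e; simpa [hd, hu] using this
        · have e' : a < i ↔ a < i + 1 := by omega
          simp only [e'] at this
          exact this
  · rintro t σ₁ hf ⟨⟨h1, h2⟩, -, ht⟩
    refine ⟨⟨hlev σ₁ (by rw [hf.arr 4 rfl]; simp [eval]), fun a ha => ?_, fun a b' ha hb' => ?_,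
      fun a b' ha hb' => ?_⟩, ?_⟩
    · have := h1 a ha
      rwa [if_pos ha] at this
    · have := (h2 a b' ha hb').1
      rwa [if_pos ha] at this
    · have := (h2 a b' ha hb').2
      rwa [if_pos ha] at this
    · rw [bumpCost]
      simp only [cost] at ht ⊢
      have : ∑ i ∈ range n, (20 + (if G.adjN i b then 100 * n + 50 else 0) + (1 + 6)) ≤
          ∑ a ∈ range n, (30 + if G.adjN a b then 100 * n + 50 else 0) :=
        Finset.sum_le_sum fun a _ => by omega
      omega

end LevelProgram

section IterationProgram

open PopAssign.Prog PopAssign.Expr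

variable {n κ : ℕ} {G : Instance (Fin n) (Fin n)} {σ σ' : State}

/-- Increases the levels of all unmatched objects. -/
def raiseProg : Prog := .for 4 (var 0) (ite (get 10 (var 4)) (lit 1) bumpProg skip)

lemma raiseProg_spec {s : ℕ → ℕ} (hI : HasInput G κ σ) (hs : HasLevels G s σ) :
    Runs raiseProg σ fun t σ' =>
      HasLevels G (fun b => if b < n ∧ σ.arr 10 b = 0 then s b + 1 else s b) σ' ∧
      t ≤ ∑ b ∈ range n, (20 + if σ.arr 10 b = 0 then bumpCost G b else 0) + 10 := by
  refine (Runs.for n (fun b => 10 + if σ.arr 10 b = 0 then bumpCost G b else 0) (fun i σ' =>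
    HasLevels G (fun b => if b < i ∧ σ.arr 10 b = 0 then s b + 1 else s b) σ') rfl
    (by simpa using hs.congr (σ' := σ.setReg 4 0) rfl rfl rfl rfl) ?_ ?_).mono ?_
  · intro i σ₁ hf hi _
    simp [eval, hf.reg 0 rfl, hI.size]
  · intro i σ₁ hf hi hin h1
    have hI₁ : HasInput G κ σ₁ :=
      hI.congr (hf.reg 0 rfl) (hf.reg 1 rfl) (hf.arr 0 rfl) (hf.arr 1 rfl)
    have h10 : σ₁.arr 10 = σ.arr 10 := hf.arr 10 rfl
    rw [Runs.ite_iff]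
    simp only [eval, hi, h10, Nat.lt_one_iff]
    refine ⟨fun h => ?_, fun h => ?_⟩
    · refine (bumpProg_spec hI₁ h1 hi hin).mono fun t σ₂ _ ⟨h2, ht⟩ => ⟨?_, ?_⟩
      · have e : Function.update (fun b => if b < i ∧ σ.arr 10 b = 0 then s b + 1 else s b) i
            ((if i < i ∧ σ.arr 10 i = 0 then s i + 1 else s i) + 1) =
            fun b => if b < i + 1 ∧ σ.arr 10 b = 0 then s b + 1 else s b := by
          funext b
          by_cases e : b = i
          · subst e; simp [h]
          · have : b < i ↔ b < i + 1 := by omega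
            simp [e, this]
        rw [e] at h2
        exact h2.congr rfl rfl rfl rfl
      · simp only [h, if_true, cost]; omega
    · rw [Runs.skip_iff]
      have e : (fun b => if b < i ∧ σ.arr 10 b = 0 then s b + 1 else s b) =
          fun b => if b < i + 1 ∧ σ.arr 10 b = 0 then s b + 1 else s b := by
        funext b
        by_cases e : b = i
        · subst e; simp [h]
        · have : b < i ↔ b < i + 1 := by omega
          simp [this]
      rw [e] at h1
      refine ⟨h1.congr rfl rfl rfl rfl, ?_⟩
      simp only [cost]; omega
  · rintro t σ₁ - ⟨h1, -, ht⟩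
    refine ⟨h1, ?_⟩
    have : ∑ b ∈ range n, (10 + (if σ.arr 10 b = 0 then bumpCost G b else 0) + (1 + 6)) ≤
        ∑ b ∈ range n, (20 + if σ.arr 10 b = 0 then bumpCost G b else 0) :=
      Finset.sum_le_sum fun b _ => by omega
    simp only [cost] at ht
    omega

/-- Sets the flag for the agent in register `4` and the object in register `6`. -/
def edgeProg : Prog :=
  seq (put 8 (add (mul (var 4) (var 0)) (var 6)) (lit 0))
    (ite (get 6 (add (mul (var 4) (var 0)) (var 6))) (get 4 (var 6))
      (ite (get 4 (var 6)) (get 5 (var 4))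
        (ite (get 5 (var 4)) (add (get 4 (var 6)) (lit 2))
          (ite (get 7 (add (mul (var 4) (var 0)) (var 6))) (get 5 (var 4))
            (put 8 (add (mul (var 4) (var 0)) (var 6)) (lit 1)) skip) skip)
        (put 8 (add (mul (var 4) (var 0)) (var 6)) (lit 1))) skip)

lemma Instance.le_topN {s : ℕ → ℕ} {a b : ℕ} (h : G.adjN a b) : s b ≤ G.topN s a := by
  classical
  obtain ⟨_, hb, _⟩ := id h
  unfold topN supOver
  exact Finset.le_sup (f := s) (Finset.mem_filter.2 ⟨mem_range.2 hb, h⟩)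

open Classical in
lemma edgeProg_spec {s : ℕ → ℕ} {a b : ℕ} (hn : σ.reg 0 = n) (hs : HasLevels G s σ)
    (h4 : σ.reg 4 = a) (h6 : σ.reg 6 = b) (h : G.adjN a b) :
    Runs edgeProg σ fun t σ' =>
      σ'.arr 8 = Function.update (σ.arr 8) (a * n + b) (if G.LevelCond s a b then 1 else 0) ∧
      t ≤ 60 := by
  obtain ⟨ha, hb, _⟩ := id h
  have hle := G.le_topN (s := s) h
  have h5 := hs.top a ha
  have hd := hs.better a b ha hb
  have hu := hs.notWorse a b ha hb
  simp only [edgeProg, Runs.seq_iff, Runs.put_iff, Runs.ite_iff, Runs.skip_iff, eval, h4, h6, hn,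
    State.setArr_reg, State.setArr_arr, hs.level, cost, Nat.reduceEqDiff, if_false,
    if_true, h5, hd, hu, Function.update_idem]
  refine ⟨fun h1 => ⟨fun h2 => ⟨fun h3 => ⟨fun h4 => ?_, fun h4 => ?_⟩, fun h3 => ?_⟩,
    fun h2 => ?_⟩, fun h1 => ?_⟩
  · rw [if_pos ⟨h1, Or.inr ⟨by omega, h4⟩⟩]; exact ⟨rfl, by norm_num⟩
  · rw [if_neg]
    · exact ⟨rfl, by norm_num⟩
    · rintro ⟨_, h | h⟩ <;> omega
  · rw [if_neg]
    · exact ⟨rfl, by norm_num⟩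
    · rintro ⟨_, h | h⟩ <;> omega
  · rw [if_pos ⟨h1, Or.inl (by omega)⟩]; exact ⟨rfl, by norm_num⟩
  · rw [if_neg fun h => h1 h.1]; exact ⟨rfl, by norm_num⟩

/-- Sets the flags of the edges of the level subgraph. -/
def edgesProg : Prog :=
  .for 4 (var 0) (.for 5 (get 2 (var 4))
    (seq (assign 6 (get 3 (add (mul (var 4) (var 0)) (var 5)))) edgeProg))

/-- The edges of the level subgraph, between nodes given by numbers. -/
def Instance.levelEdgeN (G : Instance (Fin n) (Fin n)) (s : ℕ → ℕ) (a b : ℕ) : Prop :=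
  G.adjN a b ∧ G.LevelCond s a b

lemma edgesProg_spec {s : ℕ → ℕ} (hI : HasInput G κ σ) (hL : HasLists G σ)
    (hs : HasLevels G s σ) :
    Runs edgesProg σ fun t σ' => HasGraph n (G.levelEdgeN s) G.nbrs σ' ∧
      t ≤ 100 * ∑ a ∈ range n, ((G.nbrs a).length + 1) + 10 := by
  classical
  refine (Runs.for n (fun a => 90 * (G.nbrs a).length + 10) (fun i σ' =>
    ∀ a, a < i → ∀ b ∈ G.nbrs a, G.LevelCond s a b ↔ 0 < σ'.arr 8 (a * n + b)) rfl
    (by simp) ?_ ?_).mono ?_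
  · intro i σ₁ hf hi _
    simp [eval, hf.reg 0 rfl, hI.size]
  · intro i σ₁ hf hi hin h1
    have e0 : σ₁.reg 0 = n := (hf.reg 0 rfl).trans hI.size
    refine (Runs.for (G.nbrs i).length (fun _ => 75) (fun j σ' =>
      (∀ a, a < i → ∀ b ∈ G.nbrs a, G.LevelCond s a b ↔ 0 < σ'.arr 8 (a * n + b)) ∧
      ∀ b ∈ (G.nbrs i).take j, G.LevelCond s i b ↔ 0 < σ'.arr 8 (i * n + b)) rfl
      ⟨h1, by simp⟩ ?_ ?_).mono ?_
    · intro j σ₂ hf₂ hj _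
      rw [eval, eval, hf₂.reg 4 rfl, hi, hf₂.arr 2 rfl, hf.arr 2 rfl, hL.deg i hin]
    · intro j σ₂ hf₂ hj hjn ⟨h2, h3⟩
      rw [Runs.seq_iff, Runs.assign_iff]
      have hlist : σ₂.arr 3 (σ₂.reg 4 * σ₂.reg 0 + σ₂.reg 5) = (G.nbrs i)[j] := by
        rw [hf₂.reg 4 rfl, hi, hf₂.reg 0 rfl, e0, hj, hf₂.arr 3 rfl, hf.arr 3 rfl]
        exact hL.list i hin j hjn
      have hadj := G.mem_nbrs.1 (List.getElem_mem hjn)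
      have hbn : (G.nbrs i)[j] < n := hadj.2.1
      refine (edgeProg_spec (σ := σ₂.setReg 6 (σ₂.arr 3 (σ₂.reg 4 * σ₂.reg 0 + σ₂.reg 5)))
        (s := s) (a := i) (b := (G.nbrs i)[j])
        (by simp [hf₂.reg 0 rfl, e0])
        (hs.congr ((hf₂.arr 4 rfl).trans (hf.arr 4 rfl)) ((hf₂.arr 5 rfl).trans (hf.arr 5 rfl))
          ((hf₂.arr 6 rfl).trans (hf.arr 6 rfl)) ((hf₂.arr 7 rfl).trans (hf.arr 7 rfl)))
        (by simp [hf₂.reg 4 rfl, hi]) (by simp [hlist]) hadj).mono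
        fun t σ₃ hf₃ ⟨h4, ht⟩ => ⟨⟨fun a ha b hb => ?_, fun b hb => ?_⟩, ?_⟩
      · have hb' : b < n := (G.mem_nbrs.1 hb).2.1
        rw [State.setReg_arr, h4, Function.update_of_ne]
        · exact h2 a ha b hb
        · intro e
          have := (index_inj hb' hbn e).1
          omega
      · rw [State.setReg_arr, h4]
        by_cases e : b = (G.nbrs i)[j]
        · subst e
          rw [Function.update_self]
          split_ifs with h <;> simp [h]
        · have hb' : b ∈ (G.nbrs i).take j := by
            rw [List.take_add_one, List.mem_append, List.getElem?_eq_getElem hjn] at hb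
            simpa [e] using hb
          have hbn' : b < n := (G.mem_nbrs.1 (List.mem_of_mem_take hb')).2.1
          rw [Function.update_of_ne]
          · exact h3 b hb'
          · exact fun e' => e (index_inj hbn' hbn e').2
      · simp only [cost]; omega
    · rintro t σ₂ - ⟨⟨h2, h3⟩, -, ht⟩
      refine ⟨fun a ha b hb => ?_, ?_⟩
      · rcases Nat.lt_succ_iff_lt_or_eq.1 ha with h4 | rfl
        · exact h2 a h4 b hb
        · rw [List.take_length] at h3
          exact h3 b hb
      · simp only [sum_const, card_range, smul_eq_mul, cost] at ht
        omega
  · rintro t σ₁ hf ⟨h1, -, ht⟩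
    refine ⟨⟨(hf.reg 0 rfl).trans hI.size, ?_, ?_, fun a b hb => (G.mem_nbrs.1 hb).2.1,
      fun a b h => G.mem_nbrs.2 h.1, fun a b ha hb => ?_⟩, ?_⟩
    · rw [hf.arr 2 rfl]; exact hL.deg
    · rw [hf.arr 3 rfl]; exact hL.list
    · rw [← h1 a ha b hb]
      exact ⟨fun h => h.2, fun h => ⟨G.mem_nbrs.1 hb, h⟩⟩
    · simp only [cost] at ht
      have : ∑ a ∈ range n, (90 * (G.nbrs a).length + 10 + (1 + 6)) ≤
          100 * ∑ a ∈ range n, ((G.nbrs a).length + 1) := by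
        rw [Finset.mul_sum]
        exact Finset.sum_le_sum fun a _ => by omega
      omega

/-- Sets register `5` to `1` if `e < e'` for some value of register `4` below `n`, and to `0`
otherwise. -/
def existsProg (e e' : Expr) : Prog :=
  seq (assign 5 (lit 0)) (.for 4 (var 0) (ite e e' (assign 5 (lit 1)) skip))

lemma existsProg_spec {e e' : Expr} (p : ℕ → Prop) (hn : σ.reg 0 = n)
    (hp : ∀ i σ', Frame (existsProg e e') σ σ' → σ'.reg 4 = i → i < n →
      (e.eval σ' < e'.eval σ' ↔ p i)) :
    Runs (existsProg e e') σ fun t σ' => (σ'.reg 5 = 0 ↔ ∀ i, i < n → ¬ p i) ∧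
      t ≤ n * (e.cost + e'.cost + 20) + 10 := by
  have hfr : ∀ {σ' : State}, Frame (.for 4 (var 0) (ite e e' (assign 5 (lit 1)) skip))
      (σ.setReg 5 0) σ' → Frame (existsProg e e') σ σ' := by
    refine fun {σ'} hf => ⟨fun x hx => ?_, fun r _ => ?_, fun _ => ?_⟩
    · simp only [existsProg, writesReg, Bool.or_eq_false_iff, decide_eq_false_iff_not] at hx
      rw [hf.reg x hx.2]
      simp [hx.1]
    · rw [hf.arr r (by simp [Prog.for, writesArr])]; rfl
    · rw [hf.out (by simp [Prog.for, emits])]; rfl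
  rw [existsProg, Runs.seq_iff, Runs.assign_iff]
  refine (Runs.for n (fun _ => e.cost + e'.cost + 5) (fun i σ' =>
    σ'.reg 5 = 0 ↔ ∀ j, j < i → ¬ p j) rfl (by simp [eval]) ?_ ?_).mono ?_
  · intro i σ₁ hf hi _
    simp [eval, hf.reg 0 rfl, hn]
  · intro i σ₁ hf hi hin h1
    rw [Runs.ite_iff, hp i σ₁ (hfr hf) hi hin]
    refine ⟨fun h => ?_, fun h => ?_⟩
    · rw [Runs.assign_iff]
      refine ⟨?_, by simp [cost]⟩
      simp [eval]
      exact ⟨i, le_rfl, h⟩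
    · rw [Runs.skip_iff]
      refine ⟨?_, by simp⟩
      simp only [State.setReg_reg, Nat.reduceEqDiff, if_false, h1]
      refine ⟨fun h2 j hj => ?_, fun h2 j hj => h2 j (by omega)⟩
      rcases Nat.lt_succ_iff_lt_or_eq.1 hj with h3 | rfl
      · exact h2 j h3
      · exact h
  · rintro t σ₁ - ⟨h1, -, ht⟩
    refine ⟨h1, ?_⟩
    simp only [sum_const, card_range, smul_eq_mul, cost] at ht ⊢
    have : n * (e.cost + e'.cost + 5 + (1 + 6)) ≤ n * (e.cost + e'.cost + 20) :=
      Nat.mul_le_mul_left _ (by omega)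
    omega

/-- Prints the value of `e` for all values of register `4` below `n`. -/
def printProg (e : Expr) : Prog := .for 4 (var 0) (emit e)

lemma printProg_spec {e : Expr} (f : ℕ → ℕ) (hn : σ.reg 0 = n)
    (hf : ∀ i σ', Frame (printProg e) σ σ' → σ'.reg 4 = i → i < n → e.eval σ' = f i) :
    Runs (printProg e) σ fun t σ' => σ'.out = σ.out ++ (List.range n).map f ∧
      t ≤ n * (e.cost + 20) + 10 := by
  refine (Runs.for n (fun _ => e.cost + 1) (fun i σ' =>
    σ'.out = σ.out ++ (List.range i).map f) rfl (by simp) ?_ ?_).mono ?_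
  · intro i σ₁ hf hi _
    simp [eval, hf.reg 0 rfl, hn]
  · intro i σ₁ hfr hi hin h1
    rw [Runs.emit_iff]
    refine ⟨?_, le_rfl⟩
    rw [hf i σ₁ hfr hi hin]
    simp [h1, List.range_succ]
  · rintro t σ₁ - ⟨h1, -, ht⟩
    refine ⟨h1, ?_⟩
    simp only [sum_const, card_range, smul_eq_mul, cost] at ht ⊢
    have : n * (e.cost + 1 + (1 + 6)) ≤ n * (e.cost + 20) := Nat.mul_le_mul_left _ (by omega)
    omega

/-! #### Relation to the algorithm -/

/-- The levels of the objects, from the numbers `s b = ℓ b + 1`. -/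
def levelOf (n : ℕ) (s : ℕ → ℕ) (b : Fin n) : ℕ := s b - 1

open Classical in
lemma Instance.levelEdgeN_iff {s : ℕ → ℕ} (hs : ∀ b, b < n → 1 ≤ s b) (a b : Fin n) :
    G.levelEdgeN s a b ↔ G.LevelEdge (levelOf n s) a b := by
  have hadj : ∀ a b : Fin n, G.adjN a b ↔ G.Adj a b := fun a b =>
    ⟨fun ⟨_, _, h⟩ => h, fun h => ⟨a.2, b.2, h⟩⟩
  have hpref : ∀ a b b' : Fin n, G.prefN a b b' ↔ G.pref a b b' := fun a b b' =>
    ⟨fun ⟨_, _, _, h⟩ => h, fun h => ⟨a.2, b.2, b'.2, h⟩⟩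
  have hsup : ∀ (P : ℕ → Prop) (v : ℕ), 0 < v →
      (supOver n P s < v ↔ ∀ b' : Fin n, P b' → s b' < v) := by
    intro P v hv
    rw [supOver, Finset.sup_lt_iff hv]
    refine ⟨fun h b' hb' => h b' (by simp [hb']), fun h b' hb' => ?_⟩
    rw [Finset.mem_filter, mem_range] at hb'
    exact h ⟨b', hb'.1⟩ hb'.2
  rw [levelEdgeN, hadj, levelEdge_iff]
  refine and_congr_right fun hab => ?_
  have hsb := hs b b.2
  have hle : s b ≤ G.topN s a := G.le_topN ((hadj a b).2 hab)
  have hlt : ∀ b' : Fin n, G.Adj a b' → s b' ≤ G.topN s a := fun b' h =>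
    G.le_topN ((hadj a b').2 h)
  obtain ⟨bm, hbm, hbe⟩ : ∃ bm : Fin n, G.Adj a bm ∧ s bm = G.topN s a := by
    by_contra hc
    push Not at hc
    have := (hsup (G.adjN a) (G.topN s a) (by omega)).2 fun b' hb' =>
      lt_of_le_of_ne (hlt b' ((hadj a b').1 hb')) (hc b' ((hadj a b').1 hb'))
    exact absurd this (lt_irrefl _)
  rw [LevelCond, betterN, notWorseN, hsup _ _ (by omega), hsup _ _ (by omega)]
  simp only [hadj, hpref, levelOf]
  constructor
  · rintro ⟨h1, h2⟩ b' hb'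
    have h3 := hlt b' hb'
    have h4 := hs b' b'.2
    have h5 := G.gain_le_one a b b'
    rcases h2 with h2 | ⟨h2, h6⟩
    · by_cases h7 : s b' < s b
      · omega
      · have := G.gain_le_zero.2 fun hp => h7 (h1 b' ⟨hb', hp⟩)
        omega
    · by_cases h7 : s b' < s b
      · omega
      · have h8 := G.gain_le_zero.2 fun hp => h7 (h1 b' ⟨hb', hp⟩)
        by_cases h9 : s b' < G.topN s a
        · omega
        · have : G.pref a b b' := by
            by_contra hp
            exact h9 (h6 b' ⟨hb', hp⟩)
          have := G.gain_le_neg_one.2 this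
          omega
  · intro h
    refine ⟨fun b' ⟨hb', hp⟩ => ?_, ?_⟩
    · have h1 := h b' hb'
      have h2 : ¬ G.gain a b b' ≤ 0 := fun h' => G.gain_le_zero.1 h' hp
      have := hs b' b'.2
      omega
    · have h1 := h bm hbm
      have h2 := G.neg_one_le_gain a b bm
      have h3 := hs bm bm.2
      by_cases h4 : s b = G.topN s a
      · exact Or.inl h4
      · refine Or.inr ⟨by omega, fun b' ⟨hb', hp⟩ => ?_⟩
        have h5 := h b' hb'
        have h6 : ¬ G.gain a b b' ≤ -1 := fun h' => hp (G.gain_le_neg_one.1 h')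
        have := hs b' b'.2
        omega

end IterationProgram

section MainProgram

open PopAssign.Prog PopAssign.Expr

variable {n κ k : ℕ} {G : Instance (Fin n) (Fin n)} {σ σ' : State} {R : ℕ → ℕ → Prop}
  {mA mB : ℕ → ℕ}

lemma ofFn_eq_map_range {α : Type*} (f : Fin n → α) (g : ℕ → α) (h : ∀ i : Fin n, f i = g i) :
    List.ofFn f = (List.range n).map g :=
  List.ext_getElem (by simp) fun i h1 h2 => by simp [h]

lemma Mates.encodeMatching_eq (h : Mates n R mA mB) :
    encodeMatching h.toPEquiv = (List.range n).map mA := by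
  refine ofFn_eq_map_range _ _ fun a => ?_
  rcases e : h.toPEquiv a with _ | b
  · rw [h.toPEquiv_eq_none] at e; simp [e]
  · rw [h.toPEquiv_eq_some] at e; simp [e]

lemma Mates.isPerfect_iff (h : Mates n R mA mB) :
    IsPerfect h.toPEquiv ↔ ∀ a, a < n → mA a ≠ 0 := by
  constructor
  · intro hp a ha h0
    have := hp.1 ⟨a, ha⟩
    rw [h.toPEquiv_eq_none.2 h0] at this
    simp at this
  · intro h0
    by_contra hp
    obtain ⟨a, ha⟩ := exists_unmatched rfl (M := h.toPEquiv.symm)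
      fun h' => hp ⟨h'.2, h'.1⟩
    exact h0 a a.2 (h.toPEquiv_eq_none.1 ha)

lemma Mates.raiseLevels_eq (h : Mates n R mA mB) {s : ℕ → ℕ} (hs : ∀ b, b < n → 1 ≤ s b) :
    raiseLevels (levelOf n s) h.toPEquiv =
      levelOf n (fun b => if b < n ∧ mB b = 0 then s b + 1 else s b) := by
  funext b
  have := hs b b.2
  by_cases hb : mB b = 0
  · simp [raiseLevels, levelOf, h.symm_eq_none.2 hb, hb]; omega
  · have : (h.toPEquiv.symm b).isSome :=
      Option.isSome_iff_ne_none.2 fun h' => hb (h.symm_eq_none.1 h')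
    simp [raiseLevels, levelOf, this, hb]

/-- The invariant of the main loop. Register `3` is `1` as long as the algorithm has not halted. -/
structure MainInv (G : Instance (Fin n) (Fin n)) (κ k : ℕ) (σ : State) : Prop where
  input : HasInput G κ σ
  lists : HasLists G σ
  root : σ.reg 2 = k
  levels : HasLevels G (σ.arr 4) σ
  one_le : ∀ b, b < n → 1 ≤ σ.arr 4 b
  le : σ.reg 3 ≠ 0 → ∀ b, b < n → σ.arr 4 b ≤ κ + 2
  run : ∃ cs : List (Conf (Fin n) (Fin n)), cs.IsChain (Step G (κ + 1)) ∧
    cs.head? = some Conf.start ∧ σ.out = cs.flatMap encodeConf ∧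
    (σ.reg 3 ≠ 0 → cs.getLast? = some (Conf.test (levelOf n (σ.arr 4)))) ∧
    (σ.reg 3 = 0 → ∃ o, cs.getLast? = some (Conf.halt o))

/-- The potential of the main loop. -/
noncomputable def mainPot (G : Instance (Fin n) (Fin n)) (κ T : ℕ) (σ : State) : ℕ :=
  if σ.reg 3 = 0 then 0 else (∑ b ∈ range n, (κ + 2 - σ.arr 4 b) + 1) * T +
    ∑ b ∈ range n, (κ + 2 - σ.arr 4 b) * bumpCost G b

/-- One iteration of the popular assignment algorithm. -/
def iterProg : Prog :=
  seq (existsProg (lit 0) (add (sub (get 4 (var 4)) (add (var 1) (lit 1)))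
      (sub (get 4 (var 4)) (var 0))))
    (ite (lit 0) (var 5)
      (seq (emit (lit 0)) (assign 3 (lit 0)))
      (seq edgesProg (seq matchProg (seq (emit (lit 2))
        (seq (printProg (sub (get 4 (var 4)) (lit 1))) (seq (printProg (get 9 (var 4)))
          (seq (existsProg (get 9 (var 4)) (lit 1))
            (ite (lit 0) (var 5) raiseProg
              (seq (emit (lit 1)) (seq (printProg (get 9 (var 4))) (assign 3 (lit 0))))))))))))

lemma isChain_concat {α : Type*} {r : α → α → Prop} {l : List α} {x y : α} (h : l.IsChain r)
    (hx : l.getLast? = some x) (hxy : r x y) : (l ++ [y]).IsChain r := by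
  rw [List.isChain_append]
  refine ⟨h, by simp, fun a ha b hb => ?_⟩
  rw [hx, Option.mem_some_iff] at ha
  simp only [List.head?_cons, Option.mem_some_iff] at hb
  subst ha hb
  exact hxy

lemma iterProg_spec (hn : 0 < n) (hk0 : 0 < k) (hnk : n ≤ k * k) (hI : MainInv G κ k σ)
    (h3 : σ.reg 3 ≠ 0) {T : ℕ} (hT : 4000 * (k * ∑ a ∈ range n, ((G.nbrs a).length + 1)) ≤ T) :
    Runs iterProg σ fun t σ' => MainInv G κ k σ' ∧ 3 + t + mainPot G κ T σ' ≤ mainPot G κ T σ := by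
  set S := ∑ a ∈ range n, ((G.nbrs a).length + 1) with hS
  have hnS : n ≤ S := by rw [hS, Finset.sum_add_distrib]; simp
  have hSk : S ≤ k * S := Nat.le_mul_of_pos_left _ hk0
  obtain ⟨cs, hc1, hc2, hc3, hc4, -⟩ := hI.run
  have hc4 := hc4 h3
  have hpot : T ≤ mainPot G κ T σ := by
    rw [mainPot, if_neg h3, Nat.add_mul]; omega
  rw [iterProg, Runs.seq_iff]
  refine (existsProg_spec (fun i => κ + 1 < σ.arr 4 i ∨ n < σ.arr 4 i) hI.input.size
    fun i σ₁ hf hi hin => ?_).mono fun t₁ σ₁ hf₁ ⟨h5, ht₁⟩ => ?_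
  · simp only [eval, hi, hf.reg 1 rfl, hf.reg 0 rfl, hf.arr 4 rfl, hI.input.size, hI.input.penalty]
    omega
  have hI₁ : HasInput G κ σ₁ :=
    hI.input.congr (hf₁.reg 0 rfl) (hf₁.reg 1 rfl) (hf₁.arr 0 rfl) (hf₁.arr 1 rfl)
  have hL₁ : HasLists G σ₁ :=
    ⟨by rw [hf₁.arr 2 rfl]; exact hI.lists.deg, by rw [hf₁.arr 3 rfl]; exact hI.lists.list⟩
  have hV₁ : HasLevels G (σ.arr 4) σ₁ :=
    hI.levels.congr (hf₁.arr 4 rfl) (hf₁.arr 5 rfl) (hf₁.arr 6 rfl) (hf₁.arr 7 rfl)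
  have hguard : (∀ i, i < n → ¬ (κ + 1 < σ.arr 4 i ∨ n < σ.arr 4 i)) ↔
      ∀ b : Fin n, levelOf n (σ.arr 4) b < Fintype.card (Fin n) ∧
        levelOf n (σ.arr 4) b < κ + 1 := by
    simp only [Fintype.card_fin, levelOf]
    refine ⟨fun h b => ?_, fun h i hi => ?_⟩
    · have := h b b.2
      have := hI.one_le b b.2
      omega
    · have h6 := h ⟨i, hi⟩
      have := hI.one_le i hi
      simp only at h6
      omega
  rw [hguard] at h5
  simp only [cost] at ht₁
  rw [Runs.ite_iff]
  refine ⟨fun h => ?_, fun h => ?_⟩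
  · simp only [eval] at h
    have hstep := Step.exit (G := G) (t := κ + 1) _ fun h' => by have := h5.2 h'; omega
    simp only [Runs.seq_iff, Runs.emit_iff, Runs.assign_iff, eval]
    refine ⟨⟨hI₁.congr rfl rfl rfl rfl, ⟨hL₁.deg, hL₁.list⟩, ?_, ?_, ?_, ?_, ?_⟩, ?_⟩
    · simp [hf₁.reg 2 rfl, hI.root]
    · have := hV₁.level
      simp only [State.setReg_arr, State.print_arr, this]
      exact hV₁.congr rfl rfl rfl rfl
    · simpa [hV₁.level] using hI.one_le
    · simp
    · refine ⟨cs ++ [Conf.halt none], isChain_concat hc1 hc4 hstep, ?_, ?_, by simp, by simp⟩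
      · rw [List.head?_append, hc2]; rfl
      · simp [hf₁.out rfl, hc3, encodeConf]
    · rw [mainPot, if_pos (by simp)]
      simp only [cost]
      omega
  · simp only [eval, not_lt, nonpos_iff_eq_zero] at h
    have hg := h5.1 h
    have hle : ∀ b, b < n → σ.arr 4 b ≤ κ + 1 := fun b hb => by
      have := hguard.2 hg b hb
      omega
    rw [Runs.seq_iff]
    refine (edgesProg_spec hI₁ hL₁ hV₁).mono fun t₂ σ₂ hf₂ ⟨hG₂, ht₂⟩ => ?_
    rw [Runs.seq_iff]
    refine (matchProg_spec hG₂ (by rw [hf₂.reg 2 rfl, hf₁.reg 2 rfl, hI.root]) hk0 hnk hn).mono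
      fun t₃ σ₃ hf₃ ⟨hM, hmax, ht₃⟩ => ?_
    have hmaxm : IsMaximumMatching (G.LevelEdge (levelOf n (σ.arr 4))) hM.toPEquiv := by
      have := hM.isMaximum hmax
      have e : (fun a b : Fin n => G.levelEdgeN (σ.arr 4) a b) =
          G.LevelEdge (levelOf n (σ.arr 4)) := by
        funext a b
        exact propext (G.levelEdgeN_iff hI.one_le a b)
      rwa [e] at this
    have hstep := Step.enter (G := G) (t := κ + 1) _ _ hg hmaxm
    have f4 : σ₃.arr 4 = σ.arr 4 := by rw [hf₃.arr 4 rfl, hf₂.arr 4 rfl, hf₁.arr 4 rfl]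
    have e0 : σ₃.reg 0 = n := by rw [hf₃.reg 0 rfl, hf₂.reg 0 rfl, hI₁.size]
    rw [Runs.seq_iff, Runs.emit_iff, Runs.seq_iff]
    refine (printProg_spec (n := n) (fun b => σ.arr 4 b - 1) (by simpa using e0)
      fun i σ₄ hf hi hin => ?_).mono fun t₄ σ₄ hf₄ ⟨ho₄, ht₄⟩ => ?_
    · simp [eval, hi, hf.arr 4 rfl, f4]
    rw [Runs.seq_iff]
    refine (printProg_spec (n := n) (σ₃.arr 9) (by simpa [hf₄.reg 0 rfl] using e0)
      fun i σ₅ hf hi hin => ?_).mono fun t₅ σ₅ hf₅ ⟨ho₅, ht₅⟩ => ?_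
    · simp [eval, hi, hf.arr 9 rfl, hf₄.arr 9 rfl]
    have e5 : σ₅.reg 0 = n := by rw [hf₅.reg 0 rfl, hf₄.reg 0 rfl]; simpa using e0
    rw [Runs.seq_iff]
    refine (existsProg_spec (fun a => σ₃.arr 9 a = 0) e5 fun i σ₆ hf hi hin => ?_).mono
      fun t₆ σ₆ hf₆ ⟨h6, ht₆⟩ => ?_
    · simp [eval, hi, hf.arr 9 rfl, hf₅.arr 9 rfl, hf₄.arr 9 rfl]
    have hperf := h6.trans hM.isPerfect_iff.symm
    have hregs : ∀ x, x < 4 → σ₆.reg x = σ.reg x := fun x hx => by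
      interval_cases x <;>
        rw [hf₆.reg _ rfl, hf₅.reg _ rfl, hf₄.reg _ rfl, State.print_reg, hf₃.reg _ rfl,
          hf₂.reg _ rfl, hf₁.reg _ rfl]
    have harrs : ∀ x, x < 8 → σ₆.arr x = σ.arr x := fun x hx => by
      interval_cases x <;>
        rw [hf₆.arr _ rfl, hf₅.arr _ rfl, hf₄.arr _ rfl, State.print_arr, hf₃.arr _ rfl,
          hf₂.arr _ rfl, hf₁.arr _ rfl]
    have h9 : ∀ x, 9 ≤ x → x < 11 → σ₆.arr x = σ₃.arr x := fun x hx hx' => by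
      interval_cases x <;>
        rw [hf₆.arr _ rfl, hf₅.arr _ rfl, hf₄.arr _ rfl, State.print_arr]
    have hI₆ : HasInput G κ σ₆ := hI.input.congr (hregs 0 (by omega)) (hregs 1 (by omega))
      (harrs 0 (by omega)) (harrs 1 (by omega))
    have hV₆ : HasLevels G (σ.arr 4) σ₆ := hI.levels.congr (harrs 4 (by omega))
      (harrs 5 (by omega)) (harrs 6 (by omega)) (harrs 7 (by omega))
    have hL₆ : HasLists G σ₆ := ⟨by rw [harrs 2 (by omega)]; exact hI.lists.deg,
      by rw [harrs 3 (by omega)]; exact hI.lists.list⟩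
    have hc5 := isChain_concat hc1 hc4 hstep
    have hout : σ₆.out =
        (cs ++ [Conf.matched (levelOf n (σ.arr 4)) hM.toPEquiv]).flatMap encodeConf := by
      rw [hf₆.out rfl, ho₅, ho₄, State.print_out, hf₃.out rfl, hf₂.out rfl, hf₁.out rfl, hc3]
      simp only [List.flatMap_append, List.flatMap_singleton, encodeConf, hM.encodeMatching_eq,
        eval, List.append_assoc]
      rw [ofFn_eq_map_range (levelOf n (σ.arr 4)) (fun b => σ.arr 4 b - 1) fun _ => rfl]
      simp
    simp only [cost] at ht₂ ht₃ ht₄ ht₅ ht₆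
    rw [← hS] at ht₂ ht₃
    rw [Runs.ite_iff]
    refine ⟨fun h7 => ?_, fun h7 => ?_⟩
    · simp only [eval] at h7
      have hnp : ¬ IsPerfect hM.toPEquiv := fun hp => by have := hperf.2 hp; omega
      refine (raiseProg_spec hI₆ hV₆).mono fun t₇ σ₇ hf₇ ⟨hV₇, ht₇⟩ => ?_
      rw [h9 10 (by omega) (by omega)] at hV₇ ht₇
      have e3 : σ₇.reg 3 = σ.reg 3 := (hf₇.reg 3 rfl).trans (hregs 3 (by omega))
      have hlev : ∀ b, b < n → σ₇.arr 4 b =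
          if σ₃.arr 10 b = 0 then σ.arr 4 b + 1 else σ.arr 4 b := fun b hb => by
        simp [hV₇.level, hb]
      refine ⟨⟨hI₆.congr (hf₇.reg 0 rfl) (hf₇.reg 1 rfl) (hf₇.arr 0 rfl) (hf₇.arr 1 rfl),
        ⟨by rw [hf₇.arr 2 rfl]; exact hL₆.deg, by rw [hf₇.arr 3 rfl]; exact hL₆.list⟩,
        ?_, hV₇.level ▸ hV₇, fun b hb => ?_, fun _ b hb => ?_, ?_⟩, ?_⟩
      · rw [hf₇.reg 2 rfl, hregs 2 (by omega), hI.root]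
      · have := hI.one_le b hb
        rw [hlev b hb]; split_ifs <;> omega
      · have := hle b hb
        rw [hlev b hb]; split_ifs <;> omega
      · refine ⟨_, isChain_concat hc5 List.getLast?_concat (Step.raise _ _ hnp), ?_, ?_, fun _ => ?_,
          fun h' => absurd (e3.symm.trans h') h3⟩
        · rw [List.append_assoc, List.head?_append, hc2]; rfl
        · rw [hf₇.out rfl, hout, List.flatMap_append (ys := [_])]
          simp [encodeConf]
        · rw [List.getLast?_concat, hM.raiseLevels_eq hI.one_le, hV₇.level]
      · rw [mainPot, mainPot, e3, if_neg h3, if_neg h3]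
        have h8 : ∑ b ∈ range n, (κ + 2 - σ₇.arr 4 b) +
            ∑ b ∈ range n, (if σ₃.arr 10 b = 0 then 1 else 0) =
            ∑ b ∈ range n, (κ + 2 - σ.arr 4 b) := by
          rw [← Finset.sum_add_distrib]
          refine Finset.sum_congr rfl fun b hb => ?_
          have := hle b (mem_range.1 hb)
          rw [hlev b (mem_range.1 hb)]; split_ifs <;> omega
        have h10 : ∑ b ∈ range n, (κ + 2 - σ₇.arr 4 b) * bumpCost G b +
            ∑ b ∈ range n, (if σ₃.arr 10 b = 0 then bumpCost G b else 0) =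
            ∑ b ∈ range n, (κ + 2 - σ.arr 4 b) * bumpCost G b := by
          rw [← Finset.sum_add_distrib]
          refine Finset.sum_congr rfl fun b hb => ?_
          have := hle b (mem_range.1 hb)
          rw [hlev b (mem_range.1 hb)]
          split_ifs
          · have e : κ + 2 - σ.arr 4 b = κ + 2 - (σ.arr 4 b + 1) + 1 := by omega
            rw [e, Nat.add_mul, Nat.one_mul]
          · simp
        have h11 : 1 ≤ ∑ b ∈ range n, (if σ₃.arr 10 b = 0 then 1 else 0) := by
          obtain ⟨b, hb⟩ := exists_unmatched rfl hnp
          refine Finset.sum_pos' (fun _ _ => Nat.zero_le _) ⟨b, mem_range.2 b.2, ?_⟩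
          rw [if_pos (hM.symm_eq_none.1 hb)]; exact Nat.one_pos
        have h12 : (∑ b ∈ range n, (κ + 2 - σ₇.arr 4 b) + 1) * T + T ≤
            (∑ b ∈ range n, (κ + 2 - σ.arr 4 b) + 1) * T := by
          rw [← Nat.succ_mul]
          exact Nat.mul_le_mul_right _ (by omega)
        rw [Finset.sum_add_distrib] at ht₇
        simp only [sum_const, card_range, smul_eq_mul] at ht₇
        simp only [cost]
        omega
    · simp only [eval, not_lt, nonpos_iff_eq_zero] at h7
      have hp : IsPerfect hM.toPEquiv := hperf.1 h7
      rw [Runs.seq_iff, Runs.emit_iff, Runs.seq_iff]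
      refine (printProg_spec (n := n) (σ₃.arr 9) (by simpa using hI₆.size)
        fun i σ₇ hf hi hin => ?_).mono fun t₇ σ₇ hf₇ ⟨ho₇, ht₇⟩ => ?_
      · simp [eval, hi, hf.arr 9 rfl, h9 9 le_rfl (by omega)]
      have hV₇ : HasLevels G (σ.arr 4) σ₇ :=
        hV₆.congr (hf₇.arr 4 rfl) (hf₇.arr 5 rfl) (hf₇.arr 6 rfl) (hf₇.arr 7 rfl)
      rw [Runs.assign_iff]
      refine ⟨⟨hI₆.congr (by simp [hf₇.reg 0 rfl]) (by simp [hf₇.reg 1 rfl]) (hf₇.arr 0 rfl)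
        (hf₇.arr 1 rfl), ⟨?_, ?_⟩, ?_, ?_, ?_, ?_, ?_⟩, ?_⟩
      · rw [State.setReg_arr, hf₇.arr 2 rfl]; exact hL₆.deg
      · rw [State.setReg_arr, hf₇.arr 3 rfl]; exact hL₆.list
      · simp [hf₇.reg 2 rfl, hregs 2 (by omega), hI.root]
      · have := hV₇.level
        simp only [State.setReg_arr, this]
        exact hV₇.congr rfl rfl rfl rfl
      · simpa [hV₇.level] using hI.one_le
      · simp [eval]
      · refine ⟨_, isChain_concat hc5 List.getLast?_concat (Step.accept _ _ hp), ?_, ?_,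
          by simp [eval], by simp⟩
        · rw [List.append_assoc, List.head?_append, hc2]; rfl
        · rw [State.setReg_out, ho₇, State.print_out, hout, List.flatMap_append (ys := [_])]
          simp [encodeConf, hM.encodeMatching_eq, eval]
      · rw [mainPot, if_pos (by simp [eval])]
        simp only [cost] at ht₇ ⊢
        omega

/-- Computes the least number in register `2` whose square is at least `n`. -/
def rootProg : Prog := loop (mul (var 2) (var 2)) (var 0) (assign 2 (add (var 2) (lit 1)))

lemma rootProg_spec (hn : σ.reg 0 = n) (h2 : σ.reg 2 = 0) :
    Runs rootProg σ fun t σ' => n ≤ σ'.reg 2 * σ'.reg 2 ∧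
      (σ'.reg 2 - 1) * (σ'.reg 2 - 1) ≤ n ∧ σ'.reg 2 ≤ n ∧ t ≤ 20 * n + 10 := by
  refine (Runs.loop (fun σ => σ.reg 0 = n ∧ (σ.reg 2 - 1) * (σ.reg 2 - 1) ≤ n ∧ σ.reg 2 ≤ n)
    (fun σ => 20 * (n - σ.reg 2)) ⟨hn, by simp [h2], by simp [h2]⟩ ?_).mono ?_
  · rintro σ ⟨hn, h1, h2⟩ hlt
    simp only [eval, hn] at hlt
    have h3 : σ.reg 2 < n := lt_of_le_of_lt (Nat.le_mul_self _) hlt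
    rw [Runs.assign_iff]
    simp [eval, cost, hn]
    omega
  · rintro t σ' - ⟨⟨h0, h1, h2⟩, h3, h4⟩
    simp only [eval, h0, not_lt] at h3
    simp only [cost] at h4
    exact ⟨h3, h1, h2, by omega⟩

/-- The implementation of the truncated popular assignment algorithm. -/
def mainProg : Prog :=
  seq listsProg (seq rootProg (seq raiseProg (seq (assign 3 (lit 1))
    (loop (lit 0) (var 3) iterProg))))

open Classical in
lemma sum_length_nbrs : ∑ a ∈ range n, (G.nbrs a).length = G.numEdges := by
  have h1 : ∀ a, (G.nbrs a).length = ∑ b ∈ range n, if G.adjN a b then 1 else 0 := fun a => by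
    rw [← Finset.card_filter]; rfl
  have hadj : ∀ a b : Fin n, G.adjN a b ↔ G.Adj a b := fun a b =>
    ⟨fun ⟨_, _, h⟩ => h, fun h => ⟨a.2, b.2, h⟩⟩
  rw [Instance.numEdges, Finset.card_filter, Fintype.sum_prod_type, Finset.sum_range]
  refine Finset.sum_congr rfl fun a _ => ?_
  rw [h1, Finset.sum_range]
  exact Finset.sum_congr rfl fun b _ => by simp [hadj]

open Classical in
lemma sum_bumpCost : ∑ b ∈ range n, bumpCost G b =
    30 * (n * n) + G.numEdges * (100 * n + 50) + 30 * n := by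
  have h1 : ∀ a, (∑ b ∈ range n, if G.adjN a b then 100 * n + 50 else 0) =
      (G.nbrs a).length * (100 * n + 50) := fun a => by
    rw [← Finset.sum_filter, Finset.sum_const, smul_eq_mul]; rfl
  simp only [bumpCost]
  rw [Finset.sum_add_distrib, Finset.sum_comm]
  simp only [Finset.sum_add_distrib, h1, ← Finset.sum_mul, sum_length_nbrs]
  simp
  ring

lemma mainProg_spec (hκ : 0 < κ) (hn : 0 < n) (hm : n ≤ G.numEdges) :
    Runs mainProg (inputState G κ) fun t σ' => ∃ k, k ≤ n ∧ (k - 1) * (k - 1) ≤ n ∧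
      t ≤ 40000 * (κ * n * G.numEdges * k) ∧
      ∃ cs : List (Conf (Fin n) (Fin n)), IsCompleteRun G (κ + 1) cs ∧
        σ'.out = cs.flatMap encodeConf := by
  have hI := hasInput_inputState (G := G) (κ := κ)
  have hz : ∀ r, 2 ≤ r → (inputState G κ).arr r = fun _ => 0 := fun r hr => by
    funext i
    simp only [inputState]
    rw [if_neg (by omega), if_neg (by omega)]
  have hzr : ∀ x, 2 ≤ x → (inputState G κ).reg x = 0 := fun x hx => by
    simp only [inputState]
    rw [if_neg (by omega), if_neg (by omega)]
  rw [mainProg, Runs.seq_iff]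
  refine (listsProg_spec hI fun a => by rw [hz 2 le_rfl]).mono fun t₁ σ₁ hf₁ ⟨hL₁, ht₁⟩ => ?_
  rw [Runs.seq_iff]
  refine (rootProg_spec ((hf₁.reg 0 rfl).trans hI.size)
    ((hf₁.reg 2 rfl).trans (hzr 2 le_rfl))).mono fun t₂ σ₂ hf₂ ⟨hk1, hk2, hk3, ht₂⟩ => ?_
  generalize hk : σ₂.reg 2 = k at *
  have hk0 : 0 < k := Nat.pos_of_ne_zero (by rintro rfl; omega)
  have harr : ∀ r, 4 ≤ r → r < 11 → σ₂.arr r = fun _ => 0 := fun r hr hr' => by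
    rw [← hz r (by omega)]
    interval_cases r <;> rw [hf₂.arr _ rfl, hf₁.arr _ rfl]
  have hI₂ : HasInput G κ σ₂ := hI.congr ((hf₂.reg 0 rfl).trans (hf₁.reg 0 rfl))
    ((hf₂.reg 1 rfl).trans (hf₁.reg 1 rfl)) ((hf₂.arr 0 rfl).trans (hf₁.arr 0 rfl))
    ((hf₂.arr 1 rfl).trans (hf₁.arr 1 rfl))
  have hsup : ∀ P : ℕ → Prop, Instance.supOver n P (fun _ => 0) = 0 := fun P =>
    Nat.eq_zero_of_le_zero (Finset.sup_le fun _ _ => le_rfl)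
  have hV₂ : HasLevels G (fun _ => 0) σ₂ := by
    refine ⟨harr 4 le_rfl (by omega), fun a _ => ?_, fun a b _ _ => ?_, fun a b _ _ => ?_⟩
    · rw [harr 5 (by omega) (by omega)]; exact (hsup _).symm
    · rw [harr 6 (by omega) (by omega)]; exact (hsup _).symm
    · rw [harr 7 (by omega) (by omega)]; exact (hsup _).symm
  rw [Runs.seq_iff]
  refine (raiseProg_spec hI₂ hV₂).mono fun t₃ σ₃ hf₃ ⟨hV₃, ht₃⟩ => ?_
  simp only [harr 10 (by omega) (by omega), and_true, if_true] at hV₃ ht₃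
  have hlev : ∀ b, b < n → σ₃.arr 4 b = 1 := fun b hb => by simp [hV₃.level, hb]
  set S := ∑ a ∈ range n, ((G.nbrs a).length + 1) with hS
  have hSm : S = G.numEdges + n := by
    rw [hS, Finset.sum_add_distrib, sum_length_nbrs]; simp
  rw [Runs.seq_iff, Runs.assign_iff]
  have hI₃ : HasInput G κ σ₃ := hI₂.congr (hf₃.reg 0 rfl) (hf₃.reg 1 rfl) (hf₃.arr 0 rfl)
    (hf₃.arr 1 rfl)
  have hinv : MainInv G κ k (σ₃.setReg 3 1) := by
    refine ⟨hI₃.congr rfl rfl rfl rfl, ⟨?_, ?_⟩, ?_, ?_, ?_, ?_, ?_⟩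
    · rw [State.setReg_arr, hf₃.arr 2 rfl, hf₂.arr 2 rfl]; exact hL₁.deg
    · rw [State.setReg_arr, hf₃.arr 3 rfl, hf₂.arr 3 rfl]; exact hL₁.list
    · simp [hf₃.reg 2 rfl, hk]
    · have := hV₃.level
      simp only [State.setReg_arr, this]
      exact hV₃.congr rfl rfl rfl rfl
    · intro b hb; simp [hlev b hb]
    · intro _ b hb; simp [hlev b hb]
    · refine ⟨[Conf.start], by simp, rfl, ?_, fun _ => ?_, by simp⟩
      · rw [State.setReg_out, hf₃.out rfl, hf₂.out rfl, hf₁.out rfl]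
        simp [inputState, Conf.start, encodeConf]
      · simp only [List.getLast?_singleton, Conf.start, State.setReg_arr]
        congr 2
        funext b
        simp [levelOf, hlev b b.2]
  refine (Runs.loop (σ := σ₃.setReg 3 1) (MainInv G κ k) (mainPot G κ (4000 * (k * S))) hinv
    fun σ' hI' hlt => ?_).mono ?_
  · simp only [eval] at hlt
    exact iterProg_spec hn hk0 hk1 hI' (by omega) le_rfl
  · rintro t σ' - ⟨hI', h0, ht⟩
    simp only [eval] at h0
    obtain ⟨cs, hc1, hc2, hc3, -, hc4⟩ := hI'.run
    refine ⟨k, hk3, hk2, ?_, cs, ⟨hc1, hc2, hc4 (by omega)⟩, hc3⟩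
    have hpot : mainPot G κ (4000 * (k * S)) (σ₃.setReg 3 1) =
        (n * (κ + 1) + 1) * (4000 * (k * S)) + (κ + 1) * ∑ b ∈ range n, bumpCost G b := by
      rw [mainPot, if_neg (by simp), Finset.mul_sum (range n) (fun b => bumpCost G b) (κ + 1)]
      congr 1
      · rw [Finset.sum_congr rfl (g := fun _ => κ + 1) fun b hb => by
          rw [State.setReg_arr, hlev b (mem_range.1 hb)]; omega]
        simp
      · exact Finset.sum_congr rfl fun b hb => by
          rw [State.setReg_arr, hlev b (mem_range.1 hb)]; rfl
    rw [hpot] at ht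
    rw [Finset.sum_add_distrib] at ht₃
    simp only [sum_const, card_range, smul_eq_mul, sum_bumpCost] at ht₃ ht
    rw [hSm] at ht
    simp only [cost] at ht
    generalize G.numEdges = m at *
    obtain ⟨x, rfl⟩ : ∃ x, κ = x + 1 := ⟨κ - 1, by omega⟩
    have a1 : n * m ≤ n * m * k := Nat.le_mul_of_pos_right _ hk0
    have a2 : n * n ≤ n * m := Nat.mul_le_mul_left _ hm
    have a3 : n ≤ n * n := Nat.le_mul_self n
    have a4 : m ≤ n * m := Nat.le_mul_of_pos_left _ hn
    have a5 : k * (m + n) ≤ 2 * (m * k) := by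
      have := Nat.mul_le_mul_left k hm
      rw [Nat.mul_add, mul_comm m k]; omega
    have a6 : m * k ≤ n * m * k := Nat.mul_le_mul_right _ a4
    have a7 : (n * (x + 1 + 1) + 1) * (4000 * (k * (m + n))) ≤
        (n * (3 * (x + 1))) * (4000 * (2 * (m * k))) :=
      Nat.mul_le_mul (by nlinarith) (Nat.mul_le_mul_left _ a5)
    have a8 : (n * (3 * (x + 1))) * (4000 * (2 * (m * k))) = 24000 * ((x + 1) * n * m * k) := by
      ring
    have a9 : 30 * (n * n) + m * (100 * n + 50) + 30 * n ≤ 210 * (n * m * k) := by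
      have : m * (100 * n + 50) = 100 * (n * m) + 50 * m := by ring
      omega
    have a10 : (x + 1 + 1) * (30 * (n * n) + m * (100 * n + 50) + 30 * n) ≤
        (2 * (x + 1)) * (210 * (n * m * k)) := Nat.mul_le_mul (by omega) a9
    have a11 : (2 * (x + 1)) * (210 * (n * m * k)) = 420 * ((x + 1) * n * m * k) := by ring
    have a12 : n * m * k ≤ (x + 1) * n * m * k := by
      have : (x + 1) * n * m * k = (x + 1) * (n * m * k) := by ring
      rw [this]; exact Nat.le_mul_of_pos_left _ (by omega)
    simp only [cost]
    omega

lemma mainProg_tame : mainProg.tame 30 = true := by decide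

lemma inputState_bounded : (inputState G κ).Bounded (n + κ + 2) := by
  constructor
  · intro x
    simp only [inputState]
    split_ifs <;> omega
  · intro r i
    simp only [inputState]
    split_ifs <;> omega

lemma numEdges_le : G.numEdges ≤ n * n := by
  classical
  rw [Instance.numEdges]
  refine (Finset.card_le_univ _).trans ?_
  simp

lemma root_le (hn : 0 < n) (hk : (k - 1) * (k - 1) ≤ n) :
    (n : ℝ) * k ≤ 2 * (n : ℝ) ^ (3 / 2 : ℝ) := by
  have hn' : (1 : ℝ) ≤ n := by exact_mod_cast hn
  have h1 : (n : ℝ) ^ (3 / 2 : ℝ) = n * √n := by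
    rw [Real.sqrt_eq_rpow, ← Real.rpow_one_add' (by positivity) (by norm_num)]
    norm_num
  have h2 : ((k - 1 : ℕ) : ℝ) ≤ √n := Real.le_sqrt_of_sq_le (by rw [sq]; exact_mod_cast hk)
  have h3 : (k : ℝ) ≤ ((k - 1 : ℕ) : ℝ) + 1 := by
    have : k ≤ k - 1 + 1 := by omega
    exact_mod_cast this
  have h4 : (1 : ℝ) ≤ √n := Real.one_le_sqrt.2 hn'
  rw [h1]
  nlinarith

theorem executesWithin_mainProg (hκ : 0 < κ) (hn : 0 < n) (hm : n ≤ G.numEdges) :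
    ExecutesWithin mainProg ((n + κ + 2) ^ 600) G κ (κ + 1)
      (80000 * (κ * G.numEdges * (n : ℝ) ^ (3 / 2 : ℝ))) := by
  obtain ⟨t, σ, hrun, k, hk1, hk2, ht, cs, hcs, hout⟩ := mainProg_spec (G := G) hκ hn hm
  refine ⟨σ, t, (hrun.exec (D := 30) (n + κ + 2) mainProg_tame inputState_bounded
    (by omega) ?_).1, ?_, cs, hcs, hout⟩
  · set N := n + κ + 2 with hN
    have h1 : κ * n * G.numEdges * k ≤ N * N * (N * N) * N := by
      have hnN : n ≤ N := by omega
      refine Nat.mul_le_mul (Nat.mul_le_mul (Nat.mul_le_mul (by omega) hnN) ?_) (hk1.trans hnN)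
      exact numEdges_le.trans (Nat.mul_le_mul hnN hnN)
    have h2 : 4 ≤ N := by omega
    have h3 : 4 ^ 8 ≤ N ^ 8 := Nat.pow_le_pow_left h2 8
    have h4 : N ≤ N * N * (N * N) * N := Nat.le_mul_of_pos_left _ (by positivity)
    have h5 : N + t ≤ N ^ 20 := by
      calc N + t ≤ 4 ^ 8 * (N * N * (N * N) * N) := by omega
        _ ≤ N ^ 8 * (N * N * (N * N) * N) := Nat.mul_le_mul_right _ h3
        _ = N ^ 13 := by ring
        _ ≤ N ^ 20 := Nat.pow_le_pow_right (by omega) (by norm_num)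
    calc (N + t) ^ 30 ≤ (N ^ 20) ^ 30 := Nat.pow_le_pow_left h5 30
      _ = N ^ 600 := by rw [← pow_mul]
  · have h1 : (t : ℝ) ≤ 40000 * (κ * n * G.numEdges * k) := by exact_mod_cast ht
    have h2 := mul_le_mul_of_nonneg_left (root_le hn hk2)
      (by positivity : (0 : ℝ) ≤ 40000 * (κ * G.numEdges))
    linarith

end MainProgram

end PopAssign

theorem mainTheorem9 :
    -- correctness, for every choice of the maximum matchings
    (∀ (A B : Type*) [Fintype A] [Fintype B] (G : PopAssign.Instance A B) (κ : ℕ),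
      Fintype.card A = Fintype.card B → 0 < κ →
      PopAssign.AlwaysHaltsWith G (κ + 1)
        (fun o =>
          (∀ M, o = some M → G.IsAssignment M ∧ G.PopularWithPenalty κ M) ∧
          ((∃ M, G.IsAssignment M ∧ G.PopularWithPenalty κ M) → o ≠ none))
        PopAssign.Conf.start) ∧
    -- running time, on a word RAM with words of logarithmic length
    (∃ (p : PopAssign.Prog) (C : ℝ) (c : ℕ),
      ∀ (n κ : ℕ) (G : PopAssign.Instance (Fin n) (Fin n)),
        0 < n → 0 < κ → n ≤ G.numEdges →
        PopAssign.ExecutesWithin p ((n + κ + 2) ^ c) G κ (κ + 1)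
          (C * (κ * G.numEdges * (n : ℝ) ^ (3 / 2 : ℝ)))) := by
  exact ⟨fun A B _ _ G κ hcard _ => PopAssign.alwaysHaltsWith G κ hcard,
    PopAssign.mainProg, 80000, 600, fun n κ G hn hκ hm =>
      PopAssign.executesWithin_mainProg hκ hn hm⟩
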